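/- Let $k\ge 5$ and let $F_k$ be the wedge over a $(k-2)$-gon: the combinatorial type of $3$-polytope with the $2k-6$ vertices $N,S,p_0,\dots,p_{k-5},q_0,\dots,q_{k-5}$ whose facets are the two $(k-2)$-gons $S p_0\cdots p_{k-5}N$ and $S q_0\cdots q_{k-5}N$, the two triangles $S p_0q_0$ and $N p_{k-5}q_{k-5}$, and the $k-5$ quadrilaterals $p_ip_{i+1}q_{i+1}q_i$. Realizations are vertex-labelled, and realization spaces carry the quotient of the topology given by the vertex coordinates. Let $\mathbb S^2\subset\mathbb R^3$ be the sphere of radius $\tfrac12$ centered at $(0,0,\tfrac12)$, and let $\pi_N$ be the stereographic projection from its north pole $(0,0,1)$ onto the plane $\mathbb R^2\times\{0\}$. Write $\operatorname{int}\Delta^{k-5}=\{w\in\mathbb R^{k-4}: w_i>0,\ \sum_i w_i=1\}$, with indices $0\le i\le k-5$. 1. *Up to Möbius transformations.* The space of realizations of $F_k$ inscribed in $\mathbb S^2$, modulo all Möbius transformations of $\mathbb S^2$ (including orientation-reversing ones), is homeomorphic to $\operatorname{int}\Delta^{k-5}\times(0,\pi)\times I$ with $I$ an open interval; in particular it is homeomorphic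 to an open $(k-3)$-ball. More precisely, there are non-empty open intervals $I_w\subset(0,\infty)$, $w\in\operatorname{int}\Delta^{k-5}$, and a homeomorphism from $\{(w,\gamma,\delta): w\in\operatorname{int}\Delta^{k-5},\ \gamma\in(0,\pi),\ \delta\in I_w\}$ onto this space that sends $(w,\gamma,\delta)$ to the class of a realization with the vertex $N$ at the north pole, $\pi_N(S)=0$ (so $S$ is at the south pole), $\pi_N(p_i)=\bigl(1/\sum_{j\ge i}w_j,\,0\bigr)$ for all $i$, and $\pi_N(q_0)=\delta(\cos\gamma,\sin\gamma)$. In this normal form $\gamma$ is the angle between the two $(k-2)$-gons, and $w$ is the position of the vertices of the first $(k-2)$-gon, on which alone $I_w$ depends. 2. *Up to Euclidean isometries and homotheties.* There are non-empty open intervals $I_{\alpha,\beta,\gamma}\subset(0,\infty)$ such that, with $$\mathcal R_{F_k}=\{(\alpha,\beta,\gamma,\delta):\alpha\in\mathbb R^2,\ \beta\in(\mathbb R^+)^{k-4},\ \gamma\in(0,\pi),\ \delta\in I_{\alpha,\beta,\gamma}\},$$ the space of realizations of $F_k$ inscribed in some sphere of $\mathbb R^3$, modulo Euclidean isometries and homotheties,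 is homeomorphic to $\mathcal R_{F_k}$, by a homeomorphism that sends $(\alpha,\beta,\gamma,\delta)$ to the class of a realization inscribed in $\mathbb S^2$ with the vertex $N$ at the north pole, $\pi_N(S)=\alpha$, $\pi_N(p_i)=\alpha+\bigl(\sum_{j\le i}\beta_j,\,0\bigr)$ for all $i$ (with $\beta=(\beta_0,\dots,\beta_{k-5})$), and $\pi_N(q_0)=\alpha+\delta(\cos\gamma,\sin\gamma)$. The set $\mathcal R_{F_k}$ is contractible and $k$-dimensional: it is an open subset of the $k$-dimensional space $\mathbb R^2\times\mathbb R^{k-4}\times\mathbb R\times\mathbb R$. 3. In particular, every facet of the dual $C_4(k)^*$ of the cyclic polytope is inscribable: if $C_4(k)$ is the convex hull of any $k$ distinct points on the moment curve $t\mapsto(t,t^2,t^3,t^4)$ and $Q\subset\mathbb R^4$ is any $4$-polytope whose face lattice is anti-isomorphic to that of $C_4(k)$, then each facet of $Q$ is combinatorially equivalent to a $3$-polytope in $\mathbb R^3$ with all its vertices on a sphere. -/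

import Mathlib

open Set

/-- Euclidean `3`-space. -/
abbrev E3 : Type := EuclideanSpace ℝ (Fin 3)

/-- The Euclidean plane. -/
abbrev E2 : Type := EuclideanSpace ℝ (Fin 2)

/-! ### Labelled polytopes and their faces

A polytope is given by the labelled family `v : ι → E` of its vertices; the polytope itself is
the convex hull of the family, and a face is recorded by the set of the labels of its vertices. -/

section Faces

variable {ι κ E F : Type*} [NormedAddCommGroup E] [NormedSpace ℝ E]
  [NormedAddCommGroup F] [NormedSpace ℝ F]

/-- `S` is the set of labels of the points on a face of the convex hull of `v`: the points
labelled by `S` are those at which a valid linear inequality `f x ≤ c` is tight.  The improper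
faces (`f = 0`) are included: the empty face and the whole polytope. -/
def IsFace (v : ι → E) (S : Set ι) : Prop :=
  ∃ (f : E →L[ℝ] ℝ) (c : ℝ), (∀ i, f (v i) ≤ c) ∧ ∀ i, i ∈ S ↔ f (v i) = c

/-- A facet is a maximal proper face. -/
def IsFacet (v : ι → E) (S : Set ι) : Prop :=
  IsFace v S ∧ S ≠ univ ∧ ∀ T, IsFace v T → S ⊆ T → T = S ∨ T = univ

/-- The face lattice, ordered by inclusion. -/
abbrev FaceLattice (v : ι → E) : Type _ := {S : Set ι // IsFace v S}

/-- `v` is the family of vertices of a full-dimensional polytope. -/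
def IsPolytope (v : ι → E) : Prop :=
  ConvexIndependent ℝ v ∧ affineSpan ℝ (range v) = ⊤

/-- Two polytopes are combinatorially equivalent if their face lattices are isomorphic. -/
def CombEquiv (v : ι → E) (w : κ → F) : Prop :=
  Nonempty (FaceLattice v ≃o FaceLattice w)

/-- Two polytopes are dual to each other if their face lattices are anti-isomorphic. -/
def IsDual (v : ι → E) (w : κ → F) : Prop :=
  Nonempty (FaceLattice v ≃o (FaceLattice w)ᵒᵈ)

/-- All points of the family lie on a common sphere. -/
def IsInscribed (v : ι → E) : Prop :=
  ∃ (c : E) (r : ℝ), ∀ i, dist (v i) c = r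

/-- A `3`-dimensional polytope is inscribable if it is combinatorially equivalent to a
polytope in `ℝ³` whose vertices lie on a sphere. -/
def IsInscribable3 (v : ι → E) : Prop :=
  ∃ (n : ℕ) (w : Fin n → E3), IsPolytope w ∧ IsInscribed w ∧ CombEquiv v w

end Faces

/-- The vertices of the cyclic polytope `C_d(k)`: the points on the moment curve
`t ↦ (t, t², …, t^d)` with parameters `t 0, …, t (k - 1)` (to be taken increasing). -/
noncomputable def cyclicPolytope (d : ℕ) {k : ℕ} (t : Fin k → ℝ) :
    Fin k → EuclideanSpace ℝ (Fin d) :=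
  fun i => WithLp.toLp 2 fun j => t i ^ (j.val + 1)

/-! ### The wedge `F_k` over a `(k - 2)`-gon -/

/-- The `2k - 6` vertices of the wedge over a `(k - 2)`-gon: the end points `north`, `south` of
the wedge edge, which lie on both `(k - 2)`-gons; the other vertices `p 0, …, p (k - 5)` of the
first `(k - 2)`-gon, in their order from `south` to `north`; and likewise the other vertices
`q 0, …, q (k - 5)` of the second. -/
inductive WedgeVertex (k : ℕ) : Type
  | north : WedgeVertex k
  | south : WedgeVertex k
  | p (i : Fin (k - 4)) : WedgeVertex k
  | q (i : Fin (k - 4)) : WedgeVertex k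

namespace WedgeVertex

/-- The first `(k - 2)`-gon. -/
def firstPolygon (k : ℕ) : Set (WedgeVertex k) := {north, south} ∪ range p

/-- The second `(k - 2)`-gon. -/
def secondPolygon (k : ℕ) : Set (WedgeVertex k) := {north, south} ∪ range q

/-- The triangle `south, p 0, q 0`. -/
def southTriangle (k : ℕ) : Set (WedgeVertex k) :=
  {x | x = south ∨ ∃ i, i.val = 0 ∧ (x = p i ∨ x = q i)}

/-- The triangle `north, p (k - 5), q (k - 5)`. -/
def northTriangle (k : ℕ) : Set (WedgeVertex k) :=
  {x | x = north ∨ ∃ i, i.val + 1 = k - 4 ∧ (x = p i ∨ x = q i)}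

/-- The facets of `F_k`: two `(k - 2)`-gons, two triangles, and the `k - 5` quadrilaterals
`p i, p (i + 1), q (i + 1), q i`. -/
def facets (k : ℕ) : Set (Set (WedgeVertex k)) :=
  {firstPolygon k, secondPolygon k, southTriangle k, northTriangle k} ∪
    {S | ∃ i j : Fin (k - 4), j.val = i.val + 1 ∧ S = {p i, p j, q i, q j}}

end WedgeVertex

/-- `v` is a (labelled) realization of the wedge `F_k`: a `3`-polytope whose facets are exactly
those of `F_k`. -/
def IsWedgeRealization {k : ℕ} (v : WedgeVertex k → E3) : Prop :=
  IsPolytope v ∧ ∀ S, IsFacet v S ↔ S ∈ WedgeVertex.facets k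

/-! ### The standard sphere, stereographic projection, Möbius transformations -/

/-- The sphere of radius `1/2` about `(0, 0, 1/2)`. -/
abbrev S2 : Type := Metric.sphere (!₂[0, 0, 1 / 2] : E3) (1 / 2)

/-- The north pole of `S2`. -/
noncomputable def northPole : E3 := !₂[0, 0, 1]

/-- The inverse of the stereographic projection of `S2` from the north pole onto the plane
`z = 0`: the second point of `S2` on the line through the north pole and `(u, 0)`.  The image of
the origin is the south pole `(0, 0, 0)`. -/
noncomputable def stereoInv (u : E2) : E3 :=
  !₂[u 0 / (1 + ‖u‖ ^ 2), u 1 / (1 + ‖u‖ ^ 2), ‖u‖ ^ 2 / (1 + ‖u‖ ^ 2)]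

/-- The group of Möbius transformations of `S2` (orientation reversing ones included), generated
by the isometries of `S2` and the inversions of space that preserve `S2`. -/
def moebiusGroup : Subgroup (Equiv.Perm S2) :=
  Subgroup.closure {σ | Isometry σ ∨
    ∃ (c : E3) (r : ℝ), ∀ x : S2, (σ x : E3) = EuclideanGeometry.inversion c r (x : E3)}

/-! ### The two inscribed realization spaces -/

/-- The realizations of `F_k` with all vertices on `S2`, as a subspace of `S2 ^ (2k - 6)`. -/
abbrev SphericalRealization (k : ℕ) : Type :=
  {v : WedgeVertex k → S2 // IsWedgeRealization fun x => (v x : E3)}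

/-- Equivalence of realizations up to Möbius transformations. -/
def moebiusSetoid (k : ℕ) : Setoid (SphericalRealization k) where
  r v w := ∃ g ∈ moebiusGroup, ∀ x, g (v.1 x) = w.1 x
  iseqv :=
    { refl := fun _ => ⟨1, one_mem _, fun _ => rfl⟩
      symm := by
        rintro v w ⟨g, hg, h⟩
        exact ⟨g⁻¹, inv_mem hg, fun x => by rw [← h x]; exact g.symm_apply_apply _⟩
      trans := by
        rintro u v w ⟨g, hg, h⟩ ⟨g', hg', h'⟩
        exact ⟨g' * g, mul_mem hg' hg, fun x => by rw [← h' x, ← h x]; rfl⟩ }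

/-- The inscribed realization space of `F_k` up to Möbius transformations. -/
abbrev MoebiusRealizationSpace (k : ℕ) : Type := Quotient (moebiusSetoid k)

/-- The realizations of `F_k` whose vertices lie on some sphere, as a subspace of
`(ℝ³) ^ (2k - 6)`. -/
abbrev InscribedRealization (k : ℕ) : Type :=
  {v : WedgeVertex k → E3 // IsWedgeRealization v ∧ IsInscribed v}

/-- Equivalence of realizations up to Euclidean isometries and homotheties. -/
def similaritySetoid (k : ℕ) : Setoid (InscribedRealization k) where
  r v w := ∃ s : ℝ, 0 < s ∧ ∃ (L : E3 ≃ₗᵢ[ℝ] E3) (b : E3), ∀ x, w.1 x = s • L (v.1 x) + b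
  iseqv :=
    { refl := fun _ => ⟨1, one_pos, LinearIsometryEquiv.refl ℝ E3, 0, fun _ => by simp⟩
      symm := by
        rintro v w ⟨s, hs, L, b, h⟩
        refine ⟨s⁻¹, inv_pos.2 hs, L.symm, -(s⁻¹ • L.symm b), fun x => ?_⟩
        rw [h x]
        simp [smul_smul, hs.ne']
      trans := by
        rintro u v w ⟨s, hs, L, b, h⟩ ⟨s', hs', L', b', h'⟩
        refine ⟨s' * s, mul_pos hs' hs, L.trans L', s' • L' b + b', fun x => ?_⟩
        rw [h' x, h x]
        simp [smul_smul, add_assoc] }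

/-- The inscribed realization space of `F_k` up to Euclidean isometries and homotheties. -/
abbrev SimilarityRealizationSpace (k : ℕ) : Type := Quotient (similaritySetoid k)

/-! ### The parameters -/

/-- `v` is a family of points on `S2` in the following position.  The vertex `north` of the wedge
edge is the north pole; under stereographic projection from it, the vertex `south` becomes `a`,
the vertices `p i` become the points `a + (x i, 0)` of a line parallel to the first axis, and the
vertex `q 0` becomes the point at the coordinate `δ` on the line through `a` that makes the
angle `γ` with the first one. -/
def InPosition {k : ℕ} (v : WedgeVertex k → E3) (a : E2) (x : Fin (k - 4) → ℝ) (γ δ : ℝ) : Prop :=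
  (∀ y, v y ∈ Metric.sphere (!₂[0, 0, 1 / 2] : E3) (1 / 2)) ∧
  v .north = northPole ∧
  v .south = stereoInv a ∧
  (∀ i, v (.p i) = stereoInv (a + !₂[x i, 0])) ∧
  ∀ i : Fin (k - 4), i.val = 0 → v (.q i) = stereoInv (a + !₂[δ * Real.cos γ, δ * Real.sin γ])

/-- The (relative) interior of the standard simplex of dimension `k - 5`. -/
def openSimplex (k : ℕ) : Set (Fin (k - 4) → ℝ) := {w | (∀ i, 0 < w i) ∧ ∑ i, w i = 1}

/-- The triples `(w, γ, δ)` with `w` in the open simplex, `γ ∈ (0, π)` and `δ ∈ I w`. -/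
def moebiusParameters (k : ℕ) (I : (Fin (k - 4) → ℝ) → Set ℝ) :
    Set ((Fin (k - 4) → ℝ) × ℝ × ℝ) :=
  {z | z.1 ∈ openSimplex k ∧ z.2.1 ∈ Ioo 0 Real.pi ∧ z.2.2 ∈ I z.1}

/-- The quadruples `(α, β, γ, δ)` with `α ∈ ℝ²`, `β ∈ (ℝ⁺)^(k - 4)`, `γ ∈ (0, π)` and
`δ ∈ J α β γ`. -/
def wedgeParameters (k : ℕ) (J : E2 → (Fin (k - 4) → ℝ) → ℝ → Set ℝ) :
    Set (E2 × (Fin (k - 4) → ℝ) × ℝ × ℝ) :=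
  {z | (∀ i, 0 < z.2.1 i) ∧ z.2.2.1 ∈ Ioo 0 Real.pi ∧ z.2.2.2 ∈ J z.1 z.2.1 z.2.2.1}

/-- A non-empty open interval of positive real numbers. -/
def IsPosOpenInterval (s : Set ℝ) : Prop :=
  s.Nonempty ∧ IsOpen s ∧ s.OrdConnected ∧ s ⊆ Ioi 0

/-! ### Face lattices: facets, duality, restriction to a face. -/

section Faces

variable {ι κ E F : Type*} [NormedAddCommGroup E] [NormedSpace ℝ E]
  [NormedAddCommGroup F] [NormedSpace ℝ F]

/-! Put `north` at the pole and project stereographically. An affine functional on the sphere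
becomes, up to a positive factor, a polynomial `A‖y‖² - B·y + D` in the position `y` relative to the
image of `south`. The two polygons contain `north` and `south`, so their planes become two lines
through that image, and the `p i` and `q i` lie on two rays from it, at radii `p i` and `q i`. On
the rays the polynomial is `A r² - b r + D` and `A r² - c r + D`, with common `A`, `D`; as the rays
are not parallel, `b` and `c` are independent.

A quadrilateral is a face when both quadratics vanish exactly at the radii with indices `i`, `i + 1`
and are positive elsewhere on their rays. By Vieta both products of roots equal `D / A`, so `q i * q
(i + 1) = p i * p (i + 1)`: this is the power of the point `south`. The signs and the two triangles
force both sequences to increase. Conversely, increasing positive radii with these products always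
give a realization. This is `InterlacedRadii`, with the two directions
`exists_eq_wedgePoint_of_isFace` and `InterlacedRadii.isWedgeRealization`.

The product relations determine `q` from `p` and `δ = q 0` (`zigzag`). Monotonicity of `q` bounds `t
= (δ / p 0)²` below by ratios `p i / p (i + 1)` with `i` odd, and bounds `1 / t` below by those with
`i` even. All the ratios are less than `1`, so the admissible `δ` form an open interval containing
`p 0`. Its ends vary continuously with `p`, if infinite ends are allowed, and `zigzagHomeo`
straightens the family to a product.

Both moduli spaces are handled by `exists_homeomorph_quotient`: a continuous family of normal forms
meeting every class, and a continuous invariant recovering the parameters. Up to similarity, the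
invariant is read off after inversion about `north` (`similarityInvariant`); up to Möbius
transformations it consists of absolute cross ratios (`moebiusInvariant`), and translations and
dilations of the plane normalize `south` to `0` and `p 0` to `1`.

For the cyclic polytope, the vertex figure of `C_4(k)` at `t i` is a cyclic `3`-polytope with
parameters `1 / (t j - t i)`. Gale evenness identifies its dual with the wedge, so every facet of a
dual of `C_4(k)` has the type of `F_k`, which has an inscribed realization. -/

theorem isFace_univ (v : ι → E) : IsFace v univ := ⟨0, 0, by simp, by simp⟩

theorem isFace_empty (v : ι → E) : IsFace v ∅ := ⟨0, 1, by simp, by simp⟩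

theorem isFace_iInter {α : Type*} [Finite α] {v : ι → E} {S : α → Set ι}
    (h : ∀ a, IsFace v (S a)) : IsFace v (⋂ a, S a) := by
  classical
  have := Fintype.ofFinite α
  choose f c hle heq using h
  refine ⟨∑ a, f a, ∑ a, c a, fun i => ?_, fun i => ?_⟩
  · simpa using Finset.sum_le_sum fun a _ => hle a i
  · simp only [mem_iInter, heq, FunLike.coe_sum, Finset.sum_apply]
    rw [Finset.sum_eq_sum_iff_of_le fun a _ => hle a i]
    simp

/-- Every face is the intersection of the facets that contain it. -/
theorem IsFace.exists_isFacet [Finite ι] {v : ι → E} {T : Set ι} (hT : IsFace v T) {x : ι}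
    (hx : x ∉ T) : ∃ S, IsFacet v S ∧ T ⊆ S ∧ x ∉ S := by
  obtain ⟨S, hTS, hS⟩ := ({S | IsFace v S ∧ x ∉ S} : Set (Set ι)).toFinite.exists_le_maximal
    (a := T) ⟨hT, hx⟩
  refine ⟨S, ⟨hS.prop.1, fun h => hS.prop.2 (h ▸ mem_univ x), fun U hU hSU => ?_⟩, hTS, hS.prop.2⟩
  -- A larger proper face `U` contains `x` by maximality. The functional of `S` is tilted about `U`
  -- until it first touches a vertex outside `U`. The resulting face strictly contains `S` and still
  -- misses `x`, which contradicts maximality.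
  by_contra! hne
  have hxU : x ∈ U := by
    by_contra hxU
    exact hne.1 (hS.eq_of_le ⟨hU, hxU⟩ hSU).symm
  obtain ⟨f, c, hf, hfS⟩ := hS.prop.1
  obtain ⟨g, d, hg, hgU⟩ := hU
  obtain ⟨z, hz⟩ : Uᶜ.Nonempty := nonempty_compl.2 hne.2
  obtain ⟨y, hy, hmin⟩ := Set.exists_min_image Uᶜ (fun i => (c - f (v i)) / (d - g (v i)))
    (toFinite _) ⟨z, hz⟩
  have pos : ∀ i, i ∉ U → 0 < d - g (v i) := fun i hi =>
    sub_pos.2 (lt_of_le_of_ne (hg i) fun h => hi ((hgU i).2 h))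
  set r := (c - f (v y)) / (d - g (v y)) with hr
  have hSU' : ∀ i ∈ S, f (v i) = c ∧ g (v i) = d := fun i hi => ⟨(hfS i).1 hi, (hgU i).1 (hSU hi)⟩
  have key : S ⊂ {i | (f - r • g) (v i) = c - r * d} := by
    refine ⟨fun i hi => ?_, fun h => ?_⟩
    · simp [hSU' i hi]
    · have hyS : y ∈ S := by
        apply h
        have := (pos y hy).ne'
        simp only [sub_apply, smul_apply, smul_eq_mul,
          mem_ofPred_eq]
        have : r * (d - g (v y)) = c - f (v y) := by rw [hr]; field_simp
        linarith
      exact hy (hSU hyS)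
  refine key.ne (hS.eq_of_le ⟨⟨f - r • g, c - r * d, fun i => ?_, fun i => Iff.rfl⟩, ?_⟩ key.subset)
  · simp only [sub_apply, smul_apply, smul_eq_mul]
    by_cases hi : i ∈ U
    · rw [(hgU i).1 hi]; linarith [hf i]
    · have := hmin i hi
      rw [le_div_iff₀ (pos i hi)] at this
      linarith
  · intro h
    have h1 := (hgU x).1 hxU
    simp only [sub_apply, smul_apply, smul_eq_mul,
      mem_ofPred_eq, h1] at h
    exact hS.prop.2 ((hfS x).2 (by linarith))

/-- Two polytopes with transposed vertex-facet incidences are dual to each other. -/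
theorem isDual_of_incidence [Finite ι] [Finite κ] {v : ι → E} {w : κ → F} (R : ι → κ → Prop)
    (hv : ∀ j, IsFace v {i | R i j}) (hw : ∀ i, IsFace w {j | R i j})
    (hv' : ∀ S, IsFacet v S → ∃ j, S = {i | R i j})
    (hw' : ∀ S, IsFacet w S → ∃ i, S = {j | R i j}) : IsDual v w := by
  have up (T : Set ι) : IsFace w {j | ∀ i ∈ T, R i j} := by
    convert isFace_iInter (v := w) (S := fun i : T => {j | R i j}) fun i => hw i using 1
    ext j; simp
  have down (T : Set κ) : IsFace v {i | ∀ j ∈ T, R i j} := by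
    convert isFace_iInter (v := v) (S := fun j : T => {i | R i j}) fun j => hv j using 1
    ext j; simp
  -- Faces are intersections of facets, so they are closed for the Galois connection of the
  -- incidence relation; its two polars are then mutually inverse on faces.
  have closed_v (T : Set ι) (hT : IsFace v T) : {i | ∀ j ∈ {j | ∀ i ∈ T, R i j}, R i j} = T := by
    refine Subset.antisymm (fun i hi => ?_) fun i hi j hj => hj i hi
    by_contra hiT
    obtain ⟨S, hS, hTS, hiS⟩ := hT.exists_isFacet hiT
    obtain ⟨j, rfl⟩ := hv' S hS
    exact hiS (hi j fun i' hi' => hTS hi')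
  have closed_w (T : Set κ) (hT : IsFace w T) : {j | ∀ i ∈ {i | ∀ j ∈ T, R i j}, R i j} = T := by
    refine Subset.antisymm (fun i hi => ?_) fun i hi j hj => hj i hi
    by_contra hiT
    obtain ⟨S, hS, hTS, hiS⟩ := hT.exists_isFacet hiT
    obtain ⟨j, rfl⟩ := hw' S hS
    exact hiS (hi j fun i' hi' => hTS hi')
  exact ⟨{
    toFun := fun T => OrderDual.toDual ⟨_, up T.1⟩
    invFun := fun T => ⟨_, down (OrderDual.ofDual T).1⟩
    left_inv := fun T => Subtype.ext (closed_v T.1 T.2)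
    right_inv := fun T => congrArg OrderDual.toDual (Subtype.ext (closed_w _ (OrderDual.ofDual T).2))
    map_rel_iff' := by
      intro S T
      change {j | ∀ i ∈ T.1, R i j} ⊆ {j | ∀ i ∈ S.1, R i j} ↔ S.1 ⊆ T.1
      refine ⟨fun h => ?_, fun h j hj i hi => hj i (h hi)⟩
      rw [← closed_v S.1 S.2, ← closed_v T.1 T.2]
      exact fun i hi j hj => hi j (h hj) }⟩

theorem isFace_comp_equiv (v : ι → E) (e : κ ≃ ι) {T : Set ι} :
    IsFace (v ∘ e) (e ⁻¹' T) ↔ IsFace v T :=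
  exists₂_congr fun f c => by
    simp only [Function.comp_apply, mem_preimage]
    exact and_congr (e.forall_congr_right (q := fun i => f (v i) ≤ c))
      (e.forall_congr_right (q := fun i => i ∈ T ↔ f (v i) = c))

theorem combEquiv_comp_equiv (v : ι → E) (e : κ ≃ ι) : CombEquiv v (v ∘ e) :=
  ⟨{ toFun := fun T => ⟨e ⁻¹' T.1, (isFace_comp_equiv v e).2 T.2⟩
     invFun := fun T => ⟨e.symm ⁻¹' T.1, (isFace_comp_equiv v e).1 <| by
      rw [← preimage_comp, e.symm_comp_self, preimage_id]; exact T.2⟩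
     left_inv := fun T => Subtype.ext <| by simp [← preimage_comp]
     right_inv := fun T => Subtype.ext <| by simp [← preimage_comp]
     map_rel_iff' := by
      intro S T
      exact preimage_subset_preimage_iff (by simp) }⟩

/-- The faces of a face are the faces of the polytope which it contains. -/
theorem isFace_restrict_iff [Finite ι] {v : ι → E} {S : Set ι} (hS : IsFace v S) {T : Set S} :
    IsFace (fun i : S => v i) T ↔ IsFace v ((↑) '' T) := by
  constructor
  · rintro ⟨f, c, hf, hfT⟩
    obtain ⟨g, d, hg, hgS⟩ := hS
    -- Adding a large multiple of the functional of `S` changes nothing on `S`, up to a constant,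
    -- and makes the inequality strict off `S`.
    obtain ⟨M, hM⟩ := (finite_range fun i => (f (v i) - c) / (d - g (v i))).bddAbove
    have hM' : ∀ i, i ∉ S → f (v i) - c < (M + 1) * (d - g (v i)) := by
      intro i hi
      have pos : 0 < d - g (v i) :=
        sub_pos.2 (lt_of_le_of_ne (hg i) fun h => hi ((hgS i).2 h))
      rw [← div_lt_iff₀ pos]
      exact (hM ⟨i, rfl⟩).trans_lt (lt_add_one M)
    refine ⟨f + (M + 1) • g, c + (M + 1) * d, fun i => ?_, fun i => ?_⟩ <;>
      simp only [add_apply, smul_apply, smul_eq_mul] <;>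
      by_cases hi : i ∈ S
    · rw [(hgS i).1 hi]; linarith [hf ⟨i, hi⟩]
    · linarith [hM' i hi]
    · rw [(hgS i).1 hi, add_left_inj, ← hfT ⟨i, hi⟩]; simp [hi]
    · refine ⟨?_, fun h => ?_⟩
      · rintro ⟨j, -, rfl⟩; exact (hi j.2).elim
      · linarith [hM' i hi]
  · rintro ⟨f, c, hf, hfT⟩
    exact ⟨f, c, fun i => hf i, fun i => by rw [← hfT]; simp⟩

theorem faceLattice_restrict [Finite ι] {v : ι → E} {S : Set ι} (hS : IsFace v S) :
    Nonempty (FaceLattice (fun i : S => v i) ≃o {T : FaceLattice v // T.1 ⊆ S}) :=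
  ⟨{ toFun := fun T => ⟨⟨(↑) '' T.1, (isFace_restrict_iff hS).1 T.2⟩, by simp⟩
     invFun := fun T => ⟨(↑) ⁻¹' T.1.1, (isFace_restrict_iff hS).2 <| by
      rw [Subtype.image_preimage_coe, inter_eq_right.2 T.2]; exact T.1.2⟩
     left_inv := fun T => Subtype.ext <| by simp
     right_inv := fun T => Subtype.ext <| Subtype.ext <| by simpa using T.2
     map_rel_iff' := by
      intro T U
      exact image_subset_image_iff Subtype.val_injective }⟩

/-- Under a duality, a facet corresponds to a vertex. -/
theorem exists_vertex_of_isFacet {v : ι → E} {w : κ → F}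
    (e : FaceLattice v ≃o (FaceLattice w)ᵒᵈ) (hw : ∀ j, IsFace w {j}) {S : Set ι}
    (hS : IsFacet v S) :
    ∃ j, ∀ T : FaceLattice v, T.1 ⊆ S ↔ j ∈ (OrderDual.ofDual (e T)).1 := by
  -- The dual face of `S` is not empty, since the empty face corresponds to the whole polytope. It
  -- therefore contains a vertex, whose dual face contains `S` and is proper, hence equals `S`.
  have hU : (OrderDual.ofDual (e ⟨S, hS.1⟩)).1.Nonempty := by
    by_contra hne
    have h : e ⟨univ, isFace_univ v⟩ ≤ e ⟨S, hS.1⟩ := by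
      change (OrderDual.ofDual (e ⟨S, hS.1⟩)).1 ⊆ _
      rw [not_nonempty_iff_eq_empty.1 hne]
      exact empty_subset _
    exact hS.2.1 (univ_subset_iff.1 (e.le_iff_le.1 h))
  obtain ⟨j, hj⟩ := hU
  let J : (FaceLattice w)ᵒᵈ := OrderDual.toDual ⟨{j}, hw j⟩
  have hJ : e ⟨S, hS.1⟩ ≤ J := singleton_subset_iff.2 hj
  have hJ' : (⟨S, hS.1⟩ : FaceLattice v) ≤ e.symm J := (e.le_symm_apply).2 hJ
  have hJS : e.symm J = ⟨S, hS.1⟩ := by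
    rcases hS.2.2 _ (e.symm J).2 hJ' with h | h
    · exact Subtype.ext h
    · have h0 : e.symm (OrderDual.toDual ⟨∅, isFace_empty w⟩) ≤ e.symm J := by
        change _ ⊆ (e.symm J).1
        rw [h]; exact subset_univ _
      rw [e.symm.le_iff_le] at h0
      exact (h0 (mem_singleton j)).elim
  refine ⟨j, fun T => ?_⟩
  have : T ≤ ⟨S, hS.1⟩ ↔ e T ≤ J := by rw [← hJS, e.le_symm_apply]
  exact this.trans (singleton_subset_iff (s := (OrderDual.ofDual (e T)).1))

end Faces

/-- Spheres are strictly convex: the functional `⟨v i - c, ·⟩` is strictly smaller at every other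
point of the sphere than at `v i`, so an open half-space contains all other points and not `v i`. -/
theorem convexIndependent_of_dist_eq {ι E : Type*} [NormedAddCommGroup E] [InnerProductSpace ℝ E]
    {v : ι → E} (hinj : Function.Injective v) {c : E} {r : ℝ} (h : ∀ i, dist (v i) c = r) :
    ConvexIndependent ℝ v := by
  intro s i hi
  by_contra his
  have hsub : v '' s ⊆ {y | inner ℝ (v i - c) y < inner ℝ (v i - c) (v i)} := by
    rintro _ ⟨j, hj, rfl⟩
    have hij : v i ≠ v j := fun hij => his (hinj hij ▸ hj)
    have h1 : ‖v i - c‖ = ‖v j - c‖ := by rw [← dist_eq_norm, ← dist_eq_norm, h, h]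
    have h2 : 0 < ‖v i - v j‖ ^ 2 := by
      have := norm_pos_iff.2 (sub_ne_zero.2 hij); positivity
    have h3 : v i - v j = (v i - c) - (v j - c) := by abel
    rw [h3, norm_sub_sq_real, ← h1, ← real_inner_self_eq_norm_sq] at h2
    simp only [inner_sub_right] at h2
    simp only [mem_ofPred_eq]
    linarith
  have := convexHull_min hsub (convex_halfSpace_lt (f := fun y => inner ℝ (v i - c) y)
    ⟨fun x y => inner_add_right _ _ _, fun a x => real_inner_smul_right _ _ _⟩ _) hi
  exact lt_irrefl _ (mem_ofPred.1 this)

/-! ### Cyclic polytopes: supporting polynomials and vertex figures. -/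

theorem EuclideanSpace.dual_apply_eq_sum {d : ℕ} (f : EuclideanSpace ℝ (Fin d) →L[ℝ] ℝ)
    (x : EuclideanSpace ℝ (Fin d)) : f x = ∑ j, f (EuclideanSpace.single j 1) * x j := by
  have h := (EuclideanSpace.basisFun (Fin d) ℝ).sum_repr x
  conv_lhs => rw [← h, map_sum]
  refine Finset.sum_congr rfl fun j _ => ?_
  rw [map_smul, smul_eq_mul, EuclideanSpace.basisFun_repr, EuclideanSpace.basisFun_apply, mul_comm]

theorem isFace_cyclicPolytope_iff {d k : ℕ} {t : Fin k → ℝ} {T : Set (Fin k)} :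
    IsFace (cyclicPolytope d t) T ↔ ∃ (a : Fin d → ℝ) (c : ℝ),
      (∀ i, ∑ j, a j * t i ^ (j.val + 1) ≤ c) ∧ ∀ i, i ∈ T ↔ ∑ j, a j * t i ^ (j.val + 1) = c := by
  constructor
  · rintro ⟨f, c, hf, hT⟩
    have key (i) := EuclideanSpace.dual_apply_eq_sum f (cyclicPolytope d t i)
    exact ⟨fun j => f (EuclideanSpace.single j 1), c, fun i => (key i).symm.trans_le (hf i),
      fun i => by rw [hT, key]; rfl⟩
  · rintro ⟨a, c, ha, hT⟩
    have key (i) : (∑ j, a j • EuclideanSpace.proj (𝕜 := ℝ) j : EuclideanSpace ℝ (Fin d) →L[ℝ] ℝ)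
        (cyclicPolytope d t i) = ∑ j, a j * t i ^ (j.val + 1) := by
      simp [cyclicPolytope]
    exact ⟨_, c, fun i => (key i).trans_le (ha i), fun i => by rw [hT, key]⟩

theorem isFace_cyclicPolytope_three_iff {k : ℕ} {y : Fin k → ℝ} {T : Set (Fin k)} :
    IsFace (cyclicPolytope 3 y) T ↔ ∃ a b c d : ℝ,
      (∀ i, 0 ≤ a + b * y i + c * y i ^ 2 + d * y i ^ 3) ∧
      ∀ i, i ∈ T ↔ a + b * y i + c * y i ^ 2 + d * y i ^ 3 = 0 := by
  rw [isFace_cyclicPolytope_iff]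
  simp only [Fin.sum_univ_three, Fin.val_zero, Fin.val_one, Fin.val_two]
  constructor
  · rintro ⟨a, c, ha, hT⟩
    have key (i) : c + -a 0 * y i + -a 1 * y i ^ 2 + -a 2 * y i ^ 3
        = c - (a 0 * y i ^ (0 + 1) + a 1 * y i ^ (1 + 1) + a 2 * y i ^ (2 + 1)) := by ring
    refine ⟨c, -a 0, -a 1, -a 2, fun i => ?_, fun i => ?_⟩
    · rw [key, sub_nonneg]; exact ha i
    · rw [key, hT, sub_eq_zero, eq_comm]
  · rintro ⟨a, b, c, d, h, hT⟩
    refine ⟨![-b, -c, -d], a, fun i => ?_, fun i => ?_⟩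
    · have := h i
      simp; linarith
    · rw [hT]
      simp
      constructor <;> intro h <;> linarith

/-- A supporting polynomial that vanishes at `t i` is expanded in powers of `t - t i`, so the
constant term is absent. The coefficients are lettered so that division by `(t - t i) ^ 4` yields
the cubic `a + b y + c y² + d y³` in `y = 1 / (t - t i)`. -/
theorem isFace_cyclicPolytope_four_iff {k : ℕ} {t : Fin k → ℝ} {T : Set (Fin k)} {i : Fin k}
    (hi : i ∈ T) :
    IsFace (cyclicPolytope 4 t) T ↔ ∃ a b c d : ℝ,
      (∀ j, 0 ≤ d * (t j - t i) + c * (t j - t i) ^ 2 + b * (t j - t i) ^ 3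
        + a * (t j - t i) ^ 4) ∧
      ∀ j, j ∈ T ↔ d * (t j - t i) + c * (t j - t i) ^ 2 + b * (t j - t i) ^ 3
        + a * (t j - t i) ^ 4 = 0 := by
  rw [isFace_cyclicPolytope_iff]
  simp only [Fin.sum_univ_four, Fin.val_zero, Fin.val_one, Fin.val_two,
    show ((3 : Fin 4) : ℕ) = 3 from rfl]
  constructor
  · rintro ⟨a, e, ha, hT⟩
    have he := (hT i).1 hi
    have key (j) : -(a 0 + 2 * a 1 * t i + 3 * a 2 * t i ^ 2 + 4 * a 3 * t i ^ 3) * (t j - t i)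
        + -(a 1 + 3 * a 2 * t i + 6 * a 3 * t i ^ 2) * (t j - t i) ^ 2
        + -(a 2 + 4 * a 3 * t i) * (t j - t i) ^ 3 + -a 3 * (t j - t i) ^ 4
        = e - (a 0 * t j ^ (0 + 1) + a 1 * t j ^ (1 + 1) + a 2 * t j ^ (2 + 1)
          + a 3 * t j ^ (3 + 1)) := by
      rw [← he]; ring
    exact ⟨_, _, _, _, fun j => le_of_le_of_eq (sub_nonneg.2 (ha j)) (key j).symm,
      fun j => by rw [key, hT, sub_eq_zero, eq_comm]⟩
  · rintro ⟨a, b, c, d, h, hT⟩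
    let a3 := -a
    let a2 := -b - 4 * a3 * t i
    let a1 := -c - 3 * a2 * t i - 6 * a3 * t i ^ 2
    let a0 := -d - 2 * a1 * t i - 3 * a2 * t i ^ 2 - 4 * a3 * t i ^ 3
    let e := a0 * t i + a1 * t i ^ 2 + a2 * t i ^ 3 + a3 * t i ^ 4
    have key (j) : d * (t j - t i) + c * (t j - t i) ^ 2 + b * (t j - t i) ^ 3
        + a * (t j - t i) ^ 4 = e - (a0 * t j ^ (0 + 1) + a1 * t j ^ (1 + 1) + a2 * t j ^ (2 + 1)
          + a3 * t j ^ (3 + 1)) := by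
      simp only [e, a0, a1, a2, a3]; ring
    refine ⟨![a0, a1, a2, a3], e, fun j => ?_, fun j => ?_⟩
    · have := h j
      rw [key, sub_nonneg] at this
      simpa using this
    · rw [hT, key, sub_eq_zero, eq_comm]
      simp

theorem isFace_cyclicPolytope_four_singleton {k : ℕ} {t : Fin k → ℝ} (ht : StrictMono t)
    (i : Fin k) : IsFace (cyclicPolytope 4 t) {i} := by
  rw [isFace_cyclicPolytope_four_iff (mem_singleton i)]
  -- The supporting polynomial is `(t - t i) ^ 2`.
  refine ⟨0, 0, 1, 0, fun j => by simpa using sq_nonneg _, fun j => ?_⟩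
  simp [sub_eq_zero, ht.injective.eq_iff]

/-- The vertex figures of a cyclic `4`-polytope are cyclic `3`-polytopes. -/
theorem vertexFigure_cyclicPolytope {k n : ℕ} {t : Fin k → ℝ} (ht : StrictMono t) (i : Fin k)
    (y : Fin n → ℝ) (e : Fin n ≃ {j // j ≠ i}) (hy : ∀ a, y a = (t (e a) - t i)⁻¹) :
    Nonempty ({T : FaceLattice (cyclicPolytope 4 t) // i ∈ T.1} ≃o
      FaceLattice (cyclicPolytope 3 y)) := by
  have hne (a) : t (e a) - t i ≠ 0 := sub_ne_zero.2 fun h => (e a).2 (ht.injective h)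
  -- The factor `(t - t i) ^ 4` is positive, so the quartic and the cubic in the inverse parameter
  -- have the same signs and zeros at the other vertices.
  have key (a b c d : ℝ) (l) : d * (t (e l) - t i) + c * (t (e l) - t i) ^ 2
      + b * (t (e l) - t i) ^ 3 + a * (t (e l) - t i) ^ 4 =
      (t (e l) - t i) ^ 4 * (a + b * y l + c * y l ^ 2 + d * y l ^ 3) := by
    have := hne l
    rw [hy]; field_simp; ring
  have pos (l) : 0 < (t (e l) - t i) ^ 4 := by have := hne l; positivity
  have hface (T : Set (Fin k)) (hi : i ∈ T) :
      IsFace (cyclicPolytope 3 y) {a | (e a : Fin k) ∈ T} ↔ IsFace (cyclicPolytope 4 t) T := by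
    rw [isFace_cyclicPolytope_four_iff hi, isFace_cyclicPolytope_three_iff]
    refine exists₂_congr fun a b => exists₂_congr fun c d => and_congr ?_ ?_
    · refine ⟨fun h j => ?_, fun h l => ?_⟩
      · by_cases hj : j = i
        · simp [hj]
        · obtain ⟨l, hl⟩ := e.surjective ⟨j, hj⟩
          have := key a b c d l
          rw [hl] at this
          rw [this]
          exact mul_nonneg (by simpa [hl] using (pos l).le) (h l)
      · have := h (e l)
        rw [key] at this
        exact nonneg_of_mul_nonneg_right this (pos l)
    · refine ⟨fun h j => ?_, fun h l => ?_⟩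
      · by_cases hj : j = i
        · simp [hj, hi]
        · obtain ⟨l, hl⟩ := e.surjective ⟨j, hj⟩
          have h1 := h l
          have h2 := key a b c d l
          simp only [mem_ofPred_eq] at h1
          have h3 : (e l : Fin k) = j := by rw [hl]
          rw [h3] at h1 h2
          rw [h2, h1, mul_eq_zero, or_iff_right]
          rw [← h3]
          exact (pos l).ne'
      · rw [mem_ofPred_eq, h, key, mul_eq_zero, or_iff_right (pos l).ne']
  have hback (T : Set (Fin n)) : {a | (e a : Fin k) ∈ {j | ∀ h : j ≠ i, e.symm ⟨j, h⟩ ∈ T}} = T := by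
    ext a
    simp [(e a).2]
  exact ⟨{
    toFun := fun T => ⟨{a | (e a : Fin k) ∈ T.1.1}, (hface _ T.2).2 T.1.2⟩
    invFun := fun T => ⟨⟨{j | ∀ h : j ≠ i, e.symm ⟨j, h⟩ ∈ T.1}, by
      rw [← hface _ (fun h => (h rfl).elim), hback]; exact T.2⟩, fun h => (h rfl).elim⟩
    left_inv := by
      rintro ⟨⟨T, hT⟩, hi⟩
      refine Subtype.ext (Subtype.ext ?_)
      ext j
      by_cases hj : j = i
      · subst hj; simpa using hi
      · simp [hj]
    right_inv := fun T => Subtype.ext (hback T.1)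
    map_rel_iff' := by
      rintro ⟨⟨S, hS⟩, hiS⟩ ⟨⟨T, hT⟩, hiT⟩
      change (∀ a, (e a : Fin k) ∈ S → (e a : Fin k) ∈ T) ↔ ∀ j, j ∈ S → j ∈ T
      refine ⟨fun h j hj => ?_, fun h a => h _⟩
      by_cases hji : j = i
      · exact hji ▸ hiT
      · simpa using h (e.symm ⟨j, hji⟩) (by simpa using hj) }⟩

/-- Iterated divided differences at the four roots vanish, which kills the coefficients from the top
down. -/
theorem cubic_eq_zero_of_four_roots {a b c d x₀ x₁ x₂ x₃ : ℝ} (h₁ : x₀ < x₁) (h₂ : x₁ < x₂)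
    (h₃ : x₂ < x₃) (e₀ : a + b * x₀ + c * x₀ ^ 2 + d * x₀ ^ 3 = 0)
    (e₁ : a + b * x₁ + c * x₁ ^ 2 + d * x₁ ^ 3 = 0)
    (e₂ : a + b * x₂ + c * x₂ ^ 2 + d * x₂ ^ 3 = 0)
    (e₃ : a + b * x₃ + c * x₃ ^ 2 + d * x₃ ^ 3 = 0) : a = 0 ∧ b = 0 ∧ c = 0 ∧ d = 0 := by
  have f₁ : b + c * (x₀ + x₁) + d * (x₀ ^ 2 + x₀ * x₁ + x₁ ^ 2) = 0 :=
    (mul_eq_zero.1 (show (x₁ - x₀) * _ = 0 by linear_combination e₁ - e₀)).resolve_left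
      (by linarith)
  have f₂ : b + c * (x₀ + x₂) + d * (x₀ ^ 2 + x₀ * x₂ + x₂ ^ 2) = 0 :=
    (mul_eq_zero.1 (show (x₂ - x₀) * _ = 0 by linear_combination e₂ - e₀)).resolve_left
      (by linarith)
  have f₃ : b + c * (x₀ + x₃) + d * (x₀ ^ 2 + x₀ * x₃ + x₃ ^ 2) = 0 :=
    (mul_eq_zero.1 (show (x₃ - x₀) * _ = 0 by linear_combination e₃ - e₀)).resolve_left
      (by linarith)
  have g₂ : c + d * (x₀ + x₁ + x₂) = 0 :=
    (mul_eq_zero.1 (show (x₂ - x₁) * _ = 0 by linear_combination f₂ - f₁)).resolve_left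
      (by linarith)
  have g₃ : c + d * (x₀ + x₁ + x₃) = 0 :=
    (mul_eq_zero.1 (show (x₃ - x₁) * _ = 0 by linear_combination f₃ - f₁)).resolve_left
      (by linarith)
  have hd : d = 0 :=
    (mul_eq_zero.1 (show (x₃ - x₂) * d = 0 by linear_combination g₃ - g₂)).resolve_left
      (by linarith)
  subst hd
  have hc : c = 0 := by linarith
  subst hc
  have hb : b = 0 := by linarith
  subst hb
  exact ⟨by linarith, rfl, rfl, rfl⟩

/-- The affine dependence of five points on the cubic moment curve has alternating signs. -/
theorem exists_alternating_dependence {x₀ x₁ x₂ x₃ x₄ : ℝ} (h₁ : x₀ < x₁) (h₂ : x₁ < x₂)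
    (h₃ : x₂ < x₃) (h₄ : x₃ < x₄) : ∃ μ₀ > 0, ∃ μ₁ > 0, ∃ μ₂ > 0, ∃ μ₃ > 0, ∃ μ₄ > 0,
      ∀ a b c d : ℝ, μ₀ * (a + b * x₀ + c * x₀ ^ 2 + d * x₀ ^ 3)
        + μ₂ * (a + b * x₂ + c * x₂ ^ 2 + d * x₂ ^ 3)
        + μ₄ * (a + b * x₄ + c * x₄ ^ 2 + d * x₄ ^ 3)
        = μ₁ * (a + b * x₁ + c * x₁ ^ 2 + d * x₁ ^ 3)
        + μ₃ * (a + b * x₃ + c * x₃ ^ 2 + d * x₃ ^ 3) := by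
  have p01 := sub_pos.2 h₁
  have p12 := sub_pos.2 h₂
  have p23 := sub_pos.2 h₃
  have p34 := sub_pos.2 h₄
  have p02 := sub_pos.2 (h₁.trans h₂)
  have p13 := sub_pos.2 (h₂.trans h₃)
  have p24 := sub_pos.2 (h₃.trans h₄)
  have p03 := sub_pos.2 ((h₁.trans h₂).trans h₃)
  have p14 := sub_pos.2 ((h₂.trans h₃).trans h₄)
  have p04 := sub_pos.2 (((h₁.trans h₂).trans h₃).trans h₄)
  -- The coefficient of each point is the Vandermonde product of the other four; the identity is the
  -- expansion of a determinant with two dependent columns.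
  refine ⟨(x₂ - x₁) * (x₃ - x₁) * (x₄ - x₁) * (x₃ - x₂) * (x₄ - x₂) * (x₄ - x₃), by positivity,
    (x₂ - x₀) * (x₃ - x₀) * (x₄ - x₀) * (x₃ - x₂) * (x₄ - x₂) * (x₄ - x₃), by positivity,
    (x₁ - x₀) * (x₃ - x₀) * (x₄ - x₀) * (x₃ - x₁) * (x₄ - x₁) * (x₄ - x₃), by positivity,
    (x₁ - x₀) * (x₂ - x₀) * (x₄ - x₀) * (x₂ - x₁) * (x₄ - x₁) * (x₄ - x₂), by positivity,
    (x₁ - x₀) * (x₂ - x₀) * (x₃ - x₀) * (x₂ - x₁) * (x₃ - x₁) * (x₃ - x₂), by positivity,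
    fun a b c d => by ring⟩

/-! ### Gale's evenness condition for cyclic `3`-polytopes. -/

section Gale

variable {n : ℕ} {y : Fin n → ℝ}

/-- The supporting cubic is `(Y - y z)(Y - y a)(Y - y b)`: the first factor is nonnegative because
`z` is the first index, and the product of the others because no parameter lies strictly between `y
a` and `y b`. -/
theorem isFace_first_and_consecutive (hy : StrictMono y) {z a b : Fin n} (hz : z.val = 0)
    (hab : b.val = a.val + 1) : IsFace (cyclicPolytope 3 y) {z, a, b} := by
  rw [isFace_cyclicPolytope_three_iff]
  have key (j) : -(y z * y a * y b) + (y z * y a + y a * y b + y z * y b) * y j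
      + -(y z + y a + y b) * y j ^ 2 + 1 * y j ^ 3
      = (y j - y z) * ((y j - y a) * (y j - y b)) := by ring
  refine ⟨_, _, _, _, fun j => le_of_le_of_eq ?_ (key j).symm, fun j => ?_⟩
  · refine mul_nonneg (sub_nonneg.2 (hy.monotone (Fin.le_def.2 (by lia)))) ?_
    rcases le_or_gt j a with h | h
    · exact mul_nonneg_of_nonpos_of_nonpos (sub_nonpos.2 (hy.monotone h))
        (sub_nonpos.2 (hy.monotone (h.trans (Fin.le_def.2 (by lia)))))
    · exact mul_nonneg (sub_nonneg.2 (hy.monotone h.le))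
        (sub_nonneg.2 (hy.monotone (Fin.le_def.2 (by lia))))
  · rw [key]
    simp [sub_eq_zero, hy.injective.eq_iff]

theorem isFace_consecutive_and_last (hy : StrictMono y) {z a b : Fin n} (hz : z.val + 1 = n)
    (hab : b.val = a.val + 1) : IsFace (cyclicPolytope 3 y) {a, b, z} := by
  rw [isFace_cyclicPolytope_three_iff]
  have key (j) : (y z * y a * y b) + -(y z * y a + y a * y b + y z * y b) * y j
      + (y z + y a + y b) * y j ^ 2 + (-1) * y j ^ 3
      = ((y j - y a) * (y j - y b)) * (y z - y j) := by ring
  refine ⟨_, _, _, _, fun j => le_of_le_of_eq ?_ (key j).symm, fun j => ?_⟩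
  · refine mul_nonneg ?_ (sub_nonneg.2 (hy.monotone (Fin.le_def.2 (by lia))))
    rcases le_or_gt j a with h | h
    · exact mul_nonneg_of_nonpos_of_nonpos (sub_nonpos.2 (hy.monotone h))
        (sub_nonpos.2 (hy.monotone (h.trans (Fin.le_def.2 (by lia)))))
    · exact mul_nonneg (sub_nonneg.2 (hy.monotone h.le))
        (sub_nonneg.2 (hy.monotone (Fin.le_def.2 (by lia))))
  · rw [key]
    simp [sub_eq_zero, hy.injective.eq_iff, or_assoc, eq_comm (a := z)]

/-- Gale's evenness condition for cyclic `3`-polytopes. -/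
theorem subset_of_isFace_cyclicPolytope_three (hn : 4 ≤ n) (hy : StrictMono y) {T : Set (Fin n)}
    (hT : IsFace (cyclicPolytope 3 y) T) (hne : T ≠ univ) :
    ∃ a b : Fin n, b.val = a.val + 1 ∧
      ((∀ j ∈ T, j.val = 0 ∨ j = a ∨ j = b) ∨ ∀ j ∈ T, j = a ∨ j = b ∨ j.val + 1 = n) := by
  obtain ⟨α, β, c, d, h0, hz⟩ := isFace_cyclicPolytope_three_iff.1 hT
  have contra : ¬(α = 0 ∧ β = 0 ∧ c = 0 ∧ d = 0) := by
    rintro ⟨rfl, rfl, rfl, rfl⟩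
    exact hne (eq_univ_of_forall fun j => (hz j).2 (by ring))
  have four (i j k l : Fin n) (hij : i < j) (hjk : j < k) (hkl : k < l) (hi : i ∈ T) (hj : j ∈ T)
      (hk : k ∈ T) (hl : l ∈ T) : False :=
    contra (cubic_eq_zero_of_four_roots (hy hij) (hy hjk) (hy hkl) ((hz i).1 hi) ((hz j).1 hj)
      ((hz k).1 hk) ((hz l).1 hl))
  -- If the nonnegative cubic vanishes on one side of the alternating dependence, it vanishes on the
  -- other side too. Then it has too many zeros.
  have five (i j k l m : Fin n) (hij : i < j) (hjk : j < k) (hkl : k < l) (hlm : l < m) :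
      ¬(j ∈ T ∧ l ∈ T) ∧ ¬(i ∈ T ∧ k ∈ T ∧ m ∈ T) := by
    obtain ⟨μ₀, p₀, μ₁, p₁, μ₂, p₂, μ₃, p₃, μ₄, p₄, hμ⟩ :=
      exists_alternating_dependence (hy hij) (hy hjk) (hy hkl) (hy hlm)
    have hμ := hμ α β c d
    have q₀ := mul_nonneg p₀.le (h0 i)
    have q₁ := mul_nonneg p₁.le (h0 j)
    have q₂ := mul_nonneg p₂.le (h0 k)
    have q₃ := mul_nonneg p₃.le (h0 l)
    have q₄ := mul_nonneg p₄.le (h0 m)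
    constructor
    · rintro ⟨hj, hl⟩
      rw [(hz j).1 hj, (hz l).1 hl] at hμ
      refine four i j k l hij hjk hkl ((hz i).2 ?_) hj ((hz k).2 ?_) hl
      · exact (mul_eq_zero.1 (by linarith)).resolve_left p₀.ne'
      · exact (mul_eq_zero.1 (by linarith)).resolve_left p₂.ne'
    · rintro ⟨hi, hk, hm⟩
      rw [(hz i).1 hi, (hz k).1 hk, (hz m).1 hm] at hμ
      refine four i j k l hij hjk hkl hi ((hz j).2 ?_) hk ((hz l).2 ?_)
      · exact (mul_eq_zero.1 (by linarith)).resolve_left p₁.ne'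
      · exact (mul_eq_zero.1 (by linarith)).resolve_left p₃.ne'
  let first : Fin n := ⟨0, by lia⟩
  let second : Fin n := ⟨1, by lia⟩
  let last : Fin n := ⟨n - 1, by lia⟩
  let penult : Fin n := ⟨n - 2, by lia⟩
  -- Two interior zeros with a gap would be the second and fourth of five points, namely `first`,
  -- `a`, `a + 1`, `b`, `last`.
  have inner_consec (a b : Fin n) (ha0 : 0 < a.val) (hab : a < b) (hbn : b.val + 1 < n)
      (ha : a ∈ T) (hb : b ∈ T) : b.val = a.val + 1 := by
    by_contra h
    refine (five first a ⟨a.val + 1, by lia⟩ b last ?_ ?_ ?_ ?_).1 ⟨ha, hb⟩ <;>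
      simp only [Fin.lt_def, first, last] at * <;> lia
  -- If both extreme points are zeros, a further zero must be adjacent to one of them, since
  -- otherwise `first`, the zero and `last` are the odd places of an alternating dependence. At most
  -- one of the two neighbours is a zero.
  by_cases hfl : first ∈ T ∧ last ∈ T
  · have inner (j : Fin n) (hj0 : 0 < j.val) (hjn : j.val + 1 < n) (hj : j ∈ T) :
        j = second ∨ j = penult := by
      by_contra! h
      simp only [ne_eq, Fin.ext_iff, second, penult] at h
      refine (five first second j penult last ?_ ?_ ?_ ?_).2 ⟨hfl.1, hj, hfl.2⟩ <;>
        simp only [Fin.lt_def, first, second, penult, last] <;> lia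
    by_cases hs : second ∈ T
    · have hp : penult ∉ T := fun hp => by
        refine four first second penult last ?_ ?_ ?_ hfl.1 hs hp hfl.2 <;>
          simp only [Fin.lt_def, first, second, penult, last] <;> lia
      refine ⟨first, second, rfl, .inr fun j hj => ?_⟩
      by_cases hj0 : j.val = 0
      · exact .inl (Fin.ext hj0)
      by_cases hjn : j.val + 1 = n
      · exact .inr (.inr hjn)
      rcases inner j (by lia) (by lia) hj with rfl | rfl
      · exact .inr (.inl rfl)
      · exact (hp hj).elim
    · refine ⟨penult, last, ?_, .inl fun j hj => ?_⟩
      · simp only [penult, last]; lia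
      by_cases hj0 : j.val = 0
      · exact .inl hj0
      by_cases hjn : j.val + 1 = n
      · exact .inr (.inr (Fin.ext (by simp only [last]; lia)))
      rcases inner j (by lia) (by lia) hj with rfl | rfl
      · exact (hs hj).elim
      · exact .inr (.inl rfl)
  · have hab : ∃ a b : Fin n, b.val = a.val + 1 ∧
        ∀ j ∈ T, 0 < j.val → j.val + 1 < n → j = a ∨ j = b := by
      by_cases hex : ∃ j ∈ T, 0 < j.val ∧ j.val + 1 < n
      · obtain ⟨a, ⟨haT, ha0, han⟩, hmin⟩ :=
          WellFounded.has_min (wellFounded_lt (α := Fin n))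
            {j | j ∈ T ∧ 0 < j.val ∧ j.val + 1 < n} hex
        refine ⟨a, ⟨a.val + 1, han⟩, rfl, fun j hj hj0 hjn => ?_⟩
        rcases (not_lt.1 (hmin j ⟨hj, hj0, hjn⟩)).eq_or_lt with h | h
        · exact .inl h.symm
        · exact .inr (Fin.ext (inner_consec a j ha0 h hjn haT hj))
      · push Not at hex
        exact ⟨first, second, rfl, fun j hj hj0 hjn => (hjn.not_ge (hex j hj hj0)).elim⟩
    obtain ⟨a, b, hb, hj⟩ := hab
    refine ⟨a, b, hb, ?_⟩
    by_cases hl : last ∈ T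
    · refine .inr fun j hjT => ?_
      have h0 : 0 < j.val := by
        by_contra h
        exact hfl ⟨(Fin.ext (by simp only [first]; lia) : j = first) ▸ hjT, hl⟩
      by_cases hjn : j.val + 1 < n
      · rcases hj j hjT h0 hjn with h | h <;> simp [h]
      · exact .inr (.inr (by lia))
    · refine .inl fun j hjT => ?_
      have hjn : j.val + 1 < n := by
        by_contra h
        exact hl ((Fin.ext (by simp only [last]; lia) : j = last) ▸ hjT)
      by_cases h0 : 0 < j.val
      · exact .inr (hj j hjT h0 hjn)
      · exact .inl (by lia)

end Gale

/-! ### The wedge is dual to a cyclic `3`-polytope. -/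

namespace WedgeVertex

/-- The incidences between the vertices of `F_k` and its facets, the latter numbered so that
they correspond to the vertices of a cyclic `3`-polytope in their order on the moment curve. -/
def Incident {k : ℕ} : WedgeVertex k → Fin (k - 1) → Prop
  | north, j => j.val = 0 ∨ j.val + 3 = k ∨ j.val + 2 = k
  | south, j => j.val = 0 ∨ j.val = 1 ∨ j.val + 2 = k
  | p i, j => j.val = 0 ∨ j.val = i.val + 1 ∨ j.val = i.val + 2
  | q i, j => j.val = i.val + 1 ∨ j.val = i.val + 2 ∨ j.val + 2 = k

/-- Numbering: `0` is the first polygon, `1` the south triangle, `i + 2` the quadrilateral at `p i`,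
`p (i + 1)`, `k - 3` the north triangle and `k - 2` the second polygon. -/
theorem mem_facets_iff {k : ℕ} (hk : 5 ≤ k) {S : Set (WedgeVertex k)} :
    S ∈ facets k ↔ ∃ j, S = {x | Incident x j} := by
  have first (j : Fin (k - 1)) (hj : j.val = 0) : {x | Incident x j} = firstPolygon k := by
    ext x
    rcases x with _ | _ | i | i <;> simp [Incident, firstPolygon] <;> lia
  have second (j : Fin (k - 1)) (hj : j.val + 2 = k) :
      {x | Incident x j} = secondPolygon k := by
    ext x
    rcases x with _ | _ | i | i <;> simp [Incident, secondPolygon] <;> lia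
  have souths (j : Fin (k - 1)) (hj : j.val = 1) : {x | Incident x j} = southTriangle k := by
    ext x
    rcases x with _ | _ | i | i <;> simp [Incident, southTriangle] <;> lia
  have norths (j : Fin (k - 1)) (hj : j.val + 3 = k) : {x | Incident x j} = northTriangle k := by
    ext x
    rcases x with _ | _ | i | i <;> simp [Incident, northTriangle] <;> lia
  have quad (j : Fin (k - 1)) (i i' : Fin (k - 4)) (hi : i.val + 2 = j.val)
      (hi' : i'.val = i.val + 1) : {x | Incident x j} = {p i, p i', q i, q i'} := by
    ext x
    rcases x with _ | _ | l | l <;> simp [Incident, Fin.ext_iff] <;> lia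
  constructor
  · rintro ((rfl | rfl | rfl | rfl) | ⟨i, i', h, rfl⟩)
    · exact ⟨⟨0, by lia⟩, (first _ rfl).symm⟩
    · exact ⟨⟨k - 2, by lia⟩, (second _ (by simp only; lia)).symm⟩
    · exact ⟨⟨1, by lia⟩, (souths _ rfl).symm⟩
    · exact ⟨⟨k - 3, by lia⟩, (norths _ (by simp only; lia)).symm⟩
    · exact ⟨⟨i.val + 2, by lia⟩, (quad _ i i' rfl h).symm⟩
  · rintro ⟨j, rfl⟩
    by_cases h0 : j.val = 0
    · exact .inl (.inl (first j h0))
    by_cases h1 : j.val = 1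
    · exact .inl (.inr (.inr (.inl (souths j h1))))
    by_cases h2 : j.val + 2 = k
    · exact .inl (.inr (.inl (second j h2)))
    by_cases h3 : j.val + 3 = k
    · exact .inl (.inr (.inr (.inr (norths j h3))))
    · exact .inr ⟨⟨j.val - 2, by lia⟩, ⟨j.val - 1, by lia⟩, by simp only; lia,
        quad j _ _ (by simp only; lia) (by simp only; lia)⟩

end WedgeVertex

instance (k : ℕ) : Finite (WedgeVertex k) :=
  Finite.of_injective (β := Option (Option (Fin (k - 4) ⊕ Fin (k - 4))))
    (fun | .north => none | .south => some none | .p i => some (some (.inl i))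
         | .q i => some (some (.inr i)))
    (by rintro (_ | _ | i | i) (_ | _ | j | j) h <;> simp_all)

open WedgeVertex in
/-- The wedge over a `(k - 2)`-gon is dual to the cyclic `3`-polytope with `k - 1` vertices. -/
theorem IsWedgeRealization.isDual_cyclicPolytope {k : ℕ} (hk : 5 ≤ k) {v : WedgeVertex k → E3}
    (hv : IsWedgeRealization v) {y : Fin (k - 1) → ℝ} (hy : StrictMono y) :
    IsDual v (cyclicPolytope 3 y) := by
  -- The three facets at a vertex form a Gale triple: two consecutive numbers together with the
  -- first number (`north`, `p i`) or the last (`south`, `q i`).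
  have hw (x : WedgeVertex k) : IsFace (cyclicPolytope 3 y) {j | Incident x j} := by
    rcases x with _ | _ | i | i
    · convert isFace_first_and_consecutive hy (z := ⟨0, by lia⟩) (a := ⟨k - 3, by lia⟩)
        (b := ⟨k - 2, by lia⟩) rfl (by simp only; lia) using 1
      ext j
      simp [Incident, Fin.ext_iff]; lia
    · convert isFace_consecutive_and_last hy (z := ⟨k - 2, by lia⟩) (a := ⟨0, by lia⟩)
        (b := ⟨1, by lia⟩) (by simp only; lia) rfl using 1
      ext j
      simp [Incident, Fin.ext_iff]; lia
    · convert isFace_first_and_consecutive hy (z := ⟨0, by lia⟩) (a := ⟨i + 1, by lia⟩)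
        (b := ⟨i + 2, by lia⟩) rfl rfl using 1
      ext j
      simp [Incident, Fin.ext_iff]
    · convert isFace_consecutive_and_last hy (z := ⟨k - 2, by lia⟩) (a := ⟨i + 1, by lia⟩)
        (b := ⟨i + 2, by lia⟩) (by simp only; lia) rfl using 1
      ext j
      simp [Incident, Fin.ext_iff]; lia
  refine isDual_of_incidence Incident
    (fun j => ((hv.2 _).2 ((mem_facets_iff hk).2 ⟨j, rfl⟩)).1) hw
    (fun S hS => (mem_facets_iff hk).1 ((hv.2 S).1 hS)) fun S hS => ?_
  suffices h : ∃ x : WedgeVertex k, S ⊆ {j | Incident x j} by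
    obtain ⟨x, hx⟩ := h
    refine ⟨x, ((hS.2.2 _ (hw x) hx).resolve_right fun h => ?_).symm⟩
    have h (j) : Incident x j := (h ▸ mem_univ j : j ∈ {j | Incident x j})
    rcases x with _ | _ | i | i
    · have := h ⟨1, by lia⟩; simp [Incident] at this; lia
    · have := h ⟨k - 3, by lia⟩; simp [Incident] at this; lia
    · have := h ⟨k - 2, by lia⟩; simp [Incident] at this; lia
    · have := h ⟨0, by lia⟩; simp [Incident] at this; lia
  obtain ⟨a, b, hab, h | h⟩ :=
    subset_of_isFace_cyclicPolytope_three (by lia) hy hS.1 hS.2.1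
  · by_cases ha : a.val = 0
    · refine ⟨south, fun j hj => ?_⟩
      rcases h j hj with h | rfl | rfl <;> simp only [Incident, mem_ofPred_eq] <;> lia
    by_cases hb : b.val + 2 = k
    · refine ⟨north, fun j hj => ?_⟩
      rcases h j hj with h | rfl | rfl <;> simp only [Incident, mem_ofPred_eq] <;> lia
    · refine ⟨p ⟨a.val - 1, by lia⟩, fun j hj => ?_⟩
      rcases h j hj with h | rfl | rfl <;> simp only [Incident, mem_ofPred_eq] <;> lia
  · by_cases ha : a.val = 0
    · refine ⟨south, fun j hj => ?_⟩
      rcases h j hj with rfl | rfl | h <;> simp only [Incident, mem_ofPred_eq] <;> lia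
    by_cases hb : b.val + 2 = k
    · refine ⟨north, fun j hj => ?_⟩
      rcases h j hj with rfl | rfl | h <;> simp only [Incident, mem_ofPred_eq] <;> lia
    · refine ⟨q ⟨a.val - 1, by lia⟩, fun j hj => ?_⟩
      rcases h j hj with rfl | rfl | h <;> simp only [Incident, mem_ofPred_eq] <;> lia

/-- If the wedge has an inscribed realization, then the facets of the dual of the cyclic
`4`-polytope are inscribable. -/
theorem isInscribable3_of_isFacet_of_isDual {k : ℕ} (hk : 5 ≤ k) {v : WedgeVertex k → E3}
    (hv : IsWedgeRealization v) (hins : IsInscribed v) {t : Fin k → ℝ} (ht : StrictMono t)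
    {m : ℕ} {u : Fin m → EuclideanSpace ℝ (Fin 4)} (hdual : IsDual u (cyclicPolytope 4 t))
    {S : Set (Fin m)} (hS : IsFacet u S) : IsInscribable3 fun i : S => u i := by
  classical
  obtain ⟨e⟩ := hdual
  obtain ⟨i, hi⟩ := exists_vertex_of_isFacet e (isFace_cyclicPolytope_four_singleton ht) hS
  -- Inversion of the parameters at `t i` does not preserve their order, so the values are sorted
  -- again before Gale evenness is applied.
  let s : {j // j ≠ i} → ℝ := fun j => (t j - t i)⁻¹
  have hs : Function.Injective s := fun a b h =>
    Subtype.ext (ht.injective (sub_left_injective (inv_injective h)))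
  let e₁ := Finset.orderIsoOfFin (Finset.univ.image s) (k := k - 1) (by
    rw [Finset.card_image_of_injective _ hs]; simp)
  let e₂ : {j // j ≠ i} ≃ Finset.univ.image s := Equiv.ofBijective
    (fun j => ⟨s j, Finset.mem_image_of_mem _ (Finset.mem_univ j)⟩)
    ⟨fun a b h => hs (congrArg Subtype.val h), fun ⟨x, hx⟩ => by
      obtain ⟨j, -, rfl⟩ := Finset.mem_image.1 hx
      exact ⟨j, rfl⟩⟩
  let y : Fin (k - 1) → ℝ := fun a => e₁ a
  have hy : StrictMono y := fun a b h => e₁.strictMono h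
  obtain ⟨φ⟩ := vertexFigure_cyclicPolytope ht i y (e₁.toEquiv.trans e₂.symm) fun a =>
    (congrArg Subtype.val (e₂.apply_symm_apply (e₁ a))).symm
  obtain ⟨ψ⟩ := hv.isDual_cyclicPolytope hk hy
  obtain ⟨χ⟩ := faceLattice_restrict hS.1
  obtain ⟨n, ⟨r⟩⟩ := Finite.exists_equiv_fin (WedgeVertex k)
  obtain ⟨ω⟩ := combEquiv_comp_equiv v r.symm
  -- The faces of the facet correspond, in reversed order, to the faces of the cyclic polytope
  -- through the vertex `i`, that is, to its vertex figure.
  let θ : {T : FaceLattice u // T.1 ⊆ S} ≃o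
      {T : FaceLattice (cyclicPolytope 4 t) // i ∈ T.1}ᵒᵈ :=
    { toEquiv := (e.toEquiv.trans OrderDual.ofDual).subtypeEquiv hi
      map_rel_iff' := fun {a b} => e.le_iff_le (x := a.1) (y := b.1) }
  refine ⟨n, v ∘ r.symm, ⟨?_, ?_⟩, ?_,
    ⟨((χ.trans θ).trans φ.dual).trans (ψ.symm.trans ω)⟩⟩
  · exact hv.1.1.comp_embedding r.symm.toEmbedding
  · rw [EquivLike.range_comp]; exact hv.1.2
  · obtain ⟨c, ρ, h⟩ := hins
    exact ⟨c, ρ, fun x => h _⟩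

/-! ### Stereographic projection and affine functionals on the sphere. -/

section Stereographic

theorem E2.norm_sq (u : E2) : ‖u‖ ^ 2 = u 0 ^ 2 + u 1 ^ 2 := by
  rw [EuclideanSpace.real_norm_sq_eq, Fin.sum_univ_two]

theorem E3.dist_sq (x y : E3) :
    dist x y ^ 2 = (x 0 - y 0) ^ 2 + (x 1 - y 1) ^ 2 + (x 2 - y 2) ^ 2 := by
  rw [EuclideanSpace.dist_sq_eq, Fin.sum_univ_three]
  simp [Real.dist_eq, sq_abs]

theorem one_add_norm_sq_pos (u : E2) : 0 < 1 + ‖u‖ ^ 2 := by positivity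

/-- The distance of `stereoInv u` from the north pole. -/
noncomputable def stereoFactor (u : E2) : ℝ := (√(1 + ‖u‖ ^ 2))⁻¹

theorem stereoFactor_pos (u : E2) : 0 < stereoFactor u :=
  inv_pos.2 (Real.sqrt_pos.2 (one_add_norm_sq_pos u))

theorem stereoFactor_sq (u : E2) : stereoFactor u ^ 2 = (1 + ‖u‖ ^ 2)⁻¹ := by
  rw [stereoFactor, inv_pow, Real.sq_sqrt (one_add_norm_sq_pos u).le]

/-- Stereographic projection is the restriction of the inversion in the unit sphere about the north
pole, and `stereoFactor u` is the inverse distance of `(u, 0)` from that pole. -/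
theorem dist_stereoInv (u w : E2) :
    dist (stereoInv u) (stereoInv w) = stereoFactor u * stereoFactor w * dist u w := by
  have hu := (stereoFactor_pos u).le
  have hw := (stereoFactor_pos w).le
  rw [← sq_eq_sq₀ dist_nonneg (by positivity), mul_pow, mul_pow, stereoFactor_sq, stereoFactor_sq,
    dist_eq_norm u w, E3.dist_sq, E2.norm_sq (u - w)]
  have h1 := (one_add_norm_sq_pos u).ne'
  have h2 := (one_add_norm_sq_pos w).ne'
  simp only [stereoInv, PiLp.sub_apply, PiLp.toLp_apply, Matrix.cons_val]
  rw [E2.norm_sq] at *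
  rw [E2.norm_sq] at *
  field_simp
  ring

theorem dist_northPole_stereoInv (u : E2) : dist northPole (stereoInv u) = stereoFactor u := by
  rw [← sq_eq_sq₀ dist_nonneg (stereoFactor_pos u).le, stereoFactor_sq, E3.dist_sq]
  have h1 := (one_add_norm_sq_pos u).ne'
  simp only [stereoInv, northPole, PiLp.toLp_apply, Matrix.cons_val]
  rw [E2.norm_sq] at *
  field_simp
  ring

theorem northPole_ne_stereoInv (u : E2) : northPole ≠ stereoInv u := by
  rw [← dist_pos, dist_northPole_stereoInv]
  exact stereoFactor_pos u

theorem stereoInv_injective : Function.Injective stereoInv := by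
  intro u w h
  rw [← dist_eq_zero, dist_stereoInv, mul_eq_zero, or_iff_right, dist_eq_zero] at h
  · exact h
  · exact (mul_pos (stereoFactor_pos u) (stereoFactor_pos w)).ne'

theorem continuous_stereoInv : Continuous stereoInv := by
  unfold stereoInv
  refine (PiLp.continuous_toLp 2 _).comp (continuous_pi fun i => ?_)
  fin_cases i <;> simp <;>
    refine Continuous.div (by fun_prop) (by fun_prop) fun u => (one_add_norm_sq_pos u).ne'

theorem stereoInv_mem_sphere (u : E2) :
    stereoInv u ∈ Metric.sphere (!₂[0, 0, 1 / 2] : E3) (1 / 2) := by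
  rw [Metric.mem_sphere, ← sq_eq_sq₀ dist_nonneg (by norm_num), E3.dist_sq]
  have h1 := (one_add_norm_sq_pos u).ne'
  simp only [stereoInv, PiLp.toLp_apply, Matrix.cons_val]
  rw [E2.norm_sq] at *
  field_simp
  ring

theorem northPole_mem_sphere : northPole ∈ Metric.sphere (!₂[0, 0, 1 / 2] : E3) (1 / 2) := by
  rw [Metric.mem_sphere, ← sq_eq_sq₀ dist_nonneg (by norm_num), E3.dist_sq]
  simp [northPole]
  norm_num

theorem E3.dual_apply (f : E3 →L[ℝ] ℝ) (x : E3) :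
    f x = f (EuclideanSpace.single 0 1) * x 0 + f (EuclideanSpace.single 1 1) * x 1
      + f (EuclideanSpace.single 2 1) * x 2 := by
  rw [EuclideanSpace.dual_apply_eq_sum, Fin.sum_univ_three]

/-- In the plane of the stereographic projection with origin at `α`, an affine functional becomes
a quadratic polynomial. -/
theorem exists_quadratic (α : E2) (f : E3 →L[ℝ] ℝ) (c : ℝ) : ∃ A B₀ B₁ D : ℝ,
    c - f northPole = A ∧
    (∀ y, c - f (stereoInv (α + y))
      = (A * ‖y‖ ^ 2 - B₀ * y 0 - B₁ * y 1 + D) / (1 + ‖α + y‖ ^ 2)) ∧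
    (A = 0 → B₀ = 0 → B₁ = 0 → D = 0 → f = 0) := by
  set a := f (EuclideanSpace.single 0 1) with ha
  set b := f (EuclideanSpace.single 1 1) with hb
  set d := f (EuclideanSpace.single 2 1) with hd
  refine ⟨c - d, a - 2 * (c - d) * α 0, b - 2 * (c - d) * α 1,
    (c - d) * ‖α‖ ^ 2 - a * α 0 - b * α 1 + c, ?_, fun y => ?_, fun h1 h2 h3 h4 => ?_⟩
  · rw [E3.dual_apply]
    simp [northPole, hd]
  · have h := (one_add_norm_sq_pos (α + y)).ne'
    rw [E3.dual_apply, ← ha, ← hb, ← hd]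
    simp only [stereoInv, PiLp.toLp_apply, Matrix.cons_val]
    rw [E2.norm_sq (α + y)] at *
    rw [E2.norm_sq α, E2.norm_sq y]
    simp only [PiLp.add_apply] at *
    field_simp
    ring
  · have ha0 : a = 0 := by linear_combination h2 + 2 * α 0 * h1
    have hb0 : b = 0 := by linear_combination h3 + 2 * α 1 * h1
    rw [ha0, hb0] at h4
    have hc : c = 0 := by linear_combination h4 - ‖α‖ ^ 2 * h1
    have hd0 : d = 0 := by linear_combination hc - h1
    ext x
    rw [E3.dual_apply, ← ha, ← hb, ← hd, ha0, hb0, hd0]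
    simp

/-- Converse to `exists_quadratic`: the plane sections of the sphere are all the circles and lines
of the plane, so every choice of coefficients occurs. -/
theorem exists_functional (α : E2) (A B₀ B₁ D : ℝ) : ∃ (f : E3 →L[ℝ] ℝ) (c : ℝ),
    c - f northPole = A ∧
    ∀ y, c - f (stereoInv (α + y))
      = (A * ‖y‖ ^ 2 - B₀ * y 0 - B₁ * y 1 + D) / (1 + ‖α + y‖ ^ 2) := by
  let a := B₀ + 2 * A * α 0
  let b := B₁ + 2 * A * α 1
  let c := D - A * ‖α‖ ^ 2 + a * α 0 + b * α 1
  let f : E3 →L[ℝ] ℝ := a • EuclideanSpace.proj 0 + b • EuclideanSpace.proj 1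
    + (c - A) • EuclideanSpace.proj 2
  have hf (x : E3) : f x = a * x 0 + b * x 1 + (c - A) * x 2 := by simp [f]
  refine ⟨f, c, ?_, fun y => ?_⟩
  · rw [hf]
    simp [northPole]
  · have h := (one_add_norm_sq_pos (α + y)).ne'
    rw [hf]
    simp only [stereoInv, PiLp.toLp_apply, Matrix.cons_val, c, a, b]
    rw [E2.norm_sq (α + y)] at *
    rw [E2.norm_sq α, E2.norm_sq y]
    simp only [PiLp.add_apply] at *
    field_simp
    ring

end Stereographic

/-! ### Configurations on two rays: interlaced radii give realizations. -/

/-- The points `north`, `south`, `p i`, `q i` on `S2` whose stereographic projections are `∞`,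
`α`, points on a ray from `α` parallel to the first axis at the distances `p i`, and points on a
second ray from `α` at the distances `q i`. -/
noncomputable def wedgePoint {k : ℕ} (α : E2) (p q : Fin (k - 4) → ℝ) (γ : ℝ) :
    WedgeVertex k → E3
  | .north => northPole
  | .south => stereoInv α
  | .p i => stereoInv (α + !₂[p i, 0])
  | .q i => stereoInv (α + !₂[q i * Real.cos γ, q i * Real.sin γ])

/-- The values of an affine functional at the points `wedgePoint α p q γ`, up to positive
factors. -/
def supportValue {k : ℕ} (p q : Fin (k - 4) → ℝ) (A D b c : ℝ) : WedgeVertex k → ℝ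
  | .north => A
  | .south => D
  | .p i => A * p i ^ 2 - b * p i + D
  | .q i => A * q i ^ 2 - c * q i + D

theorem norm_sq_axis (x : ℝ) : ‖(!₂[x, 0] : E2)‖ ^ 2 = x ^ 2 := by
  simp [E2.norm_sq]

theorem norm_sq_polar (r γ : ℝ) :
    ‖(!₂[r * Real.cos γ, r * Real.sin γ] : E2)‖ ^ 2 = r ^ 2 := by
  simp only [E2.norm_sq, Matrix.cons_val]
  linear_combination r ^ 2 * Real.sin_sq_add_cos_sq γ

section wedgePoint

variable {k : ℕ} {α : E2} {p q : Fin (k - 4) → ℝ} {γ : ℝ}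

theorem wedgePoint_mem_sphere (x : WedgeVertex k) :
    wedgePoint α p q γ x ∈ Metric.sphere (!₂[0, 0, 1 / 2] : E3) (1 / 2) := by
  rcases x with _ | _ | i | i
  exacts [northPole_mem_sphere, stereoInv_mem_sphere _, stereoInv_mem_sphere _,
    stereoInv_mem_sphere _]

theorem supportValue_of_quadratic {A B₀ B₁ D c : ℝ} {f : E3 →L[ℝ] ℝ}
    (hN : c - f northPole = A) (h : ∀ y, c - f (stereoInv (α + y))
      = (A * ‖y‖ ^ 2 - B₀ * y 0 - B₁ * y 1 + D) / (1 + ‖α + y‖ ^ 2)) (x : WedgeVertex k) :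
    ∃ ω > 0, c - f (wedgePoint α p q γ x)
      = supportValue p q A D B₀ (B₀ * Real.cos γ + B₁ * Real.sin γ) x / ω := by
  rcases x with _ | _ | i | i
  · exact ⟨1, one_pos, by simpa [wedgePoint, supportValue] using hN⟩
  · refine ⟨_, one_add_norm_sq_pos (α + 0), ?_⟩
    have := h 0
    rw [add_zero] at this
    simpa [wedgePoint, supportValue] using this
  · refine ⟨_, one_add_norm_sq_pos (α + !₂[p i, 0]), ?_⟩
    simp only [wedgePoint, supportValue, h]
    rw [norm_sq_axis]
    simp
  · refine ⟨_, one_add_norm_sq_pos (α + !₂[q i * Real.cos γ, q i * Real.sin γ]), ?_⟩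
    simp only [wedgePoint, supportValue, h]
    rw [norm_sq_polar]
    simp only [Matrix.cons_val]
    ring

/-- Since `sin γ ≠ 0`, the linear parts `b` and `c` along the two rays can be prescribed
independently. Faces are thus governed by two quadratics sharing only leading coefficient and
constant term. -/
theorem isFace_wedgePoint_iff (hγ : Real.sin γ ≠ 0) {S : Set (WedgeVertex k)} :
    IsFace (wedgePoint α p q γ) S ↔ ∃ A D b c : ℝ, (∀ x, 0 ≤ supportValue p q A D b c x) ∧
      ∀ x, x ∈ S ↔ supportValue p q A D b c x = 0 := by
  have aux {A D b c d : ℝ} {f : E3 →L[ℝ] ℝ}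
      (h : ∀ x, ∃ ω > 0, d - f (wedgePoint α p q γ x) = supportValue p q A D b c x / ω) (x) :
      (f (wedgePoint α p q γ x) ≤ d ↔ 0 ≤ supportValue p q A D b c x) ∧
      (f (wedgePoint α p q γ x) = d ↔ supportValue p q A D b c x = 0) := by
    obtain ⟨ω, hω, h⟩ := h x
    constructor
    · rw [← sub_nonneg, h, le_div_iff₀ hω, zero_mul]
    · rw [eq_comm, ← sub_eq_zero, h, div_eq_zero_iff, or_iff_left hω.ne']
  constructor
  · rintro ⟨f, d, hf, hS⟩
    obtain ⟨A, B₀, B₁, D, hN, h, -⟩ := exists_quadratic α f d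
    have := aux (supportValue_of_quadratic hN h)
    exact ⟨_, _, _, _, fun x => (this x).1.1 (hf x), fun x => (hS x).trans (this x).2⟩
  · rintro ⟨A, D, b, c, h0, hS⟩
    obtain ⟨f, d, hN, h⟩ := exists_functional α A b ((c - b * Real.cos γ) / Real.sin γ) D
    have := aux (supportValue_of_quadratic hN h)
    rw [div_mul_cancel₀ _ hγ, add_sub_cancel] at this
    exact ⟨f, d, fun x => (this x).1.2 (h0 x), fun x => (hS x).trans (this x).2.symm⟩

theorem wedgePoint_injective (hγ : Real.sin γ ≠ 0) (hp : ∀ i, 0 < p i)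
    (hpi : Function.Injective p) (hq : ∀ i, 0 < q i) (hqi : Function.Injective q) :
    Function.Injective (wedgePoint α p q γ) := by
  have hpa (i : Fin (k - 4)) : α ≠ α + !₂[p i, 0] := fun h => by
    have := congrArg (fun u : E2 => u 0) h
    simp at this
    exact (hp i).ne' this
  have hqa (i : Fin (k - 4)) : α ≠ α + !₂[q i * Real.cos γ, q i * Real.sin γ] := fun h => by
    have := congrArg (fun u : E2 => u 1) h
    simp [hγ] at this
    exact (hq i).ne' this
  have hpq (i j : Fin (k - 4)) :
      α + !₂[p i, 0] ≠ α + !₂[q j * Real.cos γ, q j * Real.sin γ] := fun h => by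
    have := congrArg (fun u : E2 => u 1) h
    simp [hγ] at this
    exact (hq j).ne' this
  intro x y h
  rcases x with _ | _ | i | i <;> rcases y with _ | _ | j | j <;> simp only [wedgePoint] at h
  · rfl
  · exact (northPole_ne_stereoInv _ h).elim
  · exact (northPole_ne_stereoInv _ h).elim
  · exact (northPole_ne_stereoInv _ h).elim
  · exact (northPole_ne_stereoInv _ h.symm).elim
  · rfl
  · exact (hpa j (stereoInv_injective h)).elim
  · exact (hqa j (stereoInv_injective h)).elim
  · exact (northPole_ne_stereoInv _ h.symm).elim
  · exact (hpa i (stereoInv_injective h).symm).elim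
  · have := congrArg (fun u : E2 => u 0) (stereoInv_injective h)
    simp at this
    rw [hpi this]
  · exact (hpq i j (stereoInv_injective h)).elim
  · exact (northPole_ne_stereoInv _ h.symm).elim
  · exact (hqa i (stereoInv_injective h).symm).elim
  · exact (hpq j i (stereoInv_injective h).symm).elim
  · have := congrArg (fun u : E2 => u 1) (stereoInv_injective h)
    simp [hγ] at this
    rw [hqi this]

end wedgePoint

/-- The conditions on the positions of the vertices of `F_k` on two rays from `south`. -/
structure InterlacedRadii {m : ℕ} (p q : Fin m → ℝ) : Prop where
  p_pos : ∀ i, 0 < p i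
  p_mono : StrictMono p
  q_pos : ∀ i, 0 < q i
  q_mono : StrictMono q
  -- The power of `south` with respect to the circle through the quadrilateral, computed along each
  -- ray.
  mul_eq : ∀ i j : Fin m, j.val = i.val + 1 → q i * q j = p i * p j

namespace WedgeVertex

/-- No listed facet contains another one; this yields their maximality among proper faces. -/
theorem eq_of_incident_imp {k : ℕ} (hk : 5 ≤ k) {j j' : Fin (k - 1)}
    (h : ∀ x : WedgeVertex k, Incident x j → Incident x j') : j = j' := by
  have hN := h north
  have hS := h south
  simp only [Incident] at hN hS
  rw [Fin.ext_iff]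
  by_cases h0 : j.val = 0
  · have := h (p ⟨0, by lia⟩)
    simp only [Incident] at this
    lia
  by_cases h1 : j.val = 1
  · have h1 := h (p ⟨0, by lia⟩)
    have h2 := h (q ⟨0, by lia⟩)
    simp only [Incident] at h1 h2
    lia
  by_cases h2 : j.val + 2 = k
  · have h1 := h (q ⟨k - 5, by lia⟩)
    simp only [Incident] at h1
    lia
  by_cases h3 : j.val + 3 = k
  · have h1 := h (p ⟨k - 5, by lia⟩)
    have h2 := h (q ⟨k - 5, by lia⟩)
    simp only [Incident] at h1 h2
    lia
  · have h1 := h (p ⟨j.val - 2, by lia⟩)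
    have h2 := h (p ⟨j.val - 1, by lia⟩)
    have h3 := h (q ⟨j.val - 1, by lia⟩)
    simp only [Incident] at h1 h2 h3
    lia

theorem exists_not_incident {k : ℕ} (hk : 5 ≤ k) (j : Fin (k - 1)) :
    ∃ x : WedgeVertex k, ¬ Incident x j := by
  by_contra! h
  have h1 := eq_of_incident_imp hk (j := ⟨0, by lia⟩) fun x _ => h x
  have h2 := eq_of_incident_imp hk (j := ⟨1, by lia⟩) fun x _ => h x
  have := congrArg Fin.val (h1.trans h2.symm)
  simp at this

/-- The position of a vertex of `F_k` on its ray. -/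
def index {k : ℕ} : WedgeVertex k → ℕ
  | north => k - 4
  | south => 0
  | p i => i.val
  | q i => i.val

end WedgeVertex

section Quadratic

variable {m : ℕ} {r : Fin m → ℝ} {A D b : ℝ}

/-- The position of a zero of a quadratic polynomial which is non-negative on a sequence. -/
theorem mul_le_and_le_mul_of_zero (hr : ∀ i, 0 < r i) (hmono : StrictMono r) (hA : 0 < A)
    (h0 : ∀ i, 0 ≤ A * r i ^ 2 - b * r i + D) {i : Fin m} (hi : A * r i ^ 2 - b * r i + D = 0) :
    (∀ l l' : Fin m, l < l' → l' ≤ i → A * (r l * r l') ≤ D) ∧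
      ∀ l l' : Fin m, i ≤ l → l < l' → D ≤ A * (r l * r l') := by
  have hD : D = b * r i - A * r i ^ 2 := by linarith
  -- The value at `r l` minus the zero value at `r i` factors; the sign of the first factor decides
  -- that of the second.
  have key (l) : 0 ≤ (r l - r i) * (A * (r l + r i) - b) := by
    have := h0 l
    rw [hD] at this
    linarith
  constructor
  · intro l l' hl hl'
    have h1 : A * (r l + r i) - b ≤ 0 := by
      have := sub_neg.2 (hmono (hl.trans_le hl'))
      by_contra! h
      exact absurd (key l) (not_le.2 (mul_neg_of_neg_of_pos this h))
    have h2 : A * (r l * r l') ≤ A * (r l * r i) := by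
      have := hr l
      gcongr
      exact hmono.monotone hl'
    have := mul_nonneg (hr i).le (sub_nonneg.2 (sub_nonpos.1 h1))
    rw [hD]
    linarith
  · intro l l' hl hl'
    have h1 : 0 ≤ A * (r l' + r i) - b := by
      have := sub_pos.2 (hmono (hl.trans_lt hl'))
      by_contra! h
      exact absurd (key l') (not_le.2 (mul_neg_of_pos_of_neg this h))
    have h2 : A * (r i * r l') ≤ A * (r l * r l') := by
      have := hr l'
      gcongr
      exact hmono.monotone hl
    have := mul_nonneg (hr i).le h1
    rw [hD]
    linarith

end Quadratic

section Covering

open WedgeVertex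

variable {k : ℕ} {p q : Fin (k - 4) → ℝ}

/-- Every proper face is contained in one of the facets of `F_k`. -/
theorem InterlacedRadii.exists_incident (hk : 5 ≤ k) (hpq : InterlacedRadii p q) {A D b c : ℝ}
    (h0 : ∀ x, 0 ≤ supportValue p q A D b c x) (hne : ∃ x, supportValue p q A D b c x ≠ 0) :
    ∃ j : Fin (k - 1), ∀ x, supportValue p q A D b c x = 0 → Incident x j := by
  obtain ⟨hp, hpm, hq, hqm, hmul⟩ := hpq
  have hp0 (i) : 0 ≤ A * p i ^ 2 - b * p i + D := h0 (.p i)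
  have hq0 (i) : 0 ≤ A * q i ^ 2 - c * q i + D := h0 (.q i)
  let last : Fin (k - 4) := ⟨k - 5, by lia⟩
  let first : Fin (k - 4) := ⟨0, by lia⟩
  have hlast (i : Fin (k - 4)) : i ≤ last := by simp only [Fin.le_def, last]; lia
  have hfirst (i : Fin (k - 4)) : first ≤ i := by simp [Fin.le_def, first]
  -- The signs of `A` and `D` tell whether the face contains `north` and `south`. Both: a polygon.
  -- Only one: the triangle at that vertex, as a zero must be the extreme point of its ray. Neither:
  -- the neighbourhood of a single step on the rays.
  rcases (show 0 ≤ A from h0 .north).eq_or_lt with rfl | hA <;>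
    rcases (show 0 ≤ D from h0 .south).eq_or_lt with rfl | hD
  · by_cases hb : b = 0
    · have hc : c ≠ 0 := by
        rintro rfl
        obtain ⟨x, hx⟩ := hne
        rcases x with _ | _ | i | i <;> simp [supportValue, hb] at hx
      refine ⟨⟨0, by lia⟩, fun x hx => ?_⟩
      rcases x with _ | _ | i | i <;> simp [Incident]
      simp [supportValue, hc, (hq i).ne'] at hx
    · refine ⟨⟨k - 2, by lia⟩, fun x hx => ?_⟩
      rcases x with _ | _ | i | i <;> simp only [Incident] <;> try lia
      simp [supportValue, hb, (hp i).ne'] at hx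
  · have aux {r : Fin (k - 4) → ℝ} {b : ℝ} (hr : ∀ i, 0 < r i) (hm : StrictMono r)
        (h : ∀ i, 0 ≤ 0 * r i ^ 2 - b * r i + D) {i} (hi : 0 * r i ^ 2 - b * r i + D = 0) :
        i = last := by
      have h1 : D = b * r i := by linarith
      have hb : 0 < b := pos_of_mul_pos_left (h1 ▸ hD) (hr i).le
      have h2 : b * r last ≤ b * r i := by linarith [h last]
      exact le_antisymm (hlast i) (hm.le_iff_le.1 (le_of_mul_le_mul_left h2 hb))
    refine ⟨⟨k - 3, by lia⟩, fun x hx => ?_⟩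
    rcases x with _ | _ | i | i <;> simp only [Incident]
    · lia
    · exact (hD.ne' hx).elim
    · rw [aux hp hpm hp0 hx]; simp only [last]; lia
    · rw [aux hq hqm hq0 hx]; simp only [last]; lia
  · have aux {r : Fin (k - 4) → ℝ} {b : ℝ} (hr : ∀ i, 0 < r i) (hm : StrictMono r)
        (h : ∀ i, 0 ≤ A * r i ^ 2 - b * r i + 0) {i} (hi : A * r i ^ 2 - b * r i + 0 = 0) :
        i = first := by
      have hb : b = A * r i :=
        mul_right_cancel₀ (hr i).ne' (by linarith)
      have h2 : A * r i ≤ A * r first :=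
        le_of_mul_le_mul_right (by rw [← hb]; linarith [h first]) (hr first)
      exact le_antisymm (hm.le_iff_le.1 (le_of_mul_le_mul_left h2 hA)) (hfirst i)
    refine ⟨⟨1, by lia⟩, fun x hx => ?_⟩
    rcases x with _ | _ | i | i <;> simp only [Incident]
    · exact (hA.ne' hx).elim
    · lia
    · rw [aux hp hpm hp0 hx]; simp only [first]; lia
    · rw [aux hq hqm hq0 hx]; simp only [first]; lia
  -- A zero with index `n` on either ray places `D / A` between the products of consecutive `p`'s
  -- before and after `n`; for the second ray the equality of products transfers the bounds to `p`.
  -- As these products increase strictly, the indices of two zeros differ by at most one.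
  · have aux (x) (hx : supportValue p q A D b c x = 0) : x.index < k - 4 ∧
        (∀ l l' : Fin (k - 4), l'.val = l.val + 1 → l'.val ≤ x.index → A * (p l * p l') ≤ D) ∧
        ∀ l l' : Fin (k - 4), l'.val = l.val + 1 → x.index ≤ l.val → D ≤ A * (p l * p l') := by
      rcases x with _ | _ | i | i
      · exact (hA.ne' hx).elim
      · exact (hD.ne' hx).elim
      · have := mul_le_and_le_mul_of_zero hp hpm hA hp0 hx
        exact ⟨i.2, fun l l' h1 h2 => this.1 l l' (Fin.lt_def.2 (by lia)) h2,
          fun l l' h1 h2 => this.2 l l' h2 (Fin.lt_def.2 (by lia))⟩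
      · have := mul_le_and_le_mul_of_zero hq hqm hA hq0 hx
        exact ⟨i.2,
          fun l l' h1 h2 => hmul l l' h1 ▸ this.1 l l' (Fin.lt_def.2 (by lia)) h2,
          fun l l' h1 h2 => hmul l l' h1 ▸ this.2 l l' h2 (Fin.lt_def.2 (by lia))⟩
    have hnear (x y) (hx : supportValue p q A D b c x = 0) (hy : supportValue p q A D b c y = 0) :
        y.index ≤ x.index + 1 := by
      by_contra! h
      have hy' := (aux y hy).1
      have h1 := (aux x hx).2.2 ⟨x.index, by lia⟩ ⟨x.index + 1, by lia⟩ rfl le_rfl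
      have h2 := (aux y hy).2.1 ⟨x.index + 1, by lia⟩ ⟨x.index + 2, by lia⟩ rfl h
      have h3 := le_of_mul_le_mul_left (h2.trans h1) hA
      have h4 : p ⟨x.index, by lia⟩ < p ⟨x.index + 2, by lia⟩ := hpm (Fin.lt_def.2 (by simp))
      nlinarith [hp ⟨x.index + 1, by lia⟩]
    by_cases hex : ∃ x, supportValue p q A D b c x = 0
    · have : ∃ n, ∃ x, supportValue p q A D b c x = 0 ∧ x.index = n :=
        let ⟨x, hx⟩ := hex; ⟨_, x, hx, rfl⟩
      classical
      obtain ⟨x, hx, hxn⟩ := Nat.find_spec this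
      have hxk := (aux x hx).1
      -- With the least index `n` of a zero, all zeros have index `n` or `n + 1` and lie on facet `n
      -- + 2`; for `n = k - 5` this is the north triangle.
      refine ⟨⟨x.index + 2, by lia⟩, fun y hy => ?_⟩
      have h1 := Nat.find_min' this ⟨y, hy, rfl⟩
      have h2 := hnear x y hx hy
      rcases y with _ | _ | i | i
      · exact (hA.ne' hy).elim
      · exact (hD.ne' hy).elim
      all_goals
        simp only [index, Incident] at *
        lia
    · exact ⟨⟨0, by lia⟩, fun x hx => (hex ⟨x, hx⟩).elim⟩

/-- The quadratics on each ray are `r` on one ray and `0` on the other for a polygon, `r (r - r₀)`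
for the south triangle, `1 - r / r_last` for the north one, and `(r - r_l)(r - r_l')` for a
quadrilateral. In the last case the constant terms agree by `mul_eq`. -/
theorem InterlacedRadii.exists_supportValue (hk : 5 ≤ k) (hpq : InterlacedRadii p q)
    (j : Fin (k - 1)) : ∃ A D b c : ℝ, (∀ x, 0 ≤ supportValue p q A D b c x) ∧
      ∀ x, Incident x j ↔ supportValue p q A D b c x = 0 := by
  obtain ⟨hp, hpm, hq, hqm, hmul⟩ := hpq
  let last : Fin (k - 4) := ⟨k - 5, by lia⟩
  let first : Fin (k - 4) := ⟨0, by lia⟩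
  have hlast (i : Fin (k - 4)) : i ≤ last := by simp only [Fin.le_def, last]; lia
  have hfirst (i : Fin (k - 4)) : first ≤ i := by simp [Fin.le_def, first]
  by_cases h0 : j.val = 0
  · refine ⟨0, 0, 0, -1, fun x => ?_, fun x => ?_⟩ <;> rcases x with _ | _ | i | i <;>
      simp [supportValue, Incident, h0, (hq _).le, (hq _).ne']
    lia
  by_cases h1 : j.val + 2 = k
  · refine ⟨0, 0, -1, 0, fun x => ?_, fun x => ?_⟩ <;> rcases x with _ | _ | i | i <;>
      simp [supportValue, Incident, h0, h1, (hp _).le, (hp _).ne']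
    lia
  by_cases h2 : j.val = 1
  · have h {r : Fin (k - 4) → ℝ} (hr : ∀ i, 0 < r i) (hm : StrictMono r) (i) :
        0 ≤ 1 * r i ^ 2 - r first * r i + 0 ∧
        (i.val = 0 ↔ 1 * r i ^ 2 - r first * r i + 0 = 0) := by
      have e : 1 * r i ^ 2 - r first * r i + 0 = r i * (r i - r first) := by ring
      rw [e, mul_eq_zero, sub_eq_zero, hm.injective.eq_iff, or_iff_right (hr i).ne', Fin.ext_iff]
      exact ⟨mul_nonneg (hr i).le (sub_nonneg.2 (hm.monotone (hfirst i))), Iff.rfl⟩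
    refine ⟨1, 0, p first, q first, fun x => ?_, fun x => ?_⟩ <;> rcases x with _ | _ | i | i <;>
      simp only [supportValue]
    · norm_num
    · norm_num
    · exact (h hp hpm i).1
    · exact (h hq hqm i).1
    · simp only [Incident, one_ne_zero]; lia
    · simp only [Incident]; lia
    · rw [← (h hp hpm i).2]; simp only [Incident]; lia
    · rw [← (h hq hqm i).2]; simp only [Incident]; lia
  by_cases h3 : j.val + 3 = k
  · have h {r : Fin (k - 4) → ℝ} (hr : ∀ i, 0 < r i) (hm : StrictMono r) (i) :
        0 ≤ 0 * r i ^ 2 - (r last)⁻¹ * r i + 1 ∧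
        (i.val = k - 5 ↔ 0 * r i ^ 2 - (r last)⁻¹ * r i + 1 = 0) := by
      have hl := hr last
      have e : 0 * r i ^ 2 - (r last)⁻¹ * r i + 1 = (r last)⁻¹ * (r last - r i) := by
        field_simp; ring
      rw [e, mul_eq_zero, sub_eq_zero, hm.injective.eq_iff, or_iff_right (inv_pos.2 hl).ne',
        Fin.ext_iff]
      exact ⟨mul_nonneg (inv_pos.2 hl).le (sub_nonneg.2 (hm.monotone (hlast i))), eq_comm⟩
    refine ⟨0, 1, (p last)⁻¹, (q last)⁻¹, fun x => ?_, fun x => ?_⟩ <;>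
      rcases x with _ | _ | i | i <;> simp only [supportValue]
    · norm_num
    · norm_num
    · exact (h hp hpm i).1
    · exact (h hq hqm i).1
    · simp only [Incident]; lia
    · simp only [Incident, one_ne_zero]; lia
    · rw [← (h hp hpm i).2]; simp only [Incident]; lia
    · rw [← (h hq hqm i).2]; simp only [Incident]; lia
  let l : Fin (k - 4) := ⟨j.val - 2, by lia⟩
  let l' : Fin (k - 4) := ⟨j.val - 1, by lia⟩
  have hl : l'.val = l.val + 1 := by simp only [l, l']; lia
  have h {r : Fin (k - 4) → ℝ} (hm : StrictMono r) (hr : r l * r l' = p l * p l') (i) :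
      0 ≤ 1 * r i ^ 2 - (r l + r l') * r i + p l * p l' ∧
      (i = l ∨ i = l' ↔ 1 * r i ^ 2 - (r l + r l') * r i + p l * p l' = 0) := by
    have e : 1 * r i ^ 2 - (r l + r l') * r i + p l * p l' = (r i - r l) * (r i - r l') := by
      rw [← hr]; ring
    rw [e, mul_eq_zero, sub_eq_zero, sub_eq_zero, hm.injective.eq_iff, hm.injective.eq_iff]
    refine ⟨?_, Iff.rfl⟩
    rcases le_or_gt i l with h | h
    · exact mul_nonneg_of_nonpos_of_nonpos (sub_nonpos.2 (hm.monotone h))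
        (sub_nonpos.2 (hm.monotone (h.trans (Fin.le_def.2 (by lia)))))
    · exact mul_nonneg (sub_nonneg.2 (hm.monotone h.le))
        (sub_nonneg.2 (hm.monotone (Fin.le_def.2 (by rw [Fin.lt_def] at h; lia))))
  have hpos := mul_pos (hp l) (hp l')
  refine ⟨1, p l * p l', p l + p l', q l + q l', fun x => ?_, fun x => ?_⟩ <;>
    rcases x with _ | _ | i | i <;> simp only [supportValue]
  · norm_num
  · exact hpos.le
  · exact (h hpm rfl i).1
  · exact (h hqm (hmul l l' hl) i).1
  · simp only [Incident, one_ne_zero]; lia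
  · simp only [Incident, hpos.ne']; lia
  · rw [← (h hpm rfl i).2]; simp only [Incident, Fin.ext_iff, l, l']; lia
  · rw [← (h hqm (hmul l l' hl) i).2]; simp only [Incident, Fin.ext_iff, l, l']; lia

/-- A proper affine span has its direction in the kernel of a nonzero functional, which is then
constant on the family. -/
theorem affineSpan_range_eq_top {ι : Type*} [Nonempty ι] {v : ι → E3}
    (h : ∀ (f : E3 →L[ℝ] ℝ) (c : ℝ), (∀ i, f (v i) = c) → f = 0) :
    affineSpan ℝ (range v) = ⊤ := by
  by_contra hne
  have hlt : vectorSpan ℝ (range v) < ⊤ := by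
    refine lt_top_iff_ne_top.2 fun h => hne ?_
    exact (AffineSubspace.affineSpan_eq_top_iff_vectorSpan_eq_top_of_nonempty ℝ E3 E3
      (range_nonempty v)).2 h
  obtain ⟨f, hf, hle⟩ := Submodule.exists_le_ker_of_lt_top _ hlt
  have i₀ : ι := Classical.arbitrary ι
  refine hf ?_
  have := h (LinearMap.toContinuousLinearMap f) (f (v i₀)) fun i => ?_
  · ext x
    have := congrArg (fun g : E3 →L[ℝ] ℝ => g x) this
    simpa using this
  · have := hle (vsub_mem_vectorSpan ℝ (mem_range_self i) (mem_range_self i₀))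
    rw [LinearMap.mem_ker, vsub_eq_sub, map_sub, sub_eq_zero] at this
    exact this

/-- The listed sets are faces, every proper face lies in one of them, and none contains another, so
they are exactly the facets. The vertices are convexly independent because they lie on a sphere. -/
theorem InterlacedRadii.isWedgeRealization (hk : 5 ≤ k) (hpq : InterlacedRadii p q) (α : E2)
    {γ : ℝ} (hγ : Real.sin γ ≠ 0) : IsWedgeRealization (wedgePoint α p q γ) := by
  have hface (j : Fin (k - 1)) : IsFace (wedgePoint α p q γ) {x | Incident x j} :=
    (isFace_wedgePoint_iff hγ).2 (hpq.exists_supportValue hk j)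
  have hcov (S : Set (WedgeVertex k)) (hS : IsFace (wedgePoint α p q γ) S) (hne : S ≠ univ) :
      ∃ j : Fin (k - 1), S ⊆ {x | Incident x j} := by
    obtain ⟨A, D, b, c, h0, h⟩ := (isFace_wedgePoint_iff hγ).1 hS
    obtain ⟨j, hj⟩ := hpq.exists_incident hk h0 <| by
      by_contra! h'
      exact hne (eq_univ_of_forall fun x => (h x).2 (h' x))
    exact ⟨j, fun x hx => hj x ((h x).1 hx)⟩
  have hne (j : Fin (k - 1)) : {x : WedgeVertex k | Incident x j} ≠ univ := by
    obtain ⟨x, hx⟩ := exists_not_incident hk j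
    exact fun h => hx (h ▸ mem_univ x : x ∈ {x | Incident x j})
  have : Nonempty (WedgeVertex k) := ⟨north⟩
  refine ⟨⟨convexIndependent_of_dist_eq (wedgePoint_injective hγ hpq.p_pos hpq.p_mono.injective
    hpq.q_pos hpq.q_mono.injective) wedgePoint_mem_sphere,
    affineSpan_range_eq_top fun f c hf => ?_⟩, fun S => ?_⟩
  · obtain ⟨A, B₀, B₁, D, hN, h, hz⟩ := exists_quadratic α f c
    have hs (x : WedgeVertex k) :
        supportValue p q A D B₀ (B₀ * Real.cos γ + B₁ * Real.sin γ) x = 0 := by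
      obtain ⟨ω, hω, h⟩ := supportValue_of_quadratic (p := p) (q := q) (γ := γ) hN h x
      rw [hf, sub_self, eq_comm, div_eq_zero_iff, or_iff_left hω.ne'] at h
      exact h
    have hA : A = 0 := hs north
    have hD : D = 0 := hs south
    have hp := hs (.p ⟨0, by lia⟩)
    have hq := hs (.q ⟨0, by lia⟩)
    simp [supportValue, hA, hD, (hpq.p_pos _).ne'] at hp
    simp [supportValue, hA, hD, (hpq.q_pos _).ne', hp, hγ] at hq
    exact hz hA hp hq hD
  · rw [mem_facets_iff hk]
    constructor
    · rintro ⟨hS, hSne, hmax⟩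
      obtain ⟨j, hj⟩ := hcov S hS hSne
      exact ⟨j, ((hmax _ (hface j) hj).resolve_right (hne j)).symm⟩
    · rintro ⟨j, rfl⟩
      refine ⟨hface j, hne j, fun T hT hjT => ?_⟩
      by_cases hTne : T = univ
      · exact .inr hTne
      obtain ⟨j', hj'⟩ := hcov T hT hTne
      obtain rfl := eq_of_incident_imp hk fun x hx => hj' (hjT hx)
      exact .inl (Subset.antisymm hj' hjT)

end Covering

/-! ### Realizations in position come from interlaced radii. -/

theorem Fin.strictMono_of_consecutive {m : ℕ} {r : Fin m → ℝ}
    (h : ∀ i j : Fin m, j.val = i.val + 1 → r i < r j) : StrictMono r := by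
  have aux (n : ℕ) : ∀ i j : Fin m, j.val = i.val + 1 + n → r i < r j := by
    induction n with
    | zero => exact fun i j hij => h i j hij
    | succ n ih =>
      intro i j hij
      exact (ih i ⟨i.val + 1 + n, by lia⟩ rfl).trans (h _ j (by simp only; lia))
  intro i j hij
  exact aux (j.val - i.val - 1) i j (by rw [Fin.lt_def] at hij; lia)

/-- A sequence with minimal first term no term of which lies between two consecutive ones is
increasing. -/
theorem Fin.strictMono_of_empty_intervals {m : ℕ} {r : Fin m → ℝ}
    (h0 : ∀ i j : Fin m, i.val = 0 → j ≠ i → r i < r j)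
    (h : ∀ i j l : Fin m, j.val = i.val + 1 → l ≠ i → l ≠ j → 0 < (r l - r i) * (r l - r j)) :
    StrictMono r := by
  have aux (n : ℕ) : ∀ i j : Fin m, i.val = n → i < j → r i < r j := by
    induction n with
    | zero => exact fun i j hi hij => h0 i j hi hij.ne'
    | succ n ih =>
      -- By induction `r j` exceeds the preceding term; not lying between that term and `r i`, it
      -- exceeds `r i` as well.
      intro i j hi hij
      have hj : r ⟨n, by lia⟩ < r j := ih _ _ rfl (Fin.lt_def.2 (by
        rw [Fin.lt_def] at hij; simp only; lia))
      have := h ⟨n, by lia⟩ i j (by simp only; lia) (fun hj => by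
        rw [Fin.lt_def, hj] at hij; simp only at hij; lia) hij.ne'
      exact sub_pos.1 (pos_of_mul_pos_right this (sub_pos.2 hj).le)
  exact fun i j hij => aux _ i j rfl hij

theorem vieta_of_zeros {A D b x y : ℝ} (hx : A * x ^ 2 - b * x + D = 0)
    (hy : A * y ^ 2 - b * y + D = 0) (hxy : x ≠ y) : b = A * (x + y) ∧ D = A * (x * y) := by
  have hb : b = A * (x + y) :=
    mul_left_cancel₀ (sub_ne_zero.2 hxy) (by linear_combination hy - hx)
  exact ⟨hb, by rw [hb] at hx; linear_combination hx⟩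

section Realization

open WedgeVertex

variable {k : ℕ} {v : WedgeVertex k → E3}

theorem exists_quadratic_of_isFace (hk : 5 ≤ k) (hv : ∀ S ∈ facets k, IsFace v S)
    {u : WedgeVertex k → E2} (hN : v north = northPole) (hu : ∀ x ≠ north, v x = stereoInv (u x))
    (j : Fin (k - 1)) : ∃ A B₀ B₁ D : ℝ,
      0 ≤ A ∧ (Incident (north : WedgeVertex k) j ↔ A = 0) ∧
      ∀ x ≠ north, ∀ y, u x = u south + y → 0 ≤ A * ‖y‖ ^ 2 - B₀ * y 0 - B₁ * y 1 + D ∧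
        (Incident x j ↔ A * ‖y‖ ^ 2 - B₀ * y 0 - B₁ * y 1 + D = 0) := by
  obtain ⟨f, c, hf, hS⟩ := hv _ ((mem_facets_iff hk).2 ⟨j, rfl⟩)
  obtain ⟨A, B₀, B₁, D, hA, h, -⟩ := exists_quadratic (u south) f c
  refine ⟨A, B₀, B₁, D, ?_, ?_, fun x hx y hxy => ?_⟩
  · rw [← hA, ← hN]; exact sub_nonneg.2 (hf _)
  · rw [← hA, ← hN, sub_eq_zero, eq_comm]; exact hS north
  · have hy := h y
    rw [← hxy, ← hu x hx] at hy
    have hω := one_add_norm_sq_pos (u x)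
    constructor
    · rw [← zero_mul (1 + ‖u x‖ ^ 2), ← le_div_iff₀ hω, ← hy]; exact sub_nonneg.2 (hf x)
    · rw [← or_iff_left (a := _ = (0 : ℝ)) hω.ne', ← div_eq_zero_iff, ← hy, sub_eq_zero, eq_comm]
      exact hS x

/-- Points on `S2` in suitable position, the facets of `F_k` on which are faces, form one of the
standard realizations. -/
theorem exists_eq_wedgePoint_of_isFace (hk : 5 ≤ k) (hinj : Function.Injective v)
    (hv : ∀ S ∈ facets k, IsFace v S) {u : WedgeVertex k → E2} (hN : v north = northPole) (hu : ∀ x ≠ north, v x = stereoInv (u x))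
    {i₀ : Fin (k - 4)} (hi₀ : i₀.val = 0) {x d γ : ℝ} (hx : 0 < x) (hd : 0 < d)
    (hγ : 0 < Real.sin γ) (hp₀ : u (p i₀) = u south + !₂[x, 0])
    (hq₀ : u (q i₀) = u south + !₂[d * Real.cos γ, d * Real.sin γ]) :
    ∃ r s : Fin (k - 4) → ℝ, InterlacedRadii r s ∧ v = wedgePoint (u south) r s γ := by
  have hy (x) : u x = u south + (u x - u south) := by abel
  obtain ⟨r, s, hr, hs, hvrs⟩ : ∃ r s : Fin (k - 4) → ℝ, (∀ i, 0 < r i) ∧ (∀ i, 0 < s i) ∧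
      v = wedgePoint (u south) r s γ := by
    -- The polynomials of the two polygons have `A = D = 0`, so each is a linear form vanishing on
    -- its own line through `south`. Its sign on the other polygon puts those vertices on a ray
    -- instead of a full line.
    obtain ⟨A, B₀, B₁, D, -, hA, h⟩ := exists_quadratic_of_isFace hk hv hN hu ⟨0, by lia⟩
    obtain ⟨A', B₀', B₁', D', -, hA', h'⟩ := exists_quadratic_of_isFace hk hv hN hu ⟨k - 2, by lia⟩
    have hA : A = 0 := hA.1 (by simp [Incident])
    have hA' : A' = 0 := hA'.1 (by simp only [Incident]; lia)
    subst hA hA'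
    have hD := (h south (by simp) 0 (by simp)).2.1 (by simp [Incident])
    have hD' := (h' south (by simp) 0 (by simp)).2.1 (by simp only [Incident]; lia)
    simp only [zero_mul, PiLp.zero_apply, mul_zero, sub_zero, zero_add] at hD hD'
    subst hD hD'
    have hB₀ := (h (p i₀) (by simp) _ hp₀).2.1 (by simp [Incident])
    simp [hx.ne'] at hB₀
    subst hB₀
    have hB₁ := h (q i₀) (by simp) _ hq₀
    simp [Incident, hd.ne', hγ.ne'] at hB₁
    replace hB₁ : B₁ < 0 := by
      refine lt_of_le_of_ne ?_ ?_
      · by_contra! hB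
        linarith [mul_pos hB (mul_pos hd hγ)]
      · rintro rfl; simp at hB₁; lia
    have hBq := (h' (q i₀) (by simp) _ hq₀).2.1 (by simp only [Incident]; lia)
    replace hBq : B₀' * Real.cos γ + B₁' * Real.sin γ = 0 := by
      simp at hBq
      exact (mul_eq_zero.1 (show d * (B₀' * Real.cos γ + B₁' * Real.sin γ) = 0 by
        linarith)).resolve_left hd.ne'
    have hB₀' : B₀' < 0 := by
      have hB := h' (p i₀) (by simp) _ hp₀
      have hinc : ¬ Incident (p i₀) (⟨k - 2, by lia⟩ : Fin (k - 1)) := by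
        simp only [Incident]; lia
      simp [hinc, hx.ne'] at hB
      refine lt_of_le_of_ne ?_ hB.2
      by_contra! h
      linarith [mul_pos h hx]
    refine ⟨fun i => (u (p i) - u south) 0, fun i => (u (q i) - u south) 1 / Real.sin γ,
      fun i => ?_, fun i => ?_, ?_⟩
    · have h1 := h' (p i) (by simp) _ (hy _)
      have h2 := (h (p i) (by simp) _ (hy _)).2.1 (by simp [Incident])
      have hinc : ¬ Incident (p i) (⟨k - 2, by lia⟩ : Fin (k - 1)) := by
        simp only [Incident]; lia
      simp only [zero_mul, zero_sub, sub_zero, add_zero, neg_eq_zero, mul_eq_zero, hB₁.ne,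
        false_or] at h2
      simp only [hinc, false_iff, h2, zero_mul, mul_zero, zero_sub, sub_zero, add_zero,
        neg_eq_zero, mul_eq_zero, not_or] at h1
      refine lt_of_le_of_ne ?_ (Ne.symm h1.2.2)
      by_contra! hneg
      linarith [mul_pos_of_neg_of_neg hB₀' hneg]
    · have h1 := h (q i) (by simp) _ (hy _)
      have hinc : ¬ Incident (q i) (⟨0, by lia⟩ : Fin (k - 1)) := by
        simp only [Incident]; lia
      simp only [hinc, false_iff, zero_mul, zero_sub, sub_zero, add_zero,
        neg_eq_zero, mul_eq_zero, not_or] at h1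
      refine div_pos (lt_of_le_of_ne ?_ (Ne.symm h1.2.2)) hγ
      by_contra! hneg
      linarith [mul_pos_of_neg_of_neg hB₁ hneg]
    · funext z
      by_cases hz : z = north
      · rw [hz, hN]; rfl
      rw [hu z hz]
      rcases z with _ | _ | i | i
      · exact (hz rfl).elim
      · rfl
      · have h2 := (h (p i) (by simp) _ (hy _)).2.1 (by simp [Incident])
        simp only [zero_mul, zero_sub, sub_zero, add_zero, neg_eq_zero, mul_eq_zero, hB₁.ne,
          false_or] at h2
        change _ = stereoInv _
        congr 1
        ext l
        fin_cases l
        · simp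
        · simp at h2 ⊢
          linarith
      · have h2 := (h' (q i) (by simp) _ (hy _)).2.1 (by simp only [Incident]; lia)
        have h3 : B₀' * ((u (q i) - u south) 0 * Real.sin γ
            - (u (q i) - u south) 1 * Real.cos γ) = 0 := by
          linear_combination -Real.sin γ * h2 - (u (q i) - u south) 1 * hBq
        have h3 := (mul_eq_zero.1 h3).resolve_left hB₀'.ne
        change _ = stereoInv _
        congr 1
        ext l
        fin_cases l
        · simp at h3 ⊢
          field_simp
          linarith
        · simp
          field_simp
          ring
  have hri : Function.Injective r := fun i j h => by
    have : v (p i) = v (p j) := by rw [hvrs]; simp [wedgePoint, h]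
    simpa using hinj this
  have hsi : Function.Injective s := fun i j h => by
    have : v (q i) = v (q j) := by rw [hvrs]; simp [wedgePoint, h]
    simpa using hinj this
  have hface (j : Fin (k - 1)) := (isFace_wedgePoint_iff hγ.ne').1 (hvrs ▸
    hv _ ((mem_facets_iff hk).2 ⟨j, rfl⟩))
  have hfirst {w : Fin (k - 4) → ℝ} {A b : ℝ} (hA : 0 < A) (hw : ∀ i, 0 < w i)
      (h0 : ∀ i, 0 ≤ A * w i ^ 2 - b * w i + 0)
      (h : ∀ i : Fin (k - 4), i.val = 0 ↔ A * w i ^ 2 - b * w i + 0 = 0) (i j : Fin (k - 4))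
      (hi : i.val = 0) (hj : j ≠ i) : w i < w j := by
    have hb : b = A * w i := mul_right_cancel₀ (hw i).ne' (by linarith [(h i).1 hi])
    have h1 : 0 < A * w j ^ 2 - b * w j + 0 :=
      lt_of_le_of_ne (h0 j) fun h' => hj (Fin.ext (((h j).2 h'.symm).trans hi.symm))
    rw [hb] at h1
    have h2 : 0 < A * w j * (w j - w i) := by linarith
    exact sub_pos.1 (pos_of_mul_pos_right h2 (mul_pos hA (hw j)).le)
  -- Vieta's formulas give `D / A` as the product of the two zeros. Positivity at every other index
  -- says that no other radius lies between them.
  have hquad {w : Fin (k - 4) → ℝ} {A D b : ℝ} (hA : 0 < A) (hw : Function.Injective w)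
      {i j : Fin (k - 4)} (hij : j.val = i.val + 1) (h0 : ∀ l, 0 ≤ A * w l ^ 2 - b * w l + D)
      (h : ∀ l : Fin (k - 4), l = i ∨ l = j ↔ A * w l ^ 2 - b * w l + D = 0) :
      D = A * (w i * w j) ∧ ∀ l, l ≠ i → l ≠ j → 0 < (w l - w i) * (w l - w j) := by
    obtain ⟨hb, hD⟩ := vieta_of_zeros ((h i).1 (.inl rfl)) ((h j).1 (.inr rfl))
      (hw.ne (fun h => by rw [h] at hij; lia))
    refine ⟨hD, fun l hi hj => ?_⟩
    have h1 : 0 < A * w l ^ 2 - b * w l + D :=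
      lt_of_le_of_ne (h0 l) fun h' => by
        rcases (h l).2 h'.symm with h | h
        exacts [hi h, hj h]
    rw [hb, hD] at h1
    have h2 : 0 < A * ((w l - w i) * (w l - w j)) := by linarith
    exact pos_of_mul_pos_right h2 hA.le
  have hpair (i j : Fin (k - 4)) (hij : j.val = i.val + 1) :
      (s i * s j = r i * r j) ∧ (∀ l, l ≠ i → l ≠ j → 0 < (r l - r i) * (r l - r j)) ∧
        ∀ l, l ≠ i → l ≠ j → 0 < (s l - s i) * (s l - s j) := by
    -- The same `A` and `D` serve both rays, so the two Vieta products coincide.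
    obtain ⟨A, D, b, c, h0, h⟩ := hface ⟨i.val + 2, by lia⟩
    have hA : 0 < A := lt_of_le_of_ne (h0 north) fun hA => by
      have := (h north).2 hA.symm
      simp [Incident] at this
      lia
    have h1 := hquad hA hri hij (fun l => h0 (p l)) fun l => (by
      refine Iff.trans ?_ (h (p l))
      simp only [mem_ofPred_eq, Incident, Fin.ext_iff]; lia)
    have h2 := hquad hA hsi hij (fun l => h0 (q l)) fun l => (by
      refine Iff.trans ?_ (h (q l))
      simp only [mem_ofPred_eq, Incident, Fin.ext_iff]; lia)
    exact ⟨mul_left_cancel₀ hA.ne' (h2.1.symm.trans h1.1), h1.2, h2.2⟩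
  -- The south triangle has `D = 0`, and its quadratics vanish only at the first radii, which are
  -- therefore the smallest.
  obtain ⟨A, D, b, c, h0, h⟩ := hface ⟨1, by lia⟩
  have hA : 0 < A := lt_of_le_of_ne (h0 north) fun hA => by
    have := (h north).2 hA.symm
    simp [Incident] at this
    lia
  have hD : D = 0 := (h south).1 (by simp [Incident])
  subst hD
  refine ⟨r, s, ⟨hr, ?_, hs, ?_, fun i j hij => (hpair i j hij).1⟩, hvrs⟩
  · refine Fin.strictMono_of_empty_intervals (hfirst hA hr (fun i => h0 (p i)) fun i => ?_)
      fun i j l hij => (hpair i j hij).2.1 l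
    refine Iff.trans ?_ (h (p i))
    simp only [mem_ofPred_eq, Incident]; lia
  · refine Fin.strictMono_of_empty_intervals (hfirst hA hs (fun i => h0 (q i)) fun i => ?_)
      fun i j l hij => (hpair i j hij).2.2 l
    refine Iff.trans ?_ (h (q i))
    simp only [mem_ofPred_eq, Incident]; lia

end Realization

/-! ### The radii on the second ray as a function of the first one. -/

section Zigzag

variable {m : ℕ} [NeZero m]

/-- The positions of the vertices on the second ray: the sequence with first term `δ` whose
products of consecutive terms are those of `p`. -/
noncomputable def zigzag (p : Fin m → ℝ) (δ : ℝ) (i : Fin m) : ℝ :=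
  if Even i.val then p i * (δ / p 0) else p i * (p 0 / δ)

/-- The values of `δ` for which the sequence `zigzag p δ` is increasing. -/
def zigzagDomain (p : Fin m → ℝ) : Set ℝ :=
  {δ | 0 < δ ∧ ∀ i j : Fin m, j.val = i.val + 1 → zigzag p δ i < zigzag p δ j}

theorem zigzag_mul {p : Fin m → ℝ} (hp : p 0 ≠ 0) {δ : ℝ} (hδ : δ ≠ 0) {i j : Fin m}
    (hij : j.val = i.val + 1) : zigzag p δ i * zigzag p δ j = p i * p j := by
  rw [zigzag, zigzag, hij]
  by_cases h : Even i.val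
  · have h' : ¬ Even (i.val + 1) := by simpa [Nat.even_add_one] using h
    rw [if_pos h, if_neg h']
    field_simp
  · have h' : Even (i.val + 1) := by simpa [Nat.even_add_one] using h
    rw [if_neg h, if_pos h']
    field_simp

theorem zigzag_zero {p : Fin m → ℝ} (hp : p 0 ≠ 0) (δ : ℝ) : zigzag p δ 0 = δ := by
  simp [zigzag, mul_div_cancel₀ _ hp]

theorem interlacedRadii_zigzag {p : Fin m → ℝ} (hp : ∀ i, 0 < p i) (hmono : StrictMono p) {δ : ℝ}
    (hδ : δ ∈ zigzagDomain p) : InterlacedRadii p (zigzag p δ) where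
  p_pos := hp
  p_mono := hmono
  q_pos i := by
    have := hδ.1
    have := hp i
    have := hp 0
    unfold zigzag
    split_ifs <;> positivity
  q_mono := Fin.strictMono_of_consecutive hδ.2
  mul_eq _ _ hij := zigzag_mul (hp 0).ne' hδ.1.ne' hij

/-- The product relations are a recursion: each term of `q` determines the next one. -/
theorem InterlacedRadii.eq_zigzag {p q : Fin m → ℝ} (h : InterlacedRadii p q) :
    q = zigzag p (q 0) := by
  have aux (n : ℕ) : ∀ i : Fin m, i.val = n → q i = zigzag p (q 0) i := by
    induction n with
    | zero =>
      intro i hi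
      obtain rfl : i = 0 := Fin.ext (by simpa using hi)
      rw [zigzag_zero (h.p_pos 0).ne']
    | succ n ih =>
      intro i hi
      have hn : n < m := by lia
      refine mul_left_cancel₀ (h.q_pos ⟨n, hn⟩).ne' ?_
      rw [h.mul_eq ⟨n, hn⟩ i hi, ih ⟨n, hn⟩ rfl,
        zigzag_mul (h.p_pos 0).ne' (h.q_pos 0).ne' (i := ⟨n, hn⟩) hi]
  exact funext fun i => aux _ i rfl

theorem InterlacedRadii.mem_zigzagDomain {p q : Fin m → ℝ} (h : InterlacedRadii p q) :
    q 0 ∈ zigzagDomain p := by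
  refine ⟨h.q_pos 0, fun i j hij => ?_⟩
  rw [← h.eq_zigzag]
  exact h.q_mono (Fin.lt_def.2 (by lia))

end Zigzag

/-! ### Radii in terms of differences. -/

section PartialSums

variable {m : ℕ}

theorem sum_Iic_of_eq_succ (b : Fin m → ℝ) {i j : Fin m} (hij : j.val = i.val + 1) :
    ∑ l ∈ Finset.Iic j, b l = ∑ l ∈ Finset.Iic i, b l + b j := by
  have : Finset.Iic j = insert j (Finset.Iic i) := by
    ext l; simp only [Finset.mem_insert, Finset.mem_Iic, Fin.le_def, Fin.ext_iff]; lia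
  have hj : j ∉ Finset.Iic i := by simp only [Finset.mem_Iic, Fin.le_def]; lia
  rw [this, Finset.sum_insert hj, add_comm]

theorem sum_Iic_of_eq_zero (b : Fin m → ℝ) {i : Fin m} (hi : i.val = 0) :
    ∑ l ∈ Finset.Iic i, b l = b i := by
  have : Finset.Iic i = {i} := by
    ext l; simp only [Finset.mem_singleton, Finset.mem_Iic, Fin.le_def, Fin.ext_iff]; lia
  rw [this, Finset.sum_singleton]

theorem sum_Ici_of_eq_succ (b : Fin m → ℝ) {i j : Fin m} (hij : j.val = i.val + 1) :
    ∑ l ∈ Finset.Ici i, b l = b i + ∑ l ∈ Finset.Ici j, b l := by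
  have : Finset.Ici i = insert i (Finset.Ici j) := by
    ext l; simp only [Finset.mem_insert, Finset.mem_Ici, Fin.le_def, Fin.ext_iff]; lia
  have hi : i ∉ Finset.Ici j := by simp only [Finset.mem_Ici, Fin.le_def]; lia
  rw [this, Finset.sum_insert hi]

theorem sum_Ici_of_eq_last (b : Fin m → ℝ) {i : Fin m} (hi : i.val + 1 = m) :
    ∑ l ∈ Finset.Ici i, b l = b i := by
  have : Finset.Ici i = {i} := by
    ext l; simp only [Finset.mem_singleton, Finset.mem_Ici, Fin.le_def, Fin.ext_iff]; lia
  rw [this, Finset.sum_singleton]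

theorem sum_Ici_of_eq_zero (b : Fin m → ℝ) {i : Fin m} (hi : i.val = 0) :
    ∑ l ∈ Finset.Ici i, b l = ∑ l, b l := by
  have : Finset.Ici i = Finset.univ := by
    ext l; simp only [Finset.mem_univ, Finset.mem_Ici, Fin.le_def]; lia
  rw [this]

/-- The differences of each term of a sequence and the preceding one. -/
def backwardDiff (p : Fin m → ℝ) (i : Fin m) : ℝ :=
  -- The first term is compared with `0`, the position of `south` on the ray.
  if i.val = 0 then p i else p i - p ⟨i.val - 1, by lia⟩

/-- The differences of each term of a sequence and the next one. -/
def forwardDiff (p : Fin m → ℝ) (i : Fin m) : ℝ :=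
  -- The last term is compared with `0`. The function is applied to the reciprocal radii, for which
  -- `0` is the value at `north`.
  if h : i.val + 1 < m then p i - p ⟨i.val + 1, h⟩ else p i

theorem sum_Iic_backwardDiff (p : Fin m → ℝ) (i : Fin m) :
    ∑ l ∈ Finset.Iic i, backwardDiff p l = p i := by
  have aux (n : ℕ) : ∀ i : Fin m, i.val = n → ∑ l ∈ Finset.Iic i, backwardDiff p l = p i := by
    induction n with
    | zero => exact fun i hi => by rw [sum_Iic_of_eq_zero _ hi, backwardDiff, if_pos hi]
    | succ n ih =>
      intro i hi
      rw [sum_Iic_of_eq_succ _ (i := ⟨n, by lia⟩) hi, ih _ rfl, backwardDiff, if_neg (by lia)]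
      simp [hi]
  exact aux _ i rfl

theorem backwardDiff_sum_Iic (b : Fin m → ℝ) :
    backwardDiff (fun i => ∑ l ∈ Finset.Iic i, b l) = b := by
  funext i
  unfold backwardDiff
  split_ifs with h
  · exact sum_Iic_of_eq_zero b h
  · have hi : i.val = (⟨i.val - 1, by lia⟩ : Fin m).val + 1 := by simp only; lia
    simp [sum_Iic_of_eq_succ b hi]

theorem sum_Ici_forwardDiff (p : Fin m → ℝ) (i : Fin m) :
    ∑ l ∈ Finset.Ici i, forwardDiff p l = p i := by
  have aux (n : ℕ) : ∀ i : Fin m, i.val + 1 + n = m →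
      ∑ l ∈ Finset.Ici i, forwardDiff p l = p i := by
    induction n with
    | zero => exact fun i hi => by rw [sum_Ici_of_eq_last _ hi, forwardDiff, dif_neg (by lia)]
    | succ n ih =>
      intro i hi
      have h : i.val + 1 < m := by lia
      rw [sum_Ici_of_eq_succ _ (j := ⟨i.val + 1, h⟩) rfl, ih ⟨i.val + 1, h⟩ (by simp only; lia),
        forwardDiff, dif_pos h]
      ring
  exact aux (m - (i.val + 1)) i (by lia)

theorem forwardDiff_sum_Ici (b : Fin m → ℝ) :
    forwardDiff (fun i => ∑ l ∈ Finset.Ici i, b l) = b := by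
  funext i
  unfold forwardDiff
  split_ifs with h
  · have hi : (⟨i.val + 1, h⟩ : Fin m).val = i.val + 1 := rfl
    simp [sum_Ici_of_eq_succ b hi]
  · exact sum_Ici_of_eq_last b (by lia)

theorem sum_Iic_pos {b : Fin m → ℝ} (hb : ∀ i, 0 < b i) (i : Fin m) :
    0 < ∑ l ∈ Finset.Iic i, b l :=
  Finset.sum_pos (fun l _ => hb l) ⟨i, by simp⟩

theorem strictMono_sum_Iic {b : Fin m → ℝ} (hb : ∀ i, 0 < b i) :
    StrictMono fun i => ∑ l ∈ Finset.Iic i, b l :=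
  Fin.strictMono_of_consecutive fun i j hij => by
    simp only [sum_Iic_of_eq_succ b hij]; linarith [hb j]

theorem sum_Ici_pos {b : Fin m → ℝ} (hb : ∀ i, 0 < b i) (i : Fin m) :
    0 < ∑ l ∈ Finset.Ici i, b l :=
  Finset.sum_pos (fun l _ => hb l) ⟨i, by simp⟩

theorem strictMono_one_div_sum_Ici {b : Fin m → ℝ} (hb : ∀ i, 0 < b i) :
    StrictMono fun i => 1 / ∑ l ∈ Finset.Ici i, b l :=
  Fin.strictMono_of_consecutive fun i j hij => by
    refine one_div_lt_one_div_of_lt (sum_Ici_pos hb j) ?_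
    rw [sum_Ici_of_eq_succ b hij]; linarith [hb i]

end PartialSums

/-! ### The interval of admissible `δ` and its trivialization. -/

section ZigzagDomain

variable {m : ℕ} [NeZero m]

theorem mem_zigzagDomain_iff {p : Fin m → ℝ} (hp : ∀ i, 0 < p i) {δ : ℝ} :
    δ ∈ zigzagDomain p ↔ 0 < δ ∧ ∀ i j : Fin m, j.val = i.val + 1 →
      (Even i.val → δ ^ 2 * p i < p 0 ^ 2 * p j) ∧
      (¬ Even i.val → p 0 ^ 2 * p i < δ ^ 2 * p j) := by
  refine and_congr_right fun hδ => forall₂_congr fun i j => forall_congr' fun hij => ?_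
  have h0 := hp 0
  rw [zigzag, zigzag, hij]
  by_cases h : Even i.val
  · have h' : ¬ Even (i.val + 1) := by simpa [Nat.even_add_one] using h
    rw [if_pos h, if_neg h']
    simp only [h, forall_const, not_true, IsEmpty.forall_iff, and_true]
    rw [← mul_div_assoc, ← mul_div_assoc, div_lt_div_iff₀ h0 hδ]
    constructor <;> intro h <;> linarith
  · have h' : Even (i.val + 1) := by simpa [Nat.even_add_one] using h
    rw [if_neg h, if_pos h']
    simp only [h, forall_const, not_false_iff, IsEmpty.forall_iff, true_and]
    rw [← mul_div_assoc, ← mul_div_assoc, div_lt_div_iff₀ hδ h0]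
    constructor <;> intro h <;> linarith

/-- The ratios of consecutive terms of `p` that bound `(δ / p 0) ^ 2` from below, for
`b = False`, or its inverse, for `b = True`. -/
noncomputable def zigzagRatio (b : Prop) (p : Fin m → ℝ) (x : Fin m × Fin m) : ℝ :=
  open Classical in if x.2.val = x.1.val + 1 ∧ (Even x.1.val ↔ b) then p x.1 / p x.2 else 0

/-- The largest of the ratios `zigzagRatio b p`. -/
noncomputable def zigzagBound (b : Prop) (p : Fin m → ℝ) : ℝ :=
  Finset.univ.sup' Finset.univ_nonempty (zigzagRatio b p)

theorem zigzagBound_nonneg (b : Prop) (p : Fin m → ℝ) : 0 ≤ zigzagBound b p := by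
  refine le_trans (le_of_eq ?_) (Finset.le_sup' (zigzagRatio b p) (Finset.mem_univ 0))
  simp [zigzagRatio]

/-- The value `0` given to pairs outside the maximum's intended range is harmless, since only
positive upper bounds `a` are considered. -/
theorem zigzagBound_lt_iff {b : Prop} {p : Fin m → ℝ} (hp : ∀ i, 0 < p i) {a : ℝ} (ha : 0 < a) :
    zigzagBound b p < a ↔
      ∀ i j : Fin m, j.val = i.val + 1 → (Even i.val ↔ b) → p i < a * p j := by
  rw [zigzagBound, Finset.sup'_lt_iff]
  constructor
  · intro h i j hij hb
    have := h (i, j) (Finset.mem_univ _)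
    rw [zigzagRatio, if_pos ⟨hij, hb⟩, div_lt_iff₀ (hp j)] at this
    exact this
  · rintro h ⟨i, j⟩ -
    rw [zigzagRatio]
    split_ifs with hij
    · rw [div_lt_iff₀ (hp j)]; exact h i j hij.1 hij.2
    · exact ha

theorem zigzagBound_lt_one {b : Prop} {p : Fin m → ℝ} (hp : ∀ i, 0 < p i) (hmono : StrictMono p) :
    zigzagBound b p < 1 :=
  (zigzagBound_lt_iff hp one_pos).2 fun i j hij _ => by
    rw [one_mul]; exact hmono (Fin.lt_def.2 (by lia))

/-- With `t = (δ / p 0)²`, a step from an even index requires `t * p i < p (i + 1)`, and one from an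
odd index requires `p i < t * p (i + 1)`. The upper bound on `t` is written as a product because its
coefficient may be zero, the interval then being unbounded. -/
theorem mem_zigzagDomain_iff_bounds {p : Fin m → ℝ} (hp : ∀ i, 0 < p i) {δ : ℝ} :
    δ ∈ zigzagDomain p ↔ 0 < δ ∧ zigzagBound False p < (δ / p 0) ^ 2 ∧
      zigzagBound True p * (δ / p 0) ^ 2 < 1 := by
  rw [mem_zigzagDomain_iff hp]
  refine and_congr_right fun hδ => ?_
  have h0 := hp 0
  have ht : 0 < (δ / p 0) ^ 2 := by positivity
  rw [zigzagBound_lt_iff hp ht, ← lt_div_iff₀ ht, zigzagBound_lt_iff hp (by positivity)]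
  have e₁ (i j) : p i < (δ / p 0) ^ 2 * p j ↔ p 0 ^ 2 * p i < δ ^ 2 * p j := by
    rw [div_pow, div_mul_eq_mul_div, lt_div_iff₀ (by positivity), mul_comm (p i)]
  have e₂ (i j) : p i < 1 / (δ / p 0) ^ 2 * p j ↔ δ ^ 2 * p i < p 0 ^ 2 * p j := by
    rw [div_pow, one_div_div, div_mul_eq_mul_div, lt_div_iff₀ (by positivity), mul_comm (p i)]
  simp only [e₁, e₂, iff_true, iff_false]
  exact ⟨fun h => ⟨fun i j hij => (h i j hij).2, fun i j hij => (h i j hij).1⟩,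
    fun h i j hij => ⟨h.2 i j hij, h.1 i j hij⟩⟩

/-- The value `δ = p 0` gives `q = p` and is always admissible; the conditions are bounds on `δ²`.
-/
theorem isPosOpenInterval_zigzagDomain {p : Fin m → ℝ} (hp : ∀ i, 0 < p i)
    (hmono : StrictMono p) : IsPosOpenInterval (zigzagDomain p) := by
  refine ⟨⟨p 0, ?_⟩, ?_, ⟨fun x hx y hy z hz => ?_⟩, fun δ hδ => hδ.1⟩
  · rw [mem_zigzagDomain_iff_bounds hp, div_self (hp 0).ne']
    simpa [hp 0] using ⟨zigzagBound_lt_one hp hmono, zigzagBound_lt_one hp hmono⟩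
  · have : zigzagDomain p = {δ | 0 < δ} ∩ ({δ | zigzagBound False p < (δ / p 0) ^ 2} ∩
        {δ | zigzagBound True p * (δ / p 0) ^ 2 < 1}) :=
      Set.ext fun δ => mem_zigzagDomain_iff_bounds hp
    rw [this]
    exact (isOpen_lt (by fun_prop) (by fun_prop)).inter
      ((isOpen_lt (by fun_prop) (by fun_prop)).inter (isOpen_lt (by fun_prop) (by fun_prop)))
  · rw [mem_zigzagDomain_iff_bounds hp] at *
    have h0 := hp 0
    have hx0 := hx.1
    have hz0 : 0 < z := hx.1.trans_le hz.1
    have h1 : (x / p 0) ^ 2 ≤ (z / p 0) ^ 2 := by gcongr; exact hz.1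
    have h2 : (z / p 0) ^ 2 ≤ (y / p 0) ^ 2 := by gcongr; exact hz.2
    exact ⟨hz0, hx.2.1.trans_le h1,
      (mul_le_mul_of_nonneg_left h2 (zigzagBound_nonneg _ _)).trans_lt hy.2.2⟩

theorem continuous_zigzagBound {B : Type*} [TopologicalSpace B] {P : B → Fin m → ℝ}
    (hP : Continuous P) (hpos : ∀ b i, 0 < P b i) (c : Prop) :
    Continuous fun b => zigzagBound c (P b) := by
  refine Continuous.finset_sup'_apply _ fun x _ => ?_
  unfold zigzagRatio
  split_ifs
  · exact ((continuous_apply _).comp hP).div ((continuous_apply _).comp hP) fun b => (hpos b _).ne'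
  · exact continuous_const

theorem unitCoord_mem {l u t : ℝ} (h1 : l < t) (h2 : u * t < 1) :
    (t - l) / ((t - l) + (1 - u * t)) ∈ Ioo (0 : ℝ) 1 := by
  have h1 := sub_pos.2 h1
  have h2 := sub_pos.2 h2
  refine ⟨by positivity, ?_⟩
  rw [div_lt_one (by positivity)]
  linarith

theorem unitCoord_denom_pos {u s : ℝ} (hu : 0 ≤ u) (hs : s ∈ Ioo (0 : ℝ) 1) :
    0 < 1 - s + s * u := by
  have := mul_nonneg hs.1.le hu
  linarith [hs.2]

/-- The fibrewise homeomorphism of the family of intervals `zigzagDomain (P b)` to `(0, 1)`. -/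
noncomputable def zigzagHomeo {B : Type*} [TopologicalSpace B] {P : B → Fin m → ℝ}
    (hP : Continuous P) (hpos : ∀ b i, 0 < P b i) (hmono : ∀ b, StrictMono (P b)) :
    {x : B × ℝ // x.2 ∈ zigzagDomain (P x.1)} ≃ₜ B × Ioo (0 : ℝ) 1 where
  toFun x := (x.1.1, ⟨_, unitCoord_mem ((mem_zigzagDomain_iff_bounds (hpos _)).1 x.2).2.1
    ((mem_zigzagDomain_iff_bounds (hpos _)).1 x.2).2.2⟩)
  -- This solves `s = (t - l) / ((t - l) + (1 - u * t))` for `t`, with `l` and `u` the two bounds,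
  -- and then takes `δ = p 0 * √t`. The formula also covers `u = 0`.
  invFun y := ⟨(y.1, P y.1 0 * √((y.2 + (1 - y.2) * zigzagBound False (P y.1)) /
      (1 - y.2 + y.2 * zigzagBound True (P y.1)))), by
    obtain ⟨b, s, hs⟩ := y
    have hl := zigzagBound_nonneg False (P b)
    have hu := zigzagBound_nonneg True (P b)
    have hl1 := zigzagBound_lt_one (b := False) (hpos b) (hmono b)
    have hu1 := zigzagBound_lt_one (b := True) (hpos b) (hmono b)
    have hd := unitCoord_denom_pos hu hs
    have h0 := hpos b 0
    have hs1 := sub_pos.2 hs.2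
    have hs0 := hs.1
    -- Since both bounds are less than `1`, `l * u < 1`: the interval `l < t`, `u * t < 1` is
    -- nondegenerate.
    have hlu : 0 < 1 - zigzagBound False (P b) * zigzagBound True (P b) := by nlinarith
    have hn : 0 < s + (1 - s) * zigzagBound False (P b) := by positivity
    rw [mem_zigzagDomain_iff_bounds (hpos b)]
    dsimp only
    rw [mul_div_cancel_left₀ _ h0.ne', Real.sq_sqrt (by positivity), lt_div_iff₀ hd,
      ← mul_div_assoc, div_lt_one hd]
    refine ⟨by positivity, ?_, ?_⟩
    · linarith [mul_pos hs0 hlu]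
    · linarith [mul_pos hs1 hlu]⟩
  left_inv := by
    rintro ⟨⟨b, δ⟩, hx⟩
    have hx' := (mem_zigzagDomain_iff_bounds (hpos b)).1 hx
    have h1 := sub_pos.2 hx'.2.1
    have h2 := sub_pos.2 hx'.2.2
    have hl1 := zigzagBound_lt_one (b := False) (hpos b) (hmono b)
    have hu1 := zigzagBound_lt_one (b := True) (hpos b) (hmono b)
    have hl := zigzagBound_nonneg False (P b)
    have hu := zigzagBound_nonneg True (P b)
    have h0 := hpos b 0
    have hδ : 0 < δ := hx.1
    have hlu : 0 < 1 - zigzagBound False (P b) * zigzagBound True (P b) := by nlinarith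
    refine Subtype.ext (Prod.ext rfl ?_)
    have hd := unitCoord_denom_pos hu (unitCoord_mem hx'.2.1 hx'.2.2)
    dsimp only at *
    set l := zigzagBound False (P b)
    set u := zigzagBound True (P b)
    set t := (δ / P b 0) ^ 2 with ht
    have key : ((t - l) / (t - l + (1 - u * t)) + (1 - (t - l) / (t - l + (1 - u * t))) * l) /
        (1 - (t - l) / (t - l + (1 - u * t)) + (t - l) / (t - l + (1 - u * t)) * u) = t := by
      rw [div_eq_iff hd.ne']
      have hS : t - l + (1 - u * t) ≠ 0 := by positivity
      have e : 1 - (t - l) / (t - l + (1 - u * t)) = (1 - u * t) / (t - l + (1 - u * t)) := by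
        rw [one_sub_div hS, add_sub_cancel_left]
      rw [e]
      ring
    rw [key, ht, Real.sqrt_sq (by positivity), mul_div_cancel₀ _ h0.ne']
  right_inv := by
    rintro ⟨b, s, hs⟩
    have hl := zigzagBound_nonneg False (P b)
    have hu := zigzagBound_nonneg True (P b)
    have hl1 := zigzagBound_lt_one (b := False) (hpos b) (hmono b)
    have hu1 := zigzagBound_lt_one (b := True) (hpos b) (hmono b)
    have hd := unitCoord_denom_pos hu hs
    have h0 := hpos b 0
    have hs1 := sub_pos.2 hs.2
    have hs0 := hs.1
    have hn : 0 < s + (1 - s) * zigzagBound False (P b) := by positivity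
    have hlu : 0 < 1 - zigzagBound False (P b) * zigzagBound True (P b) := by nlinarith
    refine Prod.ext rfl (Subtype.ext ?_)
    dsimp only
    rw [mul_div_cancel_left₀ _ h0.ne', Real.sq_sqrt (by positivity)]
    set l := zigzagBound False (P b)
    set u := zigzagBound True (P b)
    have e₁ : (s + (1 - s) * l) / (1 - s + s * u) - l
        = s * (1 - l * u) / (1 - s + s * u) := by field_simp; ring
    have e₂ : 1 - u * ((s + (1 - s) * l) / (1 - s + s * u))
        = (1 - s) * (1 - l * u) / (1 - s + s * u) := by field_simp; ring
    rw [e₁, e₂, ← add_div, div_div_div_cancel_right₀ hd.ne', ← add_mul, add_sub_cancel, one_mul,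
      mul_div_cancel_right₀ _ hlu.ne']
  continuous_toFun := by
    have hl := (continuous_zigzagBound hP hpos False).comp
      (continuous_fst.comp (continuous_subtype_val (p := fun x : B × ℝ =>
        x.2 ∈ zigzagDomain (P x.1))))
    have hu := (continuous_zigzagBound hP hpos True).comp
      (continuous_fst.comp (continuous_subtype_val (p := fun x : B × ℝ =>
        x.2 ∈ zigzagDomain (P x.1))))
    have h0 : Continuous fun x : {x : B × ℝ // x.2 ∈ zigzagDomain (P x.1)} => P x.1.1 0 :=
      (continuous_apply 0).comp (hP.comp (continuous_fst.comp continuous_subtype_val))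
    have ht : Continuous fun x : {x : B × ℝ // x.2 ∈ zigzagDomain (P x.1)} =>
        (x.1.2 / P x.1.1 0) ^ 2 :=
      ((continuous_snd.comp continuous_subtype_val).div h0 fun x => (hpos _ _).ne').pow 2
    refine (continuous_fst.comp continuous_subtype_val).prodMk (Continuous.subtype_mk ?_ _)
    refine (ht.sub hl).div ((ht.sub hl).add (continuous_const.sub (hu.mul ht))) fun x => ?_
    have hx := (mem_zigzagDomain_iff_bounds (hpos _)).1 x.2
    exact (add_pos (sub_pos.2 hx.2.1) (sub_pos.2 hx.2.2)).ne'
  continuous_invFun := by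
    have hl := (continuous_zigzagBound hP hpos False).comp
      (continuous_fst (X := B) (Y := Ioo (0 : ℝ) 1))
    have hu := (continuous_zigzagBound hP hpos True).comp
      (continuous_fst (X := B) (Y := Ioo (0 : ℝ) 1))
    have hs : Continuous fun y : B × Ioo (0 : ℝ) 1 => (y.2 : ℝ) :=
      continuous_subtype_val.comp continuous_snd
    refine Continuous.subtype_mk (continuous_fst.prodMk ?_) _
    refine ((continuous_apply 0).comp (hP.comp continuous_fst)).mul (Real.continuous_sqrt.comp ?_)
    refine (hs.add ((continuous_const.sub hs).mul hl)).div
      ((continuous_const.sub hs).add (hs.mul hu)) fun y => ?_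
    exact (unitCoord_denom_pos (zigzagBound_nonneg _ _) y.2.2).ne'

end ZigzagDomain

/-! ### Topology of the parameter spaces. -/

section ParameterSpaces

variable {k : ℕ}

/-- The positions on the first axis which belong to a point of the simplex. -/
noncomputable def simplexRadii {m : ℕ} (w : Fin m → ℝ) (i : Fin m) : ℝ :=
  1 / ∑ j ∈ Finset.Ici i, w j

/-- The positions on the first axis with given distances. -/
def partialSums {m : ℕ} (b : Fin m → ℝ) (i : Fin m) : ℝ := ∑ j ∈ Finset.Iic i, b j

theorem simplexRadii_pos {m : ℕ} {w : Fin m → ℝ} (hw : ∀ i, 0 < w i) (i : Fin m) :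
    0 < simplexRadii w i := one_div_pos.2 (sum_Ici_pos hw i)

theorem continuousOn_simplexRadii {m : ℕ} :
    ContinuousOn (simplexRadii (m := m)) {w | ∀ i, 0 < w i} := by
  refine continuousOn_pi.2 fun i => ContinuousOn.div continuousOn_const (by fun_prop) fun w hw => ?_
  exact (sum_Ici_pos hw i).ne'

theorem continuous_partialSums {m : ℕ} : Continuous (partialSums (m := m)) := by
  unfold partialSums; fun_prop

variable [NeZero (k - 4)]

/-- The open simplex in logarithmic coordinates. -/
noncomputable def openSimplexHomeo : openSimplex k ≃ₜ ({i : Fin (k - 4) // i ≠ 0} → ℝ) where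
  toFun w i := Real.log (w.1 i / w.1 0)
  invFun y := ⟨fun i => (if h : i = 0 then 1 else Real.exp (y ⟨i, h⟩)) /
      ∑ j, (if h : j = 0 then 1 else Real.exp (y ⟨j, h⟩)), by
    have pos (i : Fin (k - 4)) : 0 < (if h : i = 0 then 1 else Real.exp (y ⟨i, h⟩)) := by
      split_ifs <;> positivity
    have hsum := Finset.sum_pos (fun i _ => pos i) (Finset.univ_nonempty (α := Fin (k - 4)))
    exact ⟨fun i => div_pos (pos i) hsum, by rw [← Finset.sum_div, div_self hsum.ne']⟩⟩
  left_inv := by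
    rintro ⟨w, hw, hsum⟩
    refine Subtype.ext (funext fun i => ?_)
    have h (i : Fin (k - 4)) :
        (if h : i = 0 then 1 else Real.exp (Real.log (w i / w 0))) = w i / w 0 := by
      split_ifs with h
      · rw [h, div_self (hw 0).ne']
      · exact Real.exp_log (div_pos (hw i) (hw 0))
    simp only [h]
    rw [← Finset.sum_div, hsum, div_div_div_cancel_right₀ (hw 0).ne', div_one]
  right_inv := by
    intro y
    have pos (i : Fin (k - 4)) : 0 < (if h : i = 0 then 1 else Real.exp (y ⟨i, h⟩)) := by
      split_ifs <;> positivity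
    have hsum := Finset.sum_pos (fun i _ => pos i) (Finset.univ_nonempty (α := Fin (k - 4)))
    funext i
    dsimp only
    rw [div_div_div_cancel_right₀ hsum.ne', dif_neg i.2, dif_pos rfl, div_one, Real.log_exp]
  continuous_toFun := by
    refine continuous_pi fun i => Continuous.log ?_ fun w => (div_pos (w.2.1 _) (w.2.1 _)).ne'
    exact ((continuous_apply _).comp continuous_subtype_val).div
      ((continuous_apply _).comp continuous_subtype_val) fun w => (w.2.1 0).ne'
  continuous_invFun := by
    have hc (i : Fin (k - 4)) : Continuous fun y : {i : Fin (k - 4) // i ≠ 0} → ℝ =>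
        (if h : i = 0 then 1 else Real.exp (y ⟨i, h⟩)) := by
      split_ifs <;> fun_prop
    refine Continuous.subtype_mk (continuous_pi fun i => (hc i).div
      (continuous_finsetSum _ fun i _ => hc i) fun y => ?_) _
    refine (Finset.sum_pos (fun i _ => ?_) (Finset.univ_nonempty (α := Fin (k - 4)))).ne'
    split_ifs <;> positivity

/-- The normal forms up to Möbius transformations form a product. -/
noncomputable def moebiusParametersHomeo :
    moebiusParameters k (fun w => zigzagDomain (simplexRadii w)) ≃ₜ
      openSimplex k × Ioo (0 : ℝ) Real.pi × Ioo (0 : ℝ) 1 :=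
  let P : openSimplex k × Ioo (0 : ℝ) Real.pi → Fin (k - 4) → ℝ := fun b => simplexRadii b.1.1
  have hP : Continuous P := (continuousOn_iff_continuous_domRestrict.1
    (continuousOn_simplexRadii.mono fun _ hw => hw.1)).comp continuous_fst
  let e₁ : moebiusParameters k (fun w => zigzagDomain (simplexRadii w)) ≃ₜ
      {x : (openSimplex k × Ioo (0 : ℝ) Real.pi) × ℝ // x.2 ∈ zigzagDomain (P x.1)} :=
    { toFun := fun z => ⟨((⟨z.1.1, z.2.1⟩, ⟨z.1.2.1, z.2.2.1⟩), z.1.2.2), z.2.2.2⟩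
      invFun := fun x => ⟨(x.1.1.1.1, x.1.1.2.1, x.1.2), x.1.1.1.2, x.1.1.2.2, x.2⟩
      left_inv := fun _ => rfl
      right_inv := fun _ => rfl
      continuous_toFun := by fun_prop
      continuous_invFun := by fun_prop }
  (e₁.trans (zigzagHomeo hP (fun b => simplexRadii_pos b.1.2.1)
    fun b => strictMono_one_div_sum_Ici b.1.2.1)).trans (Homeomorph.prodAssoc _ _ _)

/-- An open interval is homeomorphic to the line. -/
theorem nonempty_homeomorph_Ioo {a b : ℝ} (hab : a < b) : Nonempty (Ioo a b ≃ₜ ℝ) := by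
  have h : (OpenPartialHomeomorph.univBall (E := ℝ) ((a + b) / 2) ((b - a) / 2)).target
      = Ioo a b := by
    rw [OpenPartialHomeomorph.univBall_target _ (by linarith), Real.ball_eq_Ioo]
    congr 1 <;> ring
  exact ⟨(((Homeomorph.Set.univ ℝ).symm.trans (Homeomorph.setCongr
    (OpenPartialHomeomorph.univBall_source _ _).symm)).trans
    ((OpenPartialHomeomorph.univBall (E := ℝ) ((a + b) / 2)
      ((b - a) / 2)).toHomeomorphSourceTarget.trans (Homeomorph.setCongr h))).symm⟩

/-- The simplex contributes dimension `k - 5` in logarithmic coordinates and each interval one, `k -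
3` in all. -/
theorem nonempty_homeomorph_ball (hk : 5 ≤ k) :
    Nonempty (openSimplex k × Ioo (0 : ℝ) Real.pi × Ioo (0 : ℝ) 1 ≃ₜ
      Metric.ball (0 : EuclideanSpace ℝ (Fin (k - 3))) 1) := by
  obtain ⟨e₁⟩ := nonempty_homeomorph_Ioo Real.pi_pos
  obtain ⟨e₂⟩ := nonempty_homeomorph_Ioo (zero_lt_one (α := ℝ))
  have e : (({i : Fin (k - 4) // i ≠ 0} → ℝ) × ℝ × ℝ) ≃L[ℝ] EuclideanSpace ℝ (Fin (k - 3)) :=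
    ContinuousLinearEquiv.ofFinrankEq (by simp; lia)
  exact ⟨((openSimplexHomeo.prodCongr (e₁.prodCongr e₂)).trans e.toHomeomorph).trans
    Homeomorph.unitBall⟩

theorem isOpen_wedgeParameters :
    IsOpen (wedgeParameters k fun _ β _ => zigzagDomain (partialSums β)) := by
  have h : wedgeParameters k (fun _ β _ => zigzagDomain (partialSums β)) =
      {z | (∀ i, 0 < z.2.1 i) ∧ (0 < z.2.2.1 ∧ z.2.2.1 < Real.pi) ∧ 0 < z.2.2.2 ∧
        ∀ i j : Fin (k - 4), j.val = i.val + 1 →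
        (Even i.val → z.2.2.2 ^ 2 * partialSums z.2.1 i
          < partialSums z.2.1 0 ^ 2 * partialSums z.2.1 j) ∧
        (¬ Even i.val → partialSums z.2.1 0 ^ 2 * partialSums z.2.1 i
          < z.2.2.2 ^ 2 * partialSums z.2.1 j)} := by
    ext z
    exact and_congr_right fun hz => and_congr_right fun _ =>
      mem_zigzagDomain_iff fun i => sum_Iic_pos hz i
  have hc (i : Fin (k - 4)) : Continuous fun z : E2 × (Fin (k - 4) → ℝ) × ℝ × ℝ =>
      partialSums z.2.1 i :=
    (continuous_apply i).comp (continuous_partialSums.comp (by fun_prop))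
  rw [h]
  simp only [ofPred_and, ofPred_forall]
  refine IsOpen.inter (isOpen_iInter_of_finite fun i => isOpen_lt (by fun_prop) (by fun_prop))
    (IsOpen.inter ((isOpen_lt (by fun_prop) (by fun_prop)).inter
      (isOpen_lt (by fun_prop) (by fun_prop))) (IsOpen.inter (isOpen_lt (by fun_prop)
        (by fun_prop)) (isOpen_iInter_of_finite fun i => isOpen_iInter_of_finite fun j =>
          isOpen_iInter_of_finite fun _ => IsOpen.inter
            (isOpen_iInter_of_finite fun _ => ?_) (isOpen_iInter_of_finite fun _ => ?_))))
  · have := hc i; have := hc j; have := hc 0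
    exact isOpen_lt (by fun_prop) (by fun_prop)
  · have := hc i; have := hc j; have := hc 0
    exact isOpen_lt (by fun_prop) (by fun_prop)

/-- The space is a family of intervals over the convex set of `(α, β, γ)`, and `zigzagHomeo` turns
it into a product with `(0, 1)`. -/
theorem contractibleSpace_wedgeParameters :
    ContractibleSpace (wedgeParameters k fun _ β _ => zigzagDomain (partialSums β)) := by
  let S : Set (E2 × (Fin (k - 4) → ℝ) × ℝ) := univ ×ˢ (univ.pi fun _ => Ioi 0) ×ˢ Ioo 0 Real.pi
  have hS {b} (hb : b ∈ S) (i) : 0 < b.2.1 i := hb.2.1 i (mem_univ i)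
  let P : S → Fin (k - 4) → ℝ := fun b => partialSums b.1.2.1
  have hP : Continuous P := continuous_partialSums.comp (by fun_prop)
  let e₁ : wedgeParameters k (fun _ β _ => zigzagDomain (partialSums β)) ≃ₜ
      {x : S × ℝ // x.2 ∈ zigzagDomain (P x.1)} :=
    { toFun := fun z => ⟨(⟨(z.1.1, z.1.2.1, z.1.2.2.1), mem_univ _, fun i _ => z.2.1 i, z.2.2.1⟩,
        z.1.2.2.2), z.2.2.2⟩
      invFun := fun x => ⟨(x.1.1.1.1, x.1.1.1.2.1, x.1.1.1.2.2, x.1.2), fun i => hS x.1.1.2 i,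
        x.1.1.2.2.2, x.2⟩
      left_inv := fun _ => rfl
      right_inv := fun _ => rfl
      continuous_toFun := by fun_prop
      continuous_invFun := by fun_prop }
  let e := e₁.trans (zigzagHomeo hP (fun b => sum_Iic_pos (hS b.2))
    fun b => strictMono_sum_Iic (hS b.2))
  have hS₁ : ContractibleSpace S := Convex.contractibleSpace
    (convex_univ.prod ((convex_pi fun _ _ => convex_Ioi 0).prod (convex_Ioo 0 Real.pi)))
    ⟨(0, 1, Real.pi / 2), mem_univ _, fun _ _ => by simp, by
      constructor <;> dsimp only <;> linarith [Real.pi_pos]⟩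
  have hS₂ : ContractibleSpace (Ioo (0 : ℝ) 1) :=
    (convex_Ioo 0 1).contractibleSpace ⟨1 / 2, by constructor <;> norm_num⟩
  exact e.contractibleSpace

end ParameterSpaces

/-- The normal forms are a continuous section of the quotient and the invariant descends to its
inverse; no openness of the quotient map is needed. -/
theorem exists_homeomorph_quotient {X P : Type*} [TopologicalSpace X] [TopologicalSpace P]
    (s : Setoid X) {Z : Set P} {nf : Z → X} (hnf : Continuous nf) {inv : X → P}
    (hinv : Continuous inv) (hrel : ∀ x y, s x y → inv x = inv y) (hleft : ∀ z, inv (nf z) = z)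
    (hsurj : ∀ x, ∃ z, s x (nf z)) :
    ∃ Φ : Z ≃ₜ Quotient s, ∀ z, Φ z = Quotient.mk s (nf z) := by
  have hmem (x) : inv x ∈ Z := by
    obtain ⟨z, hz⟩ := hsurj x
    rw [hrel _ _ hz, hleft]
    exact z.2
  let g : X → Z := fun x => ⟨inv x, hmem x⟩
  have hg (x y) (h : s x y) : g x = g y := Subtype.ext (hrel x y h)
  exact ⟨{
    toFun := fun z => Quotient.mk s (nf z)
    invFun := Quotient.lift g hg
    left_inv := fun z => Subtype.ext (hleft z)
    right_inv := by
      intro x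
      induction x using Quotient.inductionOn with | _ x => ?_
      obtain ⟨z, hz⟩ := hsurj x
      have h : g x = z := Subtype.ext ((hrel _ _ hz).trans (hleft z))
      rw [Quotient.lift_mk, h]
      exact (Quotient.sound hz).symm
    continuous_toFun := continuous_quotient_mk'.comp hnf
    continuous_invFun := (hinv.subtype_mk _).quotient_lift hg }, fun _ => rfl⟩

/-! ### Moving an inscribed realization into standard position. -/

theorem exists_polar {a b : ℝ} (hb : 0 < b) :
    ∃ d > 0, ∃ γ ∈ Ioo 0 Real.pi, d * Real.cos γ = a ∧ d * Real.sin γ = b := by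
  let z : ℂ := ⟨a, b⟩
  have hz : 0 < ‖z‖ := norm_pos_iff.2 fun h => hb.ne' (congrArg Complex.im h)
  have hs : ‖z‖ * Real.sin z.arg = b := Complex.norm_mul_sin_arg z
  have hpos : 0 < Real.sin z.arg := pos_of_mul_pos_right (hs ▸ hb) hz.le
  refine ⟨‖z‖, hz, z.arg, ⟨?_, ?_⟩, Complex.norm_mul_cos_arg z, hs⟩
  · by_contra! h
    exact absurd hpos (not_lt.2 (Real.sin_nonpos_of_nonpos_of_neg_pi_le h
      (Complex.neg_pi_lt_arg z).le))
  · refine lt_of_le_of_ne (Complex.arg_le_pi z) fun h => ?_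
    rw [h, Real.sin_pi] at hpos
    exact lt_irrefl _ hpos

theorem E3.norm_sq (x : E3) : ‖x‖ ^ 2 = x 0 ^ 2 + x 1 ^ 2 + x 2 ^ 2 := by
  rw [EuclideanSpace.real_norm_sq_eq, Fin.sum_univ_three]

theorem E3.inner_eq (x y : E3) : inner ℝ x y = x 0 * y 0 + x 1 * y 1 + x 2 * y 2 := by
  simp [PiLp.inner_apply, Fin.sum_univ_three, mul_comm]

/-- The points of `S2` in terms of their stereographic projections. -/
theorem add_northPole_eq_stereoInv {w : E3} (hw : w ≠ 0) (h : w 2 = -‖w‖ ^ 2) :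
    w + northPole = stereoInv !₂[w 0 / ‖w‖ ^ 2, w 1 / ‖w‖ ^ 2] := by
  have hpos : ‖w‖ ^ 2 ≠ 0 := by simpa using hw
  have hn := E3.norm_sq w
  have hu : ‖(!₂[w 0 / ‖w‖ ^ 2, w 1 / ‖w‖ ^ 2] : E2)‖ ^ 2 = 1 / ‖w‖ ^ 2 - 1 := by
    rw [E2.norm_sq]
    simp only [Matrix.cons_val]
    rw [h] at hn
    field_simp
    linarith
  rw [stereoInv, hu]
  ext i
  fin_cases i
  · simp [northPole]
    field_simp
  · simp [northPole]
    field_simp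
  · simp [northPole, h]
    field_simp
    ring

/-- The inversion at the unit sphere about `N`, followed by the translation of `N` to `0`. -/
noncomputable def invertAt (N x : E3) : E3 := (‖x - N‖ ^ 2)⁻¹ • (x - N)

theorem isFace_similarity {ι : Type*} {v : ι → E3} {S : Set ι} (hS : IsFace v S) {s : ℝ}
    (hs : s ≠ 0) (L : E3 ≃ₗᵢ[ℝ] E3) (a b : E3) : IsFace (fun x => s • L (v x - a) + b) S := by
  obtain ⟨f, c, hf, h⟩ := hS
  let g : E3 →L[ℝ] ℝ := s⁻¹ • f.comp L.symm.toContinuousLinearEquiv.toContinuousLinearMap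
  have key (x) : g (s • L (v x - a) + b) = f (v x) + (g b - f a) := by
    have : g (s • L (v x - a)) = f (v x - a) := by simp [g, hs]
    rw [map_add, this, map_sub]; ring
  refine ⟨g, c + (g b - f a), fun x => ?_, fun x => ?_⟩
  · rw [key]; linarith [hf x]
  · rw [key, add_left_inj, h]

theorem exists_linearIsometryEquiv {e₁ e₂ e₃ : E3} (h₁ : ‖e₁‖ = 1) (h₂ : ‖e₂‖ = 1)
    (h₃ : ‖e₃‖ = 1) (h₁₂ : inner ℝ e₁ e₂ = 0) (h₁₃ : inner ℝ e₁ e₃ = 0)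
    (h₂₃ : inner ℝ e₂ e₃ = 0) : ∃ L : E3 ≃ₗᵢ[ℝ] E3,
      ∀ x, L x 0 = inner ℝ e₁ x ∧ L x 1 = inner ℝ e₂ x ∧ L x 2 = inner ℝ e₃ x := by
  have hon : Orthonormal ℝ ![e₁, e₂, e₃] := by
    constructor
    · intro i; fin_cases i <;> simpa
    · intro i j hij
      fin_cases i <;> fin_cases j <;> simp_all [real_inner_comm]
  let B := OrthonormalBasis.mk hon
    (hon.linearIndependent.span_eq_top_of_card_eq_finrank (by simp)).ge
  refine ⟨B.repr, fun x => ?_⟩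
  simp only [OrthonormalBasis.repr_apply_apply, B, OrthonormalBasis.coe_mk]
  simp

open WedgeVertex in
/-- Every inscribed realization of `F_k` is similar to a standard one. -/
theorem IsWedgeRealization.exists_similarity {k : ℕ} (hk : 5 ≤ k) {v : WedgeVertex k → E3}
    (hv : IsWedgeRealization v) {c : E3} {r : ℝ} (hc : ∀ x, dist (v x) c = r) :
    0 < r ∧ ∃ (L : E3 ≃ₗᵢ[ℝ] E3) (α : E2) (p q : Fin (k - 4) → ℝ) (γ : ℝ), γ ∈ Ioo 0 Real.pi ∧
      InterlacedRadii p q ∧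
      (fun x => (1 / (2 * r)) • L (v x - v north) + northPole) = wedgePoint α p q γ ∧
      L (c - v north) = !₂[0, 0, -r] := by
  have hinj := hv.1.1.injective
  set N := v north with hN
  set n := c - N with hn
  have hnr : ‖n‖ = r := by rw [hn, ← dist_eq_norm, dist_comm, hc]
  have hne (x) (hx : x ≠ north) : v x - N ≠ 0 := sub_ne_zero.2 (hinj.ne hx)
  have hrpos : 0 < r := by
    rw [← hnr, norm_pos_iff]
    intro h0
    rw [h0, norm_zero] at hnr
    have h1 := hc south
    have h2 := hc north
    rw [← hnr, dist_eq_zero] at h1 h2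
    exact hne south (by simp) (by rw [h1, hN, h2, sub_self])
  -- The sphere passes through `N` and has centre `N + n`. Hence its inversion about `N` lies in the
  -- plane `⟨·, n⟩ = 1 / 2`, in which the differences `P`, `Q` are tangent vectors.
  have hinner (x) : inner ℝ (v x - N) n = ‖v x - N‖ ^ 2 / 2 := by
    have h1 : ‖(v x - N) - n‖ = ‖n‖ := by rw [hn, sub_sub_sub_cancel_right, ← dist_eq_norm, hc, hnr]
    have h2 := norm_sub_sq_real (v x - N) n
    rw [h1] at h2
    linarith
  let i₀ : Fin (k - 4) := ⟨0, by lia⟩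
  have hstar (x) (hx : x ≠ north) : inner ℝ (invertAt N (v x)) n = 1 / 2 := by
    have : ‖v x - N‖ ^ 2 ≠ 0 := by simpa using hne x hx
    rw [invertAt, real_inner_smul_left, hinner, ← mul_div_assoc, inv_mul_cancel₀ this]
  set P := invertAt N (v (p i₀)) - invertAt N (v south) with hP
  set Q := invertAt N (v (q i₀)) - invertAt N (v south) with hQ
  have hPn : inner ℝ P n = 0 := by
    rw [hP, inner_sub_left, hstar _ (by simp), hstar _ (by simp), sub_self]
  have hQn : inner ℝ Q n = 0 := by
    rw [hQ, inner_sub_left, hstar _ (by simp), hstar _ (by simp), sub_self]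
  have hface (j : Fin (k - 1)) : IsFace v {x | Incident x j} :=
    ((hv.2 _).2 ((mem_facets_iff hk).2 ⟨j, rfl⟩)).1
  -- A facet through `north` lies in a plane through the centre of inversion, so its functional
  -- still detects incidence after inversion.
  have hfun (j : Fin (k - 1)) (hj : Incident (north : WedgeVertex k) j) :
      ∃ f : E3 →L[ℝ] ℝ, ∀ x ≠ north, f (invertAt N (v x)) = 0 ↔ Incident x j := by
    obtain ⟨f, d, -, h⟩ := hface j
    have hd : f N = d := (h north).1 hj
    refine ⟨f, fun x hx => ?_⟩
    have : ‖v x - N‖ ^ 2 ≠ 0 := by simpa using hne x hx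
    rw [invertAt, map_smul, map_sub, hd, smul_eq_mul, mul_eq_zero, or_iff_right (inv_ne_zero this),
      sub_eq_zero]
    exact (h x).symm
  have hP0 : P ≠ 0 := by
    obtain ⟨f, hf⟩ := hfun ⟨k - 2, by lia⟩ (by simp only [Incident]; lia)
    have h1 := (hf south (by simp)).2 (by simp only [Incident]; lia)
    have h2 : f (invertAt N (v (p i₀))) ≠ 0 := fun h => by
      have := (hf (p i₀) (by simp)).1 h
      simp only [Incident, i₀] at this; lia
    intro h0
    have h3 : f P = 0 := by rw [h0, map_zero]
    rw [hP, map_sub, h1, sub_zero] at h3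
    exact h2 h3
  have hPpos := norm_pos_iff.2 hP0
  set e₁ := ‖P‖⁻¹ • P with he₁
  -- Gram–Schmidt on `P` and `Q`. The second polygon separates `south` from `p 0`, so `P ≠ 0`; the
  -- first contains `south` and `p 0` but not `q 0`, so `Q` is not a multiple of `P`. The third axis
  -- `-n / r` brings `north` to the top.
  set Q' := Q - inner ℝ e₁ Q • e₁ with hQ'
  have hQ0 : Q' ≠ 0 := by
    obtain ⟨f, hf⟩ := hfun ⟨0, by lia⟩ (by simp [Incident])
    have h1 := (hf south (by simp)).2 (by simp [Incident])
    have h2 := (hf (p i₀) (by simp)).2 (by simp [Incident])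
    have h3 : f (invertAt N (v (q i₀))) ≠ 0 := fun h => by
      have := (hf (q i₀) (by simp)).1 h
      simp only [Incident, i₀] at this; lia
    have hfP : f P = 0 := by rw [hP, map_sub, h1, h2, sub_zero]
    intro h0
    have h4 : f Q' = 0 := by rw [h0, map_zero]
    rw [hQ', map_sub, map_smul, he₁, map_smul, hfP, hQ, map_sub, h1] at h4
    simp [h3] at h4
  have hQpos := norm_pos_iff.2 hQ0
  have hn₁ : ‖e₁‖ = 1 := by rw [he₁, norm_smul, norm_inv, norm_norm, inv_mul_cancel₀ hPpos.ne']
  have hn₂ : ‖‖Q'‖⁻¹ • Q'‖ = 1 := by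
    rw [norm_smul, norm_inv, norm_norm, inv_mul_cancel₀ hQpos.ne']
  have hn₃ : ‖-(r⁻¹ • n)‖ = 1 := by
    rw [norm_neg, norm_smul, norm_inv, hnr, Real.norm_of_nonneg hrpos.le, inv_mul_cancel₀ hrpos.ne']
  have h1Q' : inner ℝ e₁ Q' = 0 := by
    rw [hQ', inner_sub_right, real_inner_smul_right, real_inner_self_eq_norm_sq, hn₁]; ring
  have h1n : inner ℝ e₁ n = 0 := by rw [he₁, real_inner_smul_left, hPn, mul_zero]
  have hQ'n : inner ℝ Q' n = 0 := by
    rw [hQ', inner_sub_left, real_inner_smul_left, hQn, h1n]; ring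
  obtain ⟨L, hL⟩ := exists_linearIsometryEquiv hn₁ hn₂ hn₃
    (by rw [real_inner_smul_right, h1Q', mul_zero])
    (by rw [inner_neg_right, real_inner_smul_right, h1n]; simp)
    (by rw [inner_neg_right, real_inner_smul_right, real_inner_smul_left, hQ'n]; simp)
  refine ⟨hrpos, L, ?_⟩
  have hLn : L n = !₂[0, 0, -r] := by
    ext i
    fin_cases i
    · simp [(hL n).1, h1n]
    · simp [(hL n).2.1, real_inner_smul_left, hQ'n]
    · simp [(hL n).2.2, real_inner_smul_left, inner_neg_left, hnr]
      field_simp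
  let w : WedgeVertex k → E3 := fun x => (1 / (2 * r)) • L (v x - N)
  have hw2 (x) : w x 2 = -‖w x‖ ^ 2 := by
    have h1 : ‖w x‖ = 1 / (2 * r) * ‖v x - N‖ := by
      simp only [w, norm_smul, L.norm_map]
      rw [Real.norm_of_nonneg (by positivity)]
    rw [h1]
    simp only [w, PiLp.smul_apply, smul_eq_mul]
    rw [(hL _).2.2, inner_neg_left, real_inner_smul_left, real_inner_comm, hinner]
    field_simp
  let u : WedgeVertex k → E2 := fun x => !₂[w x 0 / ‖w x‖ ^ 2, w x 1 / ‖w x‖ ^ 2]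
  have hw0 (x) (hx : x ≠ north) : w x ≠ 0 :=
    smul_ne_zero (by positivity) ((map_ne_zero_iff L L.injective).2 (hne x hx))
  have hu (x) (hx : x ≠ north) :
      (1 / (2 * r)) • L (v x - N) + northPole = stereoInv (u x) :=
    add_northPole_eq_stereoInv (hw0 x hx) (hw2 x)
  -- Scaling by `1 / (2 r)` before an inversion amounts to scaling by `2 r` after it.
  have hucoord (x) (hx : x ≠ north) (i : Fin 3) :
      w x i / ‖w x‖ ^ 2 = 2 * r * L (invertAt N (v x)) i := by
    have h1 : ‖w x‖ = 1 / (2 * r) * ‖v x - N‖ := by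
      simp only [w, norm_smul, L.norm_map]
      rw [Real.norm_of_nonneg (by positivity)]
    have h2 : ‖v x - N‖ ≠ 0 := norm_ne_zero_iff.2 (hne x hx)
    rw [h1]
    simp only [w, invertAt, map_smul, PiLp.smul_apply, smul_eq_mul]
    field_simp
  have hu' (x) (hx : x ≠ north) : u x = u south +
      !₂[2 * r * inner ℝ e₁ (invertAt N (v x) - invertAt N (v south)),
        2 * r * inner ℝ (‖Q'‖⁻¹ • Q') (invertAt N (v x) - invertAt N (v south))] := by
    ext i
    fin_cases i
    · simp only [u, hucoord x hx, hucoord south (by simp), (hL _).1, inner_sub_right]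
      simp; ring
    · simp only [u, hucoord x hx, hucoord south (by simp), (hL _).2.1, inner_sub_right]
      simp; ring
  have h1P : inner ℝ e₁ P = ‖P‖ := by
    rw [he₁, real_inner_smul_left, real_inner_self_eq_norm_sq]; field_simp
  have hQ'P : inner ℝ Q' P = 0 := by
    have : P = ‖P‖ • e₁ := by rw [he₁, smul_inv_smul₀ hPpos.ne']
    rw [this, real_inner_smul_right, real_inner_comm, h1Q', mul_zero]
  have hQ'Q : inner ℝ Q' Q = ‖Q'‖ ^ 2 := by
    have : Q = Q' + inner ℝ e₁ Q • e₁ := by rw [hQ']; abel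
    conv_lhs => rw [this, inner_add_right, real_inner_smul_right, real_inner_comm e₁ Q', h1Q',
      real_inner_self_eq_norm_sq]
    simp
  have hpos₂ : 0 < 2 * r * inner ℝ (‖Q'‖⁻¹ • Q') Q := by
    rw [real_inner_smul_left, hQ'Q]; positivity
  obtain ⟨d, hd, γ, hγ, hcos, hsin⟩ := exists_polar (a := 2 * r * inner ℝ e₁ Q) hpos₂
  obtain ⟨p', q', hpq, heq⟩ := exists_eq_wedgePoint_of_isFace (i₀ := i₀) (u := u)
    (v := fun x => (1 / (2 * r)) • L (v x - N) + northPole) (x := 2 * r * ‖P‖) hk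
    (fun x y hxy => hinj (by
      have h2r : (1 / (2 * r)) ≠ 0 := by positivity
      simpa [hrpos.ne'] using hxy))
    (fun S hS => isFace_similarity ((hv.2 S).2 hS).1 (by positivity) L N northPole)
    (by simp [hN]) hu rfl (by positivity) hd (Real.sin_pos_of_mem_Ioo hγ)
    (by rw [hu' _ (by simp), ← hP, h1P, real_inner_smul_left, hQ'P]; simp)
    (by rw [hu' _ (by simp), ← hQ, hcos, hsin])
  exact ⟨_, p', q', γ, hγ, hpq, heq, hLn⟩

/-! ### Invariants and moduli up to similarity. -/

section SimilarityInvariant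

/-- The component of `Q` orthogonal to `P`. -/
noncomputable def orthComponent (P Q : E3) : E3 := Q - (inner ℝ P Q / ‖P‖ ^ 2) • P

/-- The distance from the origin of the plane through `s` parallel to `P` and `Q`. -/
noncomputable def planeHeight (s P Q : E3) : ℝ :=
  -- By Pythagoras, the components of `s` along the orthogonal vectors `P` and `orthComponent P Q`
  -- are removed. The height is the unit of length: it is `1` in standard position.
  √(‖s‖ ^ 2 - inner ℝ P s ^ 2 / ‖P‖ ^ 2
    - inner ℝ (orthComponent P Q) s ^ 2 / ‖orthComponent P Q‖ ^ 2)

theorem orthComponent_similarity {a : ℝ} (ha : 0 < a) (L : E3 ≃ₗᵢ[ℝ] E3) (P Q : E3) :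
    orthComponent (a • L P) (a • L Q) = a • L (orthComponent P Q) := by
  have h : inner ℝ (a • L P) (a • L Q) / ‖a • L P‖ ^ 2 = inner ℝ P Q / ‖P‖ ^ 2 := by
    rw [real_inner_smul_left, real_inner_smul_right, L.inner_map_map, norm_smul, L.norm_map,
      Real.norm_of_nonneg ha.le, mul_pow, ← mul_assoc, ← sq, mul_div_mul_left _ _ (by positivity)]
  rw [orthComponent, h, orthComponent, map_sub, map_smul, smul_sub, smul_comm a]

theorem planeHeight_similarity {a : ℝ} (ha : 0 < a) (L : E3 ≃ₗᵢ[ℝ] E3) (s P Q : E3) :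
    planeHeight (a • L s) (a • L P) (a • L Q) = a * planeHeight s P Q := by
  have h (x : E3) : inner ℝ (a • L x) (a • L s) ^ 2 / ‖a • L x‖ ^ 2
      = a ^ 2 * (inner ℝ x s ^ 2 / ‖x‖ ^ 2) := by
    rw [real_inner_smul_left, real_inner_smul_right, L.inner_map_map, norm_smul, L.norm_map,
      Real.norm_of_nonneg ha.le, mul_pow, mul_pow, mul_pow, mul_div_mul_left _ _ (by positivity),
      mul_div_assoc]
  rw [planeHeight, orthComponent_similarity ha, h, h, norm_smul, L.norm_map,
    Real.norm_of_nonneg ha.le, mul_pow, ← mul_sub, ← mul_sub, Real.sqrt_mul (sq_nonneg a),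
    Real.sqrt_sq ha.le, planeHeight]

/-- The parameters of a realization in terms of the images `s` of `south`, `s + R i` of `p i` and
`s + Q` of `q 0` under the inversion about `north`. -/
noncomputable def invertedParameters {m : ℕ} [NeZero m] (s : E3) (R : Fin m → E3) (Q : E3) :
    E2 × (Fin m → ℝ) × ℝ × ℝ :=
  (!₂[inner ℝ (R 0) s / (‖R 0‖ * planeHeight s (R 0) Q),
      inner ℝ (orthComponent (R 0) Q) s / (‖orthComponent (R 0) Q‖ * planeHeight s (R 0) Q)],
    backwardDiff (fun i => ‖R i‖ / planeHeight s (R 0) Q), InnerProductGeometry.angle (R 0) Q,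
    ‖Q‖ / planeHeight s (R 0) Q)

/-- All entries are angles or quotients of quantities of equal degree. -/
theorem invertedParameters_similarity {m : ℕ} [NeZero m] {a : ℝ} (ha : 0 < a) (L : E3 ≃ₗᵢ[ℝ] E3)
    (s : E3) (R : Fin m → E3) (Q : E3) :
    invertedParameters (a • L s) (fun i => a • L (R i)) (a • L Q) = invertedParameters s R Q := by
  have h₁ (x : E3) : inner ℝ (a • L x) (a • L s) / (‖a • L x‖ * (a * planeHeight s (R 0) Q))
      = inner ℝ x s / (‖x‖ * planeHeight s (R 0) Q) := by
    rw [real_inner_smul_left, real_inner_smul_right, L.inner_map_map, norm_smul, L.norm_map,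
      Real.norm_of_nonneg ha.le, ← mul_assoc, mul_mul_mul_comm, mul_div_mul_left _ _ (by positivity)]
  have h₂ (x : E3) : ‖a • L x‖ / (a * planeHeight s (R 0) Q) = ‖x‖ / planeHeight s (R 0) Q := by
    rw [norm_smul, L.norm_map, Real.norm_of_nonneg ha.le, mul_div_mul_left _ _ ha.ne']
  have h₃ : InnerProductGeometry.angle (L (R 0)) (L Q) = InnerProductGeometry.angle (R 0) Q :=
    L.toLinearIsometry.angle_map _ _
  simp only [invertedParameters, planeHeight_similarity ha, orthComponent_similarity ha, h₁, h₂,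
    InnerProductGeometry.angle_smul_left_of_pos _ _ ha,
    InnerProductGeometry.angle_smul_right_of_pos _ _ ha, h₃]

/-- The conditions under which `invertedParameters` is continuous. -/
def IsNondegenerate (s P Q : E3) : Prop :=
  P ≠ 0 ∧ orthComponent P Q ≠ 0 ∧ planeHeight s P Q ≠ 0

theorem isNondegenerate_similarity {a : ℝ} (ha : 0 < a) (L : E3 ≃ₗᵢ[ℝ] E3) {s P Q : E3} :
    IsNondegenerate (a • L s) (a • L P) (a • L Q) ↔ IsNondegenerate s P Q := by
  simp [IsNondegenerate, orthComponent_similarity ha, planeHeight_similarity ha, ha.ne']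

theorem continuous_invertedParameters {X : Type*} [TopologicalSpace X] {m : ℕ} [NeZero m]
    {s Q : X → E3} {R : X → Fin m → E3} (hs : Continuous s) (hR : Continuous R)
    (hQ : Continuous Q) (h : ∀ x, IsNondegenerate (s x) (R x 0) (Q x)) :
    Continuous fun x => invertedParameters (s x) (R x) (Q x) := by
  have hR' (i) : Continuous fun x => R x i := (continuous_apply i).comp hR
  have hP := hR' 0
  have n₁ (x) : ‖R x 0‖ ≠ 0 := norm_ne_zero_iff.2 (h x).1
  have n₂ (x) : ‖orthComponent (R x 0) (Q x)‖ ≠ 0 := norm_ne_zero_iff.2 (h x).2.1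
  have n₃ (x) : planeHeight (s x) (R x 0) (Q x) ≠ 0 := (h x).2.2
  have hQ0 (x) : Q x ≠ 0 := fun h0 => (h x).2.1 (by simp [orthComponent, h0])
  have hO : Continuous fun x => orthComponent (R x 0) (Q x) :=
    hQ.sub (((hP.inner hQ).div (hP.norm.pow 2) fun x => pow_ne_zero 2 (n₁ x)).smul hP)
  have hH : Continuous fun x => planeHeight (s x) (R x 0) (Q x) :=
    Real.continuous_sqrt.comp (((hs.norm.pow 2).sub (((hP.inner hs).pow 2).div (hP.norm.pow 2)
      fun x => pow_ne_zero 2 (n₁ x))).sub (((hO.inner hs).pow 2).div (hO.norm.pow 2)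
      fun x => pow_ne_zero 2 (n₂ x)))
  refine Continuous.prodMk ?_ (Continuous.prodMk ?_ (Continuous.prodMk ?_ ?_))
  · refine (PiLp.continuous_toLp 2 _).comp (continuous_pi fun i => ?_)
    fin_cases i
    · exact (hP.inner hs).div (hP.norm.mul hH) fun x => mul_ne_zero (n₁ x) (n₃ x)
    · exact (hO.inner hs).div (hO.norm.mul hH) fun x => mul_ne_zero (n₂ x) (n₃ x)
  · have hd (i) : Continuous fun x => ‖R x i‖ / planeHeight (s x) (R x 0) (Q x) :=
      (hR' i).norm.div hH n₃
    refine continuous_pi fun i => ?_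
    unfold backwardDiff
    split_ifs
    · exact hd i
    · exact (hd i).sub (hd _)
  · exact continuous_iff_continuousAt.2 fun x =>
      (InnerProductGeometry.continuousAt_angle (x := (R x 0, Q x)) (h x).1 (hQ0 x)).comp
        (f := fun x => (R x 0, Q x)) (hP.prodMk hQ).continuousAt
  · exact hQ.norm.div hH n₃

variable {k : ℕ}

theorem invertAt_northPole (u : E2) : invertAt northPole (stereoInv u) = !₂[u 0, u 1, -1] := by
  have h : ‖stereoInv u - northPole‖ ^ 2 = (1 + ‖u‖ ^ 2)⁻¹ := by
    rw [← dist_eq_norm, dist_comm, dist_northPole_stereoInv, stereoFactor_sq]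
  have h1 := (one_add_norm_sq_pos u).ne'
  rw [invertAt, h, inv_inv]
  ext i
  fin_cases i
  · simp [stereoInv, northPole]
    field_simp
  · simp [stereoInv, northPole]
    field_simp
  · simp [stereoInv, northPole]
    field_simp
    ring

/-- Inversion commutes with isometries and turns a scaling into the inverse one. -/
theorem invertAt_similarity {N x : E3} {a : ℝ} (ha : 0 < a) (L : E3 ≃ₗᵢ[ℝ] E3) (b : E3) :
    invertAt (a • L N + b) (a • L x + b) = a⁻¹ • L (invertAt N x) := by
  have h : a • L x + b - (a • L N + b) = a • L (x - N) := by rw [map_sub, smul_sub]; abel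
  rw [invertAt, h, norm_smul, L.norm_map, Real.norm_of_nonneg ha.le, invertAt, map_smul, smul_smul,
    smul_smul]
  congr 1
  field_simp

theorem continuous_wedgePoint {X : Type*} [TopologicalSpace X] {α : X → E2}
    {p q : X → Fin (k - 4) → ℝ} {γ : X → ℝ} (hα : Continuous α) (hp : Continuous p)
    (hq : Continuous q) (hγ : Continuous γ) :
    Continuous fun x => wedgePoint (α x) (p x) (q x) (γ x) := by
  have hp' (i) : Continuous fun x => p x i := (continuous_apply i).comp hp
  have hq' (i) : Continuous fun x => q x i := (continuous_apply i).comp hq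
  refine continuous_pi fun y => ?_
  rcases y with _ | _ | i | i
  · exact continuous_const
  · exact continuous_stereoInv.comp hα
  · refine continuous_stereoInv.comp (hα.add ((PiLp.continuous_toLp 2 _).comp
      (continuous_pi fun j => ?_)))
    fin_cases j
    · exact hp' i
    · exact continuous_const
  · refine continuous_stereoInv.comp (hα.add ((PiLp.continuous_toLp 2 _).comp
      (continuous_pi fun j => ?_)))
    fin_cases j
    · exact (hq' i).mul (Real.continuous_cos.comp hγ)
    · exact (hq' i).mul (Real.continuous_sin.comp hγ)

variable [NeZero (k - 4)]

/-- The parameters of an inscribed realization. -/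
noncomputable def similarityInvariant (v : WedgeVertex k → E3) :
    E2 × (Fin (k - 4) → ℝ) × ℝ × ℝ :=
  invertedParameters (invertAt (v .north) (v .south))
    (fun i => invertAt (v .north) (v (.p i)) - invertAt (v .north) (v .south))
    (invertAt (v .north) (v (.q 0)) - invertAt (v .north) (v .south))

theorem axis_params {s₀ s₁ x a b : ℝ} (hx : 0 < x) (hb : 0 < b) :
    orthComponent !₂[x, 0, 0] !₂[a, b, 0] = !₂[0, b, 0] ∧
      planeHeight !₂[s₀, s₁, -1] !₂[x, 0, 0] !₂[a, b, 0] = 1 := by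
  have h : orthComponent !₂[x, 0, 0] !₂[a, b, 0] = !₂[0, b, 0] := by
    rw [orthComponent, E3.inner_eq, E3.norm_sq]
    ext i
    fin_cases i
    · simp; field_simp; simp
    · simp
    · simp
  refine ⟨h, ?_⟩
  rw [planeHeight, h]
  simp only [E3.inner_eq, E3.norm_sq]
  simp
  field_simp
  ring

/-- After inversion about the pole the standard vertices lie in the plane at height `-1` over their
stereographic projections, so the parameters can be read off. -/
theorem similarityInvariant_wedgePoint {α : E2} {p q : Fin (k - 4) → ℝ} {γ : ℝ}
    (hγ : γ ∈ Ioo 0 Real.pi) (hp : ∀ i, 0 < p i) (hq : 0 < q 0) :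
    similarityInvariant (wedgePoint α p q γ) = (α, backwardDiff p, γ, q 0) ∧
      IsNondegenerate !₂[α 0, α 1, -1] !₂[p 0, 0, 0]
        !₂[q 0 * Real.cos γ, q 0 * Real.sin γ, 0] := by
  have hs := Real.sin_pos_of_mem_Ioo hγ
  have hb := mul_pos hq hs
  have hR (i) : invertAt northPole (stereoInv (α + !₂[p i, 0])) - !₂[α 0, α 1, -1]
      = !₂[p i, 0, 0] := by
    rw [invertAt_northPole]
    ext j
    fin_cases j <;> simp
  have hQ : invertAt northPole (stereoInv (α + !₂[q 0 * Real.cos γ, q 0 * Real.sin γ]))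
      - !₂[α 0, α 1, -1] = !₂[q 0 * Real.cos γ, q 0 * Real.sin γ, 0] := by
    rw [invertAt_northPole]
    ext j
    fin_cases j <;> simp
  obtain ⟨hO, hH⟩ := axis_params (s₀ := α 0) (s₁ := α 1) (a := q 0 * Real.cos γ) (hp 0) hb
  have hn {x : E3} {a : ℝ} (ha : 0 < a) (h : ‖x‖ ^ 2 = a ^ 2) : ‖x‖ = a :=
    (sq_eq_sq₀ (norm_nonneg _) ha.le).1 h
  have hn₁ (i) : ‖(!₂[p i, 0, 0] : E3)‖ = p i := hn (hp i) (by simp [E3.norm_sq])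
  have hn₂ : ‖(!₂[0, q 0 * Real.sin γ, 0] : E3)‖ = q 0 * Real.sin γ :=
    hn hb (by simp [E3.norm_sq])
  have hn₃ : ‖(!₂[q 0 * Real.cos γ, q 0 * Real.sin γ, 0] : E3)‖ = q 0 := hn hq (by
    simp only [E3.norm_sq, Matrix.cons_val]
    linear_combination q 0 ^ 2 * Real.sin_sq_add_cos_sq γ)
  constructor
  · simp only [similarityInvariant, wedgePoint, hR, hQ, invertAt_northPole α, invertedParameters,
      hO, hH, hn₁, hn₂, hn₃, mul_one, div_one, E3.inner_eq, InnerProductGeometry.angle]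
    refine Prod.ext ?_ (Prod.ext rfl (Prod.ext ?_ rfl))
    · ext j
      have := hp 0
      fin_cases j
      · simp; field_simp
      · simp; field_simp
    · have := hp 0
      simp
      rw [show p 0 * (q 0 * Real.cos γ) / (p 0 * q 0) = Real.cos γ by field_simp]
      exact Real.arccos_cos hγ.1.le hγ.2.le
  · refine ⟨?_, ?_, ?_⟩
    · rw [← norm_ne_zero_iff, hn₁]; exact (hp 0).ne'
    · rw [hO, ← norm_ne_zero_iff, hn₂]; exact hb.ne'
    · rw [hH]; exact one_ne_zero

theorem continuousOn_zigzag {m : ℕ} [NeZero m] :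
    ContinuousOn (fun x : (Fin m → ℝ) × ℝ => zigzag x.1 x.2) {x | x.1 0 ≠ 0 ∧ x.2 ≠ 0} := by
  refine continuousOn_pi.2 fun i => ?_
  unfold zigzag
  split_ifs
  · exact ContinuousOn.mul (by fun_prop) (ContinuousOn.div (by fun_prop) (by fun_prop)
      fun x hx => hx.1)
  · exact ContinuousOn.mul (by fun_prop) (ContinuousOn.div (by fun_prop) (by fun_prop)
      fun x hx => hx.2)

theorem inPosition_wedgePoint {α : E2} {p q : Fin (k - 4) → ℝ} {γ : ℝ} :
    InPosition (wedgePoint α p q γ) α p γ (q 0) := by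
  refine ⟨wedgePoint_mem_sphere, rfl, rfl, fun _ => rfl, fun i hi => ?_⟩
  rw [show i = 0 from Fin.ext (by simpa using hi)]
  rfl

theorem exists_homeomorph_similarityRealizationSpace (hk : 5 ≤ k) :
    ∃ Ψ : wedgeParameters k (fun _ β _ => zigzagDomain (partialSums β)) ≃ₜ
        SimilarityRealizationSpace k,
      ∀ z : wedgeParameters k (fun _ β _ => zigzagDomain (partialSums β)),
        ∃ v : InscribedRealization k,
          InPosition v.1 z.1.1 (fun i => ∑ j ∈ Finset.Iic i, z.1.2.1 j) z.1.2.2.1 z.1.2.2.2 ∧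
          Ψ z = Quotient.mk (similaritySetoid k) v := by
  set Z := wedgeParameters k (fun _ β _ => zigzagDomain (partialSums β)) with hZ
  have hpq (z : Z) : InterlacedRadii (partialSums z.1.2.1)
      (zigzag (partialSums z.1.2.1) z.1.2.2.2) :=
    interlacedRadii_zigzag (sum_Iic_pos z.2.1) (strictMono_sum_Iic z.2.1) z.2.2.2
  have hsin (z : Z) : Real.sin z.1.2.2.1 ≠ 0 := (Real.sin_pos_of_mem_Ioo z.2.2.1).ne'
  have hz0 (z : Z) : zigzag (partialSums z.1.2.1) z.1.2.2.2 0 = z.1.2.2.2 :=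
    zigzag_zero (sum_Iic_pos z.2.1 0).ne' _
  let nf : Z → InscribedRealization k := fun z =>
    ⟨wedgePoint z.1.1 (partialSums z.1.2.1) (zigzag (partialSums z.1.2.1) z.1.2.2.2) z.1.2.2.1,
      (hpq z).isWedgeRealization hk _ (hsin z), _, _, wedgePoint_mem_sphere⟩
  have hnf : Continuous nf := by
    refine Continuous.subtype_mk (continuous_wedgePoint (by fun_prop)
      (continuous_partialSums.comp (by fun_prop)) ?_ (by fun_prop)) _
    exact continuousOn_zigzag.comp_continuous (f := fun z : Z => (partialSums z.1.2.1, z.1.2.2.2))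
      ((continuous_partialSums.comp (by fun_prop)).prodMk (by fun_prop))
      fun z => ⟨(sum_Iic_pos z.2.1 0).ne', z.2.2.2.1.ne'⟩
  have hsurj (v : InscribedRealization k) : ∃ z, similaritySetoid k v (nf z) := by
    obtain ⟨v, hv, c, r, hc⟩ := v
    obtain ⟨hr, L, α, p, q, γ, hγ, hpq, heq, -⟩ := hv.exists_similarity hk hc
    have hsum : partialSums (backwardDiff p) = p := funext (sum_Iic_backwardDiff p)
    have hb (i) : 0 < backwardDiff p i := by
      unfold backwardDiff
      split_ifs with h
      · exact hpq.p_pos i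
      · exact sub_pos.2 (hpq.p_mono (Fin.lt_def.2 (by simp only; lia)))
    refine ⟨⟨(α, backwardDiff p, γ, q 0), hb, hγ, ?_⟩, 1 / (2 * r), by positivity, L,
      northPole - (1 / (2 * r)) • L (v .north), fun x => ?_⟩
    · change q 0 ∈ zigzagDomain (partialSums (backwardDiff p))
      rw [hsum]; exact hpq.mem_zigzagDomain
    · change wedgePoint α (partialSums (backwardDiff p))
        (zigzag (partialSums (backwardDiff p)) (q 0)) γ x = (1 / (2 * r)) • L (v x) + _
      rw [hsum, ← hpq.eq_zigzag, ← congrFun heq x, map_sub, smul_sub]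
      abel
  have hvalue (z : Z) := similarityInvariant_wedgePoint (α := z.1.1) z.2.2.1 (hpq z).p_pos
    ((hpq z).q_pos 0)
  have hleft (z : Z) : similarityInvariant (nf z).1 = z.1 := by
    rw [(hvalue z).1, hz0]
    exact Prod.ext rfl (Prod.ext (backwardDiff_sum_Iic _) rfl)
  have hrel (v w : InscribedRealization k) (h : similaritySetoid k v w) :
      similarityInvariant v.1 = similarityInvariant w.1 := by
    obtain ⟨s, hs, L, b, h⟩ := h
    simp only [similarityInvariant, h, invertAt_similarity hs, ← smul_sub, ← map_sub]
    exact (invertedParameters_similarity (inv_pos.2 hs) L _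
      (fun i => invertAt (v.1 .north) (v.1 (.p i)) - invertAt (v.1 .north) (v.1 .south)) _).symm
  -- Nondegeneracy is invariant under similarity, so it is checked on the normal form.
  have hnondeg (v : InscribedRealization k) :
      IsNondegenerate (invertAt (v.1 .north) (v.1 .south))
        (invertAt (v.1 .north) (v.1 (.p 0)) - invertAt (v.1 .north) (v.1 .south))
        (invertAt (v.1 .north) (v.1 (.q 0)) - invertAt (v.1 .north) (v.1 .south)) := by
    obtain ⟨z, s, hs, L, b, h⟩ := hsurj v
    rw [← isNondegenerate_similarity (inv_pos.2 hs) L, map_sub, map_sub, smul_sub, smul_sub,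
      ← invertAt_similarity hs L b, ← invertAt_similarity hs L b, ← invertAt_similarity hs L b,
      ← h, ← h, ← h, ← h]
    convert (hvalue z).2 using 1
    · exact invertAt_northPole _
    · simp only [nf, wedgePoint, invertAt_northPole]
      ext j; fin_cases j <;> simp
    · simp only [nf, wedgePoint, invertAt_northPole]
      ext j; fin_cases j <;> simp
  have hinv : Continuous fun v : InscribedRealization k => similarityInvariant v.1 := by
    have hy (y) : Continuous fun v : InscribedRealization k => v.1 y :=
      (continuous_apply y).comp continuous_subtype_val
    have hstar (y) (hyN : y ≠ WedgeVertex.north) :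
        Continuous fun v : InscribedRealization k => invertAt (v.1 .north) (v.1 y) := by
      have hd : Continuous fun v : InscribedRealization k => v.1 y - v.1 .north :=
        (hy y).sub (hy _)
      refine ((hd.norm.pow 2).inv₀ fun v => ?_).smul hd
      simpa [sub_eq_zero] using v.2.1.1.1.injective.ne hyN
    exact continuous_invertedParameters (hstar _ (by simp))
      (continuous_pi fun i => (hstar _ (by simp)).sub (hstar _ (by simp)))
      ((hstar _ (by simp)).sub (hstar _ (by simp))) hnondeg
  obtain ⟨Ψ, hΨ⟩ := exists_homeomorph_quotient (similaritySetoid k) hnf hinv hrel hleft hsurj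
  refine ⟨Ψ, fun z => ⟨nf z, ?_, hΨ z⟩⟩
  have := inPosition_wedgePoint (α := z.1.1) (p := partialSums z.1.2.1)
    (q := zigzag (partialSums z.1.2.1) z.1.2.2.2) (γ := z.1.2.2.1)
  rw [hz0] at this
  exact this

end SimilarityInvariant

/-! ### Möbius transformations of the sphere. -/

section Moebius

/-- The center of `S2`. -/
noncomputable abbrev sphereCenter : E3 := !₂[0, 0, 1 / 2]

theorem one_lt_rank_E3 : 1 < Module.rank ℝ E3 := by
  rw [← Module.finrank_eq_rank]
  norm_num

/-- `EuclideanGeometry.inversion` fixes its centre, so a centre on the sphere has to be excluded by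
an argument: points of the sphere close to it would be sent farther away than the diameter `1`. -/
theorem ne_of_inversion_mem {σ : Equiv.Perm S2} {c : E3} {r : ℝ}
    (h : ∀ x : S2, (σ x : E3) = EuclideanGeometry.inversion c r (x : E3)) (x : S2) :
    (x : E3) ≠ c := by
  rintro rfl
  let N : S2 := ⟨northPole, northPole_mem_sphere⟩
  let O : S2 := ⟨stereoInv 0, stereoInv_mem_sphere 0⟩
  have hle (y : S2) : dist (y : E3) x ≤ 1 := by
    have := dist_triangle_right (y : E3) x sphereCenter
    have h1 := y.2
    have h2 := x.2
    rw [Metric.mem_sphere] at h1 h2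
    linarith
  have hr : r ≠ 0 := by
    rintro rfl
    have h1 : σ N = σ O := by
      apply Subtype.ext
      rw [h, h]; simp [EuclideanGeometry.inversion]
    exact northPole_ne_stereoInv 0 (congrArg Subtype.val (σ.injective h1))
  have hpos : 0 < r ^ 2 := by positivity
  let y₀ : E3 := sphereCenter - (x - sphereCenter)
  have hy₀ : y₀ ∈ Metric.sphere sphereCenter (1 / 2) := by
    have := x.2
    rw [Metric.mem_sphere, dist_eq_norm] at *
    rw [show y₀ - sphereCenter = -(x - sphereCenter) by simp [y₀], norm_neg, this]
  have hd : dist y₀ x = 1 := by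
    have := x.2
    rw [Metric.mem_sphere, dist_eq_norm] at this
    rw [dist_eq_norm, show y₀ - x = -((2 : ℝ) • ((x : E3) - sphereCenter)) by
      simp only [y₀, two_smul]; abel, norm_neg, norm_smul, this]
    norm_num
  -- By connectedness, distances from `x` to points of the sphere take all values from `0` to `1`. A
  -- distance less than `r²` is sent to one greater than `1`.
  obtain ⟨y, hy, hyd⟩ := (isPreconnected_sphere one_lt_rank_E3 sphereCenter (1 / 2)).intermediate_value
    x.2 hy₀ (f := fun y => dist y x) (by fun_prop)
    (show min (r ^ 2) 1 / 2 ∈ Icc (dist (x : E3) x) (dist y₀ x) by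
      rw [dist_self, hd]
      constructor
      · positivity
      · linarith [min_le_right (r ^ 2) 1])
  replace hyd : dist y x = min (r ^ 2) 1 / 2 := hyd
  have h1 : 0 < dist y x := by rw [hyd]; positivity
  have h2 : dist y x < r ^ 2 := by
    rw [hyd]; linarith [min_le_left (r ^ 2) 1, lt_min hpos one_pos]
  have h3 := hle (σ ⟨y, hy⟩)
  rw [h, EuclideanGeometry.dist_inversion_center, div_le_one h1] at h3
  exact absurd h3 (not_le.2 h2)

/-- Möbius transformations are conformal. -/
theorem exists_conformalFactor {g : Equiv.Perm S2} (hg : g ∈ moebiusGroup) :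
    ∃ l : S2 → ℝ, (∀ x, 0 < l x) ∧ ∀ x y, dist (g x) (g y) = l x * l y * dist x y := by
  induction hg using Subgroup.closure_induction with
  | mem σ h =>
    rcases h with h | ⟨c, r, h⟩
    · exact ⟨fun _ => 1, fun _ => one_pos, fun x y => by rw [h.dist_eq]; ring⟩
    · have hne := ne_of_inversion_mem h
      have hr : r ≠ 0 := by
        rintro rfl
        let N : S2 := ⟨northPole, northPole_mem_sphere⟩
        let O : S2 := ⟨stereoInv 0, stereoInv_mem_sphere 0⟩
        have h1 : σ N = σ O := by
          apply Subtype.ext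
          rw [h, h]; simp [EuclideanGeometry.inversion]
        exact northPole_ne_stereoInv 0 (congrArg Subtype.val (σ.injective h1))
      refine ⟨fun x => |r| / dist (x : E3) c, fun x => div_pos (abs_pos.2 hr)
        (dist_pos.2 (hne x)), fun x y => ?_⟩
      rw [Subtype.dist_eq, h, h, EuclideanGeometry.dist_inversion_inversion (hne x) (hne y),
        ← sq_abs, Subtype.dist_eq]
      ring
  | one => exact ⟨fun _ => 1, fun _ => one_pos, fun x y => by simp⟩
  | mul g g' _ _ h h' =>
    obtain ⟨l, hl, h⟩ := h
    obtain ⟨l', hl', h'⟩ := h'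
    refine ⟨fun x => l (g' x) * l' x, fun x => mul_pos (hl _) (hl' _), fun x y => ?_⟩
    rw [Equiv.Perm.mul_apply, Equiv.Perm.mul_apply, h, h']
    ring
  | inv g _ h =>
    obtain ⟨l, hl, h⟩ := h
    refine ⟨fun x => (l (g⁻¹ x))⁻¹, fun x => inv_pos.2 (hl _), fun x y => ?_⟩
    have h1 := h (g⁻¹ x) (g⁻¹ y)
    have hg (z) : g (g⁻¹ z) = z := g.apply_symm_apply z
    rw [hg, hg] at h1
    have := (hl (g⁻¹ x)).ne'
    have := (hl (g⁻¹ y)).ne'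
    rw [h1]
    field_simp

theorem exists_moebius_of_isometry (L : E3 ≃ₗᵢ[ℝ] E3) {b : E3} (hb : L sphereCenter + b = sphereCenter) :
    ∃ g ∈ moebiusGroup, ∀ x : S2, (g x : E3) = L x + b := by
  let e : E3 ≃ᵢ E3 := L.toIsometryEquiv.trans (IsometryEquiv.addRight b)
  have he (x) : e x = L x + b := rfl
  have hmem (x : E3) : e x ∈ Metric.sphere sphereCenter (1 / 2) ↔ x ∈ Metric.sphere sphereCenter (1 / 2) := by
    rw [Metric.mem_sphere, Metric.mem_sphere, ← e.dist_eq x, he sphereCenter, hb]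
  let g : Equiv.Perm S2 := e.toEquiv.subtypeEquiv fun x => (hmem x).symm
  refine ⟨g, Subgroup.subset_closure (.inl (Isometry.of_dist_eq fun x y => ?_)), fun x => rfl⟩
  exact e.dist_eq x y

/-- Here `r²` is the power of `c` with respect to the sphere, so the sphere of inversion is
orthogonal to it and the inversion preserves it. -/
theorem exists_moebius_of_inversion {c : E3} {r : ℝ} (hr : 0 < r)
    (hc : r ^ 2 = dist c sphereCenter ^ 2 - 1 / 4) :
    ∃ g ∈ moebiusGroup, ∀ x : S2, (g x : E3) = EuclideanGeometry.inversion c r (x : E3) := by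
  have hmem (x : E3) (hx : x ∈ Metric.sphere sphereCenter (1 / 2)) :
      EuclideanGeometry.inversion c r x ∈ Metric.sphere sphereCenter (1 / 2) := by
    rw [Metric.mem_sphere] at hx
    have hxc : 0 < ‖x - c‖ := by
      rw [norm_sub_pos_iff]
      rintro rfl
      rw [hx] at hc
      nlinarith
    rw [dist_eq_norm] at hx hc
    rw [Metric.mem_sphere, dist_eq_norm, ← sq_eq_sq₀ (norm_nonneg _) (by norm_num),
      EuclideanGeometry.inversion, vsub_eq_sub, vadd_eq_add, add_sub_assoc, norm_add_sq_real,
      norm_smul, real_inner_smul_left, dist_eq_norm]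
    have h1 : ‖(x - c) + (c - sphereCenter)‖ = 1 / 2 := by rw [sub_add_sub_cancel, hx]
    have h2 := norm_add_sq_real (x - c) (c - sphereCenter)
    rw [h1] at h2
    have h3 : inner ℝ (x - c) (c - sphereCenter) = -(r ^ 2 + ‖x - c‖ ^ 2) / 2 := by
      linarith
    have h4 : ‖c - sphereCenter‖ ^ 2 = r ^ 2 + 1 / 4 := by linarith
    rw [h3, h4, Real.norm_of_nonneg (by positivity)]
    field_simp
    ring
  have hinv (x : E3) : EuclideanGeometry.inversion c r (EuclideanGeometry.inversion c r x) = x :=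
    EuclideanGeometry.inversion_inversion c hr.ne' x
  let f : S2 → S2 := fun x => ⟨_, hmem x x.2⟩
  have hf : Function.Involutive f := fun x => Subtype.ext (hinv x)
  exact ⟨hf.toPerm, Subgroup.subset_closure (.inr ⟨c, r, fun x => rfl⟩), fun x => rfl⟩

/-- A translation is a product of two reflections in parallel lines. The inversion, centred in the
tangent plane at the north pole and fixing that pole, induces the reflection in the bisector of `0`
and `α`; the linear reflection orthogonal to `α` follows. -/
theorem exists_moebius_translation (α : E2) : ∃ g ∈ moebiusGroup, ∀ x : S2,
    ((x : E3) = northPole → (g x : E3) = northPole) ∧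
    ∀ u, (x : E3) = stereoInv u → (g x : E3) = stereoInv (u - α) := by
  by_cases hα : α = 0
  · exact ⟨1, one_mem _, fun x => ⟨fun h => h, fun u h => by simpa [hα] using h⟩⟩
  have hn : 0 < ‖α‖ := norm_pos_iff.2 hα
  have hsq := E2.norm_sq α
  set A := ‖α‖ ^ 2 with hA
  have hApos : 0 < A := by positivity
  set a := α 0 with ha
  set b := α 1 with hb
  let c : E3 := !₂[a / A, b / A, 1]
  obtain ⟨g₁, hg₁, h₁⟩ := exists_moebius_of_inversion (c := c) (r := ‖α‖⁻¹) (inv_pos.2 hn) (by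
    rw [E3.dist_sq, inv_pow, ← hA]
    simp [c]
    field_simp
    linarith)
  obtain ⟨L, hL⟩ := exists_linearIsometryEquiv (e₁ := !₂[1 - 2 * a ^ 2 / A, -2 * a * b / A, 0])
    (e₂ := !₂[-2 * a * b / A, 1 - 2 * b ^ 2 / A, 0]) (e₃ := !₂[0, 0, 1])
    (by
      rw [← sq_eq_sq₀ (norm_nonneg _) one_pos.le, E3.norm_sq]
      simp
      field_simp
      rw [hsq]; ring)
    (by
      rw [← sq_eq_sq₀ (norm_nonneg _) one_pos.le, E3.norm_sq]
      simp
      field_simp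
      rw [hsq]; ring)
    (by
      rw [← sq_eq_sq₀ (norm_nonneg _) one_pos.le, E3.norm_sq]
      simp)
    (by
      rw [E3.inner_eq]
      simp
      field_simp
      rw [hsq]; ring)
    (by simp [E3.inner_eq]) (by simp [E3.inner_eq])
  have hL' (x : E3) : L x = !₂[(1 - 2 * a ^ 2 / A) * x 0 + -2 * a * b / A * x 1,
      -2 * a * b / A * x 0 + (1 - 2 * b ^ 2 / A) * x 1, x 2] := by
    obtain ⟨h0, h1, h2⟩ := hL x
    ext i
    fin_cases i
    · simpa [E3.inner_eq] using h0
    · simpa [E3.inner_eq] using h1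
    · simpa [E3.inner_eq] using h2
  obtain ⟨g₂, hg₂, h₂⟩ := exists_moebius_of_isometry L (b := 0) (by
    rw [hL']; ext i; fin_cases i <;> simp)
  refine ⟨g₂ * g₁, mul_mem hg₂ hg₁, fun x => ?_⟩
  rw [Equiv.Perm.mul_apply, h₂, h₁, add_zero, hL', EuclideanGeometry.inversion, div_pow, inv_pow,
    ← hA]
  constructor
  · intro hx
    have hd : dist northPole c ^ 2 = A⁻¹ := by
      rw [E3.dist_sq]
      simp [northPole, c]
      field_simp
      linarith
    rw [hx, hd, div_self (inv_ne_zero hApos.ne'), one_smul, vsub_vadd]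
    ext i
    fin_cases i <;> simp [northPole]
  · intro u hx
    have hu := (one_add_norm_sq_pos u).ne'
    have hu' := (one_add_norm_sq_pos (u - α)).ne'
    have hd : dist (stereoInv u) c ^ 2 = (1 + ‖u - α‖ ^ 2) / (A * (1 + ‖u‖ ^ 2)) := by
      rw [E3.dist_sq]
      simp only [stereoInv, c, Matrix.cons_val, E2.norm_sq, PiLp.sub_apply, ← ha, ← hb] at *
      field_simp
      rw [hsq]
      ring
    rw [hx, hd, stereoInv, stereoInv]
    have e : A⁻¹ / ((1 + ‖u - α‖ ^ 2) / (A * (1 + ‖u‖ ^ 2)))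
        = (1 + ‖u‖ ^ 2) / (1 + ‖u - α‖ ^ 2) := by field_simp
    rw [e]
    ext i
    fin_cases i
    · simp [c, E2.norm_sq, ← ha, ← hb] at hu hu' hsq ⊢
      field_simp
      rw [hsq]
      ring
    · simp [c, E2.norm_sq, ← ha, ← hb] at hu hu' hsq ⊢
      field_simp
      rw [hsq]
      ring
    · simp [c, E2.norm_sq, ← ha, ← hb] at hu hu' hsq ⊢
      field_simp
      ring

/-- A dilation is a product of two inversions in concentric circles. Both factors exchange the
poles: the inversion centred on the axis induces the circle inversion of squared radius `1 / l`, and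
the reflection `z ↦ 1 - z` that in the unit circle. -/
theorem exists_moebius_dilation {l : ℝ} (hl : 0 < l) : ∃ g ∈ moebiusGroup, ∀ x : S2,
    ((x : E3) = northPole → (g x : E3) = northPole) ∧
    ∀ u, (x : E3) = stereoInv u → (g x : E3) = stereoInv (l • u) := by
  by_cases hl1 : l = 1
  · exact ⟨1, one_mem _, fun x => ⟨fun h => h, fun u h => by simpa [hl1] using h⟩⟩
  have hl2 : 1 - l ≠ 0 := sub_ne_zero.2 (Ne.symm hl1)
  let c : E3 := !₂[0, 0, 1 / (1 - l)]
  have hr : √(l / (1 - l) ^ 2) ^ 2 = l / (1 - l) ^ 2 := Real.sq_sqrt (by positivity)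
  obtain ⟨g₁, hg₁, h₁⟩ := exists_moebius_of_inversion (c := c) (r := √(l / (1 - l) ^ 2))
    (by positivity) (by
    rw [E3.dist_sq, hr]
    simp [c]
    field_simp
    ring)
  obtain ⟨L, hL⟩ := exists_linearIsometryEquiv (e₁ := !₂[1, 0, 0])
    (e₂ := !₂[0, 1, 0]) (e₃ := !₂[0, 0, -1])
    (by rw [← sq_eq_sq₀ (norm_nonneg _) one_pos.le, E3.norm_sq]; simp)
    (by rw [← sq_eq_sq₀ (norm_nonneg _) one_pos.le, E3.norm_sq]; simp)
    (by rw [← sq_eq_sq₀ (norm_nonneg _) one_pos.le, E3.norm_sq]; simp)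
    (by simp [E3.inner_eq]) (by simp [E3.inner_eq]) (by simp [E3.inner_eq])
  have hL' (x : E3) : L x = !₂[x 0, x 1, -x 2] := by
    obtain ⟨h0, h1, h2⟩ := hL x
    ext i
    fin_cases i
    · simpa [E3.inner_eq] using h0
    · simpa [E3.inner_eq] using h1
    · simpa [E3.inner_eq] using h2
  obtain ⟨g₂, hg₂, h₂⟩ := exists_moebius_of_isometry L (b := !₂[0, 0, 1]) (by
    rw [hL']; ext i; fin_cases i <;> simp; norm_num)
  refine ⟨g₂ * g₁, mul_mem hg₂ hg₁, fun x => ?_⟩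
  rw [Equiv.Perm.mul_apply, h₂, h₁, hL', EuclideanGeometry.inversion, div_pow, hr]
  constructor
  · intro hx
    have hd : dist northPole c ^ 2 = (l / (1 - l)) ^ 2 := by
      rw [E3.dist_sq]
      simp [northPole, c]
      field_simp
      ring
    rw [hx, hd]
    ext i
    fin_cases i
    · simp [northPole, c]
    · simp [northPole, c]
    · simp [northPole, c]
      field_simp
      ring
  · intro u hx
    have hu := (one_add_norm_sq_pos u).ne'
    have hu' := (one_add_norm_sq_pos (l • u)).ne'
    have hd : dist (stereoInv u) c ^ 2 =
        (1 + ‖l • u‖ ^ 2) / ((1 - l) ^ 2 * (1 + ‖u‖ ^ 2)) := by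
      rw [E3.dist_sq]
      simp only [stereoInv, c, Matrix.cons_val, E2.norm_sq, PiLp.smul_apply, smul_eq_mul] at *
      field_simp
      ring
    have e : l / (1 - l) ^ 2 / ((1 + ‖l • u‖ ^ 2) / ((1 - l) ^ 2 * (1 + ‖u‖ ^ 2)))
        = l * (1 + ‖u‖ ^ 2) / (1 + ‖l • u‖ ^ 2) := by field_simp
    rw [hx, hd, e, stereoInv, stereoInv]
    ext i
    fin_cases i
    · simp [c, E2.norm_sq] at hu hu' ⊢
      field_simp
    · simp [c, E2.norm_sq] at hu hu' ⊢
      field_simp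
    · simp [c, E2.norm_sq] at hu hu' ⊢
      field_simp
      ring

end Moebius

/-! ### Cross ratios and moduli up to Möbius transformations. -/

section CrossRatio

/-- The absolute cross ratio of four points. -/
noncomputable def crossRatio (a b c d : S2) : ℝ := dist a b * dist c d / (dist a d * dist c b)

/-- Every point occurs once above and once below, so the conformal factors cancel. -/
theorem crossRatio_moebius {g : Equiv.Perm S2} (hg : g ∈ moebiusGroup) (a b c d : S2) :
    crossRatio (g a) (g b) (g c) (g d) = crossRatio a b c d := by
  obtain ⟨l, hl, h⟩ := exists_conformalFactor hg
  have e : l a * l b * (l c * l d) ≠ 0 :=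
    (mul_pos (mul_pos (hl a) (hl b)) (mul_pos (hl c) (hl d))).ne'
  simp only [crossRatio, h]
  rw [← mul_div_mul_left (dist a b * dist c d) (dist a d * dist c b) e]
  congr 1 <;> ring

/-- With the third point at infinity only a ratio of plane distances from the first point remains.
-/
theorem crossRatio_northPole {a b c d : S2} {x y z : E2} (ha : (a : E3) = stereoInv x)
    (hb : (b : E3) = stereoInv y) (hc : (c : E3) = northPole) (hd : (d : E3) = stereoInv z) :
    crossRatio a b c d = dist x y / dist x z := by
  have hx := (stereoFactor_pos x).ne'
  have hy := (stereoFactor_pos y).ne'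
  have hz := (stereoFactor_pos z).ne'
  simp only [crossRatio, Subtype.dist_eq, ha, hb, hc, hd, dist_stereoInv, dist_northPole_stereoInv]
  have e : stereoFactor x * stereoFactor y * stereoFactor z ≠ 0 := mul_ne_zero (mul_ne_zero hx hy) hz
  rw [← mul_div_mul_left (dist x y) (dist x z) e]
  congr 1 <;> ring

theorem continuous_crossRatio {X : Type*} [TopologicalSpace X] {a b c d : X → S2}
    (ha : Continuous a) (hb : Continuous b) (hc : Continuous c) (hd : Continuous d)
    (had : ∀ x, a x ≠ d x) (hcb : ∀ x, c x ≠ b x) :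
    Continuous fun x => crossRatio (a x) (b x) (c x) (d x) :=
  ((ha.dist hb).mul (hc.dist hd)).div ((ha.dist hd).mul (hc.dist hb)) fun x =>
    mul_ne_zero (dist_ne_zero.2 (had x)) (dist_ne_zero.2 (hcb x))

theorem continuous_forwardDiff {m : ℕ} : Continuous (forwardDiff (m := m)) := by
  refine continuous_pi fun i => ?_
  unfold forwardDiff
  split_ifs <;> fun_prop

variable {k : ℕ}

theorem InterlacedRadii.smul {m : ℕ} {p q : Fin m → ℝ} (h : InterlacedRadii p q) {l : ℝ}
    (hl : 0 < l) : InterlacedRadii (l • p) (l • q) where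
  p_pos i := mul_pos hl (h.p_pos i)
  p_mono _ _ hij := mul_lt_mul_of_pos_left (h.p_mono hij) hl
  q_pos i := mul_pos hl (h.q_pos i)
  q_mono _ _ hij := mul_lt_mul_of_pos_left (h.q_mono hij) hl
  mul_eq i j hij := by
    simp only [Pi.smul_apply, smul_eq_mul]
    linear_combination l ^ 2 * h.mul_eq i j hij

theorem exists_moebius_wedgePoint {v : WedgeVertex k → S2} {α : E2} {p q : Fin (k - 4) → ℝ}
    {γ : ℝ} (hv : ∀ x, (v x : E3) = wedgePoint α p q γ x) {l : ℝ} (hl : 0 < l) :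
    ∃ g ∈ moebiusGroup, ∀ x, (g (v x) : E3) = wedgePoint 0 (l • p) (l • q) γ x := by
  obtain ⟨g, hg, h⟩ := exists_moebius_translation α
  obtain ⟨g', hg', h'⟩ := exists_moebius_dilation hl
  refine ⟨g' * g, mul_mem hg' hg, fun x => ?_⟩
  have key (u : E2) (w : E2) (hx : (v x : E3) = stereoInv u) (huw : l • (u - α) = w) :
      ((g' * g) (v x) : E3) = stereoInv w := by
    rw [← huw]
    exact (h' _).2 _ ((h _).2 _ hx)
  rcases x with _ | _ | i | i
  · exact (h' _).1 ((h _).1 (hv _))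
  · exact key _ _ (hv _) (by simp)
  · refine key _ _ (hv _) ?_
    ext j; fin_cases j <;> simp
  · refine key _ _ (hv _) ?_
    ext j; fin_cases j <;> simp [mul_assoc]

variable [NeZero (k - 4)]

/-- For the sphere of radius `1 / 2` the scaling factor of `exists_similarity` is `1`, so the
similarity is an isometry of `S2`. A translation and a dilation of the plane finish the
normalization. -/
theorem exists_moebius_normalForm (hk : 5 ≤ k) (v : SphericalRealization k) :
    ∃ g ∈ moebiusGroup, ∃ (p q : Fin (k - 4) → ℝ) (γ : ℝ), γ ∈ Ioo 0 Real.pi ∧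
      InterlacedRadii p q ∧ p 0 = 1 ∧ ∀ x, (g (v.1 x) : E3) = wedgePoint 0 p q γ x := by
  obtain ⟨-, L, α, p, q, γ, hγ, hpq, heq, hL⟩ := v.2.exists_similarity hk
    (c := sphereCenter) (r := 1 / 2) fun x => (v.1 x).2
  have hsub : L sphereCenter + (northPole - L (v.1 .north)) = sphereCenter := by
    rw [add_sub_left_comm, ← map_sub, hL]
    ext i
    fin_cases i <;> norm_num [northPole]
  obtain ⟨g, hg, h⟩ := exists_moebius_of_isometry L hsub
  have h0 := hpq.p_pos 0
  obtain ⟨g', hg', h'⟩ := exists_moebius_wedgePoint (v := fun x => g (v.1 x)) (α := α) (p := p)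
    (q := q) (γ := γ) (fun x => by
      rw [h, ← congrFun heq x, map_sub]
      norm_num
      abel) (inv_pos.2 h0)
  exact ⟨g' * g, mul_mem hg' hg, _, _, γ, hγ, hpq.smul (inv_pos.2 h0),
    inv_mul_cancel₀ h0.ne', h'⟩

/-- The parameters of a realization on `S2` up to Möbius transformations. -/
noncomputable def moebiusInvariant (v : WedgeVertex k → S2) : (Fin (k - 4) → ℝ) × ℝ × ℝ :=
  let δ := crossRatio (v .south) (v (.q 0)) (v .north) (v (.p 0))
  let κ := crossRatio (v (.p 0)) (v (.q 0)) (v .north) (v .south)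
  (forwardDiff fun i => crossRatio (v .south) (v (.p 0)) (v .north) (v (.p i)),
    -- Law of cosines in the plane triangle `south`, `p 0`, `q 0`, whose sides in normal form are
    -- `1`, `δ` and `κ`.
    Real.arccos ((1 + δ ^ 2 - κ ^ 2) / (2 * δ)), δ)

theorem moebiusInvariant_moebius {g : Equiv.Perm S2} (hg : g ∈ moebiusGroup)
    (v : WedgeVertex k → S2) : moebiusInvariant (fun x => g (v x)) = moebiusInvariant v := by
  simp only [moebiusInvariant, crossRatio_moebius hg]

theorem moebiusInvariant_wedgePoint {v : WedgeVertex k → S2} {p q : Fin (k - 4) → ℝ} {γ : ℝ}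
    (hv : ∀ x, (v x : E3) = wedgePoint 0 p q γ x) (hp : ∀ i, 0 < p i) (hp0 : p 0 = 1)
    (hq : 0 < q 0) (hγ : γ ∈ Ioo 0 Real.pi) :
    moebiusInvariant v = (forwardDiff fun i => 1 / p i, γ, q 0) := by
  have hpn (i) : ‖(!₂[p i, 0] : E2)‖ = p i :=
    (sq_eq_sq₀ (norm_nonneg _) (hp i).le).1 (norm_sq_axis _)
  have hqn : ‖(!₂[q 0 * Real.cos γ, q 0 * Real.sin γ] : E2)‖ = q 0 :=
    (sq_eq_sq₀ (norm_nonneg _) hq.le).1 (norm_sq_polar _ _)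
  have hδ : crossRatio (v .south) (v (.q 0)) (v .north) (v (.p 0)) = q 0 := by
    rw [crossRatio_northPole (hv _) (hv _) (hv _) (hv _)]
    simp only [zero_add, dist_zero_left, hqn, hpn]
    rw [hp0, div_one]
  have hκ : crossRatio (v (.p 0)) (v (.q 0)) (v .north) (v .south) ^ 2
      = 1 + q 0 ^ 2 - 2 * q 0 * Real.cos γ := by
    rw [crossRatio_northPole (hv _) (hv _) (hv _) (hv _)]
    simp only [zero_add, dist_zero_right, hpn]
    rw [hp0, div_one, dist_eq_norm, E2.norm_sq]
    simp only [PiLp.sub_apply, Matrix.cons_val]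
    linear_combination q 0 ^ 2 * Real.sin_sq_add_cos_sq γ
  have hw (i) : crossRatio (v .south) (v (.p 0)) (v .north) (v (.p i)) = 1 / p i := by
    rw [crossRatio_northPole (hv _) (hv _) (hv _) (hv _)]
    simp only [zero_add, dist_zero_left, hpn]
    rw [hp0]
  simp only [moebiusInvariant, hδ, hκ, hw]
  rw [show (1 + q 0 ^ 2 - (1 + q 0 ^ 2 - 2 * q 0 * Real.cos γ)) / (2 * q 0) = Real.cos γ by
    field_simp; ring, Real.arccos_cos hγ.1.le hγ.2.le]

theorem continuous_moebiusInvariant :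
    Continuous fun v : SphericalRealization k => moebiusInvariant v.1 := by
  have hy (y) : Continuous fun v : SphericalRealization k => v.1 y :=
    (continuous_apply y).comp continuous_subtype_val
  have hne {y z : WedgeVertex k} (hyz : y ≠ z) (v : SphericalRealization k) : v.1 y ≠ v.1 z :=
    fun h => hyz (v.2.1.1.injective (congrArg Subtype.val h))
  have hδ := continuous_crossRatio (hy .south) (hy (.q 0)) (hy .north) (hy (.p 0))
    (hne (by simp)) (hne (by simp))
  have hκ := continuous_crossRatio (hy (.p 0)) (hy (.q 0)) (hy .north) (hy .south)
    (hne (by simp)) (hne (by simp))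
  have hδ0 (v : SphericalRealization k) :
      crossRatio (v.1 .south) (v.1 (.q 0)) (v.1 .north) (v.1 (.p 0)) ≠ 0 := by
    have hd {y z : WedgeVertex k} (hyz : y ≠ z) := dist_ne_zero.2 (hne hyz v)
    exact div_ne_zero (mul_ne_zero (hd (by simp)) (hd (by simp)))
      (mul_ne_zero (hd (by simp)) (hd (by simp)))
  refine Continuous.prodMk (continuous_forwardDiff.comp (continuous_pi fun i =>
    continuous_crossRatio (hy _) (hy _) (hy _) (hy _) (hne (by simp)) (hne (by simp))))
    (Continuous.prodMk (Real.continuous_arccos.comp (Continuous.div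
      ((continuous_const.add (hδ.pow 2)).sub (hκ.pow 2)) (continuous_const.mul hδ)
      fun v => mul_ne_zero two_ne_zero (hδ0 v))) hδ)

theorem exists_homeomorph_moebiusRealizationSpace (hk : 5 ≤ k) :
    ∃ Φ : moebiusParameters k (fun w => zigzagDomain (simplexRadii w)) ≃ₜ
        MoebiusRealizationSpace k,
      ∀ z : moebiusParameters k (fun w => zigzagDomain (simplexRadii w)),
        ∃ v : SphericalRealization k,
          InPosition (fun y => (v.1 y : E3)) 0 (fun i => 1 / ∑ j ∈ Finset.Ici i, z.1.1 j)
            z.1.2.1 z.1.2.2 ∧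
          Φ z = Quotient.mk (moebiusSetoid k) v := by
  set Z := moebiusParameters k (fun w => zigzagDomain (simplexRadii w)) with hZ
  have hpos (z : Z) := simplexRadii_pos z.2.1.1
  have hpq (z : Z) : InterlacedRadii (simplexRadii z.1.1) (zigzag (simplexRadii z.1.1) z.1.2.2) :=
    interlacedRadii_zigzag (hpos z) (strictMono_one_div_sum_Ici z.2.1.1) z.2.2.2
  have hsin (z : Z) : Real.sin z.1.2.1 ≠ 0 := (Real.sin_pos_of_mem_Ioo z.2.2.1).ne'
  have hz0 (z : Z) : zigzag (simplexRadii z.1.1) z.1.2.2 0 = z.1.2.2 :=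
    zigzag_zero (hpos z 0).ne' _
  have hone (z : Z) : simplexRadii z.1.1 0 = 1 := by
    rw [simplexRadii, sum_Ici_of_eq_zero _ rfl, z.2.1.2, div_one]
  let nf : Z → SphericalRealization k := fun z =>
    ⟨fun y => ⟨wedgePoint 0 (simplexRadii z.1.1) (zigzag (simplexRadii z.1.1) z.1.2.2) z.1.2.1 y,
      wedgePoint_mem_sphere y⟩, (hpq z).isWedgeRealization hk _ (hsin z)⟩
  have hnf : Continuous nf := by
    have hP : Continuous fun z : Z => simplexRadii z.1.1 :=
      continuousOn_simplexRadii.comp_continuous (by fun_prop) fun z => z.2.1.1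
    have hw := continuous_wedgePoint (X := Z) (α := fun _ => 0) continuous_const hP
      (continuousOn_zigzag.comp_continuous (hP.prodMk (by fun_prop : Continuous fun z : Z =>
        z.1.2.2)) fun z => ⟨(hpos z 0).ne', z.2.2.2.1.ne'⟩)
      (by fun_prop : Continuous fun z : Z => z.1.2.1)
    exact Continuous.subtype_mk (continuous_pi fun y =>
      ((continuous_apply y).comp hw).subtype_mk _) _
  have hleft (z : Z) : moebiusInvariant (nf z).1 = z.1 := by
    rw [moebiusInvariant_wedgePoint (fun x => rfl) (hpos z) (hone z) ((hpq z).q_pos 0) z.2.2.1, hz0]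
    refine Prod.ext ?_ rfl
    simp only [simplexRadii, one_div_one_div]
    exact forwardDiff_sum_Ici _
  have hrel (v w : SphericalRealization k) (h : moebiusSetoid k v w) :
      moebiusInvariant v.1 = moebiusInvariant w.1 := by
    obtain ⟨g, hg, h⟩ := h
    rw [← moebiusInvariant_moebius hg v.1]
    exact congrArg moebiusInvariant (funext h)
  -- The condition `p 0 = 1` becomes `∑ w = 1`, since the differences of the reciprocal radii
  -- telescope to `1 / p 0`.
  have hsurj (v : SphericalRealization k) : ∃ z, moebiusSetoid k v (nf z) := by
    obtain ⟨g, hg, p, q, γ, hγ, hpq, hp0, h⟩ := exists_moebius_normalForm hk v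
    have hrad : simplexRadii (forwardDiff fun i => 1 / p i) = p := funext fun i => by
      rw [simplexRadii, sum_Ici_forwardDiff, one_div_one_div]
    have hw (i) : 0 < forwardDiff (fun i => 1 / p i) i := by
      unfold forwardDiff
      split_ifs with hi
      · exact sub_pos.2 (one_div_lt_one_div_of_lt (hpq.p_pos i)
          (hpq.p_mono (Fin.lt_def.2 (Nat.lt_succ_self _))))
      · exact one_div_pos.2 (hpq.p_pos i)
    refine ⟨⟨(forwardDiff fun i => 1 / p i, γ, q 0), ⟨hw, ?_⟩, hγ, ?_⟩, g, hg, fun x => ?_⟩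
    · rw [← sum_Ici_of_eq_zero _ (Fin.val_zero (k - 4)), sum_Ici_forwardDiff, hp0, div_one]
    · change q 0 ∈ zigzagDomain (simplexRadii (forwardDiff fun i => 1 / p i))
      rw [hrad]; exact hpq.mem_zigzagDomain
    · refine Subtype.ext ((h x).trans ?_)
      change _ = wedgePoint 0 (simplexRadii (forwardDiff fun i => 1 / p i))
        (zigzag (simplexRadii (forwardDiff fun i => 1 / p i)) (q 0)) γ x
      rw [hrad, ← hpq.eq_zigzag]
  obtain ⟨Φ, hΦ⟩ := exists_homeomorph_quotient (moebiusSetoid k) hnf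
    continuous_moebiusInvariant hrel hleft hsurj
  refine ⟨Φ, fun z => ⟨nf z, ?_, hΦ z⟩⟩
  have := inPosition_wedgePoint (α := 0) (p := simplexRadii z.1.1)
    (q := zigzag (simplexRadii z.1.1) z.1.2.2) (γ := z.1.2.1)
  rw [hz0] at this
  exact this

end CrossRatio

/-- The case `q = p` satisfies the product relations trivially and supplies an inscribed realization
for every `k`. -/
theorem interlacedRadii_self {m : ℕ} :
    InterlacedRadii (fun i : Fin m => (i.val : ℝ) + 1) fun i => (i.val : ℝ) + 1 where
  p_pos i := by positivity
  p_mono i j h := by simpa using h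
  q_pos i := by positivity
  q_mono i j h := by simpa using h
  mul_eq _ _ _ := rfl

theorem proposition3p1 (k : ℕ) (hk : 5 ≤ k) :
    -- up to Möbius transformations: the normal forms
    (∃ I : (Fin (k - 4) → ℝ) → Set ℝ,
      (∀ w ∈ openSimplex k, IsPosOpenInterval (I w)) ∧
      ∃ Φ : moebiusParameters k I ≃ₜ MoebiusRealizationSpace k,
        ∀ z : moebiusParameters k I, ∃ v : SphericalRealization k,
          InPosition (fun y => (v.1 y : E3)) 0 (fun i => 1 / ∑ j ∈ Finset.Ici i, z.1.1 j)
            z.1.2.1 z.1.2.2 ∧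
          Φ z = Quotient.mk (moebiusSetoid k) v) ∧
    -- up to Möbius transformations: the product and the open ball
    Nonempty (MoebiusRealizationSpace k ≃ₜ
      openSimplex k × Ioo (0 : ℝ) Real.pi × Ioo (0 : ℝ) 1) ∧
    Nonempty (MoebiusRealizationSpace k ≃ₜ
      Metric.ball (0 : EuclideanSpace ℝ (Fin (k - 3))) 1) ∧
    -- up to isometries and homotheties
    (∃ J : E2 → (Fin (k - 4) → ℝ) → ℝ → Set ℝ,
      (∀ α β γ, (∀ i, 0 < β i) → γ ∈ Ioo 0 Real.pi → IsPosOpenInterval (J α β γ)) ∧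
      (∃ Ψ : wedgeParameters k J ≃ₜ SimilarityRealizationSpace k,
        ∀ z : wedgeParameters k J, ∃ v : InscribedRealization k,
          InPosition v.1 z.1.1 (fun i => ∑ j ∈ Finset.Iic i, z.1.2.1 j) z.1.2.2.1 z.1.2.2.2 ∧
          Ψ z = Quotient.mk (similaritySetoid k) v) ∧
      ContractibleSpace (wedgeParameters k J) ∧
      IsOpen (wedgeParameters k J) ∧
      Module.finrank ℝ (E2 × (Fin (k - 4) → ℝ) × ℝ × ℝ) = k) ∧
    -- every facet of the dual of the cyclic polytope is inscribable
    (∀ t : Fin k → ℝ, StrictMono t →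
      ∀ (m : ℕ) (u : Fin m → EuclideanSpace ℝ (Fin 4)), IsPolytope u →
        IsDual u (cyclicPolytope 4 t) →
        ∀ S : Set (Fin m), IsFacet u S → IsInscribable3 fun i : S => u i) := by

  have : NeZero (k - 4) := ⟨by lia⟩
  obtain ⟨Φ, hΦ⟩ := exists_homeomorph_moebiusRealizationSpace hk
  obtain ⟨Ψ, hΨ⟩ := exists_homeomorph_similarityRealizationSpace hk
  obtain ⟨e⟩ := nonempty_homeomorph_ball hk
  have hprod := Φ.symm.trans moebiusParametersHomeo
  refine ⟨⟨_, fun w hw => isPosOpenInterval_zigzagDomain (simplexRadii_pos hw.1)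
    (strictMono_one_div_sum_Ici hw.1), Φ, hΦ⟩, ⟨hprod⟩, ⟨hprod.trans e⟩,
    ⟨_, fun _ β _ hβ _ => isPosOpenInterval_zigzagDomain (sum_Iic_pos hβ)
      (strictMono_sum_Iic hβ), ⟨Ψ, hΨ⟩, contractibleSpace_wedgeParameters,
      isOpen_wedgeParameters, by simp; lia⟩, fun t ht m u _ hdual S hS => ?_⟩
  exact isInscribable3_of_isFacet_of_isDual hk
    (interlacedRadii_self.isWedgeRealization hk 0 (γ := Real.pi / 2) (by simp))
    ⟨_, _, wedgePoint_mem_sphere⟩ ht hdual hS
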